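/- Let $M$ be a smooth manifold (Hausdorff, second countable, finite-dimensional, without boundary) and let $A\to M$ be a Lie algebroid: a smooth real vector bundle of finite rank with a smooth bundle map $\rho:A\to TM$ (the anchor) and a Lie bracket on $\Gamma(A)$ such that $[\alpha,f\beta]=f[\alpha,\beta]+L_{\rho(\alpha)}(f)\beta$. Elements of $S^iA^*$ are viewed as symmetric $i$-linear forms on $A$ (the symmetric product being the sum over shuffles), and sections of $\Lambda^uT^*M\otimes S^iA^*\otimes\Lambda^wA^*$ as the corresponding $C^\infty(M)$-multilinear functions of vector fields and sections of $A$. **Intrinsic model.** An element $c\in W^{p,q}(A)$ is a string $c=(c_0,c_1,\dots)$, $0\le i\le \min(p,q)$, of antisymmetric $\mathbb R$-multilinear maps $$c_i:\Gamma(A)^{p-i}\to\Omega^{q-i}(M;S^iA^*)$$ with $$c_i(\alpha_1,\dots,f\alpha_{p-i})=f\,c_i(\alpha_1,\dots,\alpha_{p-i})-df\wedge c_{i+1}(\alpha_1,\dots,\alpha_{p-i-1})(\alpha_{p-i})$$ (the last symmetric-form argument plugged in; $c_{i+1}=0$ for $i+1>\min(p,q)$), and $W(A)=\bigoplus_{p,q}W^{p,q}(A)$.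 The product of $c\in W^{p,q}(A)$ and $c'\in W^{p',q'}(A)$ is $$(cc')_k(\alpha_1,\dots,\alpha_{p+p'-k})=\sum_{i+j=k}(-1)^{(q-i)(p'-j)}\sum_{\sigma}\mathrm{sgn}(\sigma)\,c_i(\alpha_{\sigma(1)},\dots,\alpha_{\sigma(p-i)})\cdot c'_j(\alpha_{\sigma(p-i+1)},\dots,\alpha_{\sigma(p+p'-k)}),$$ the inner sum running over $(p-i,p'-j)$-shuffles and $\cdot$ being the wedge product of forms combined with the symmetric product. The differentials are $$(d^{\rm hor}c)_k(\alpha_1,\dots,\alpha_{w})=\sum_{i<j}(-1)^{i+j}c_k([\alpha_i,\alpha_j],\dots,\hat\alpha_i,\dots,\hat\alpha_j,\dots)+\sum_i(-1)^{i+1}L_{\alpha_i}\big(c_k(\dots,\hat\alpha_i,\dots)\big)+(\tau c)_k(\alpha_1,\dots,\alpha_w),\qquad w=p+1-k,$$ $$(\tau c)_k(\alpha_1,\dots,\alpha_w)(\beta_1,\dots,\beta_k)=-(-1)^{w}\sum_j i_{\rho(\beta_j)}\big(c_{k-1}(\alpha_1,\dots,\alpha_w)(\beta_1,\dots,\hat\beta_j,\dots,\beta_k)\big),$$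 where $L_\alpha$ is $L_{\rho(\alpha)}$ on forms and dual to $[\alpha,\cdot]$ on $A^*$ (so $\tau c$ has no $0$-th component), and $$(d^{\rm ver}c)_k(\alpha_1,\dots,\alpha_w)(\beta_1,\dots,\beta_k)=(-1)^{w}d_{DR}\big(c_k(\alpha_1,\dots,\alpha_w)(\beta_1,\dots,\beta_k)\big)+\sum_j c_{k-1}(\beta_j,\alpha_1,\dots,\alpha_w)(\beta_1,\dots,\hat\beta_j,\dots,\beta_k),\qquad w=p-k .$$ **Connection-dependent model.** For a connection $\nabla$ on the vector bundle $A$ put $R_\nabla(X,Y)\alpha=\nabla_X\nabla_Y\alpha-\nabla_Y\nabla_X\alpha-\nabla_{[X,Y]}\alpha$, $\nabla^{\rm bas}_\alpha\beta=\nabla_{\rho(\beta)}\alpha+[\alpha,\beta]$, $\nabla^{\rm bas}_\alpha X=\rho(\nabla_X\alpha)+[\rho(\alpha),X]$ and $R^{\rm bas}_\nabla(\alpha,\beta)X=\nabla_X[\alpha,\beta]-[\nabla_X\alpha,\beta]-[\alpha,\nabla_X\beta]-\nabla_{\nabla^{\rm bas}_\beta X}\alpha+\nabla_{\nabla^{\rm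 bas}_\alpha X}\beta$. Let $W^{p,q}(A,\nabla)=\bigoplus_i\Gamma(\Lambda^{q-i}T^*M\otimes S^iA^*\otimes\Lambda^{p-i}A^*)$, with the product given by the same formula, and let $$d^{\rm hor}_\nabla=-\rho^*+(\nabla^{\rm bas})^*+(R^{\rm bas}_\nabla)^*,\qquad d^{\rm ver}_\nabla=\mathrm{Id}^*+\nabla^*+(R_\nabla)^*,$$ where: $(\nabla^{\rm bas})^*$ is the Koszul differential in the $\Lambda A^*$-arguments for the connection dual to $\nabla^{\rm bas}$ on $\Lambda T^*M\otimes SA^*$; $\nabla^*$ is $(-1)^w$ times (on components with $w$ arguments in $\Lambda A^*$) the exterior covariant derivative for the connection dual to $\nabla$ on $\Lambda A^*\otimes SA^*$; and $-\rho^*$, $\mathrm{Id}^*$, $(R^{\rm bas}_\nabla)^*$, $(R_\nabla)^*$ are the $C^\infty(M)$-linear odd graded derivations (for the total degree $p+q$) which vanish on the generators not listed and satisfy, for $\omega\in\Omega^1(M)$, $\theta\in\Gamma(\Lambda^1A^*)$, $\mu\in\Gamma(S^1A^*)$: $(-\rho^*\omega)(\beta)=-\omega(\rho(\beta))$ in $S^1A^*$,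 $\mathrm{Id}^*\theta=\theta$ in $S^1A^*$, $((R^{\rm bas}_\nabla)^*\mu)(\alpha,\alpha'|X)=\mu(R^{\rm bas}_\nabla(\alpha,\alpha')X)$ and $((R_\nabla)^*\mu)(\alpha|X,Y)=\mu(R_\nabla(X,Y)\alpha)$. **Theorem.** (1) With $d^{\rm hor}$ and $d^{\rm ver}$, $W(A)$ is a differential bigraded algebra: a bigraded associative unital algebra, graded commutative for the total degree $p+q$, on which $d^{\rm hor}$ (of bidegree $(1,0)$) and $d^{\rm ver}$ (of bidegree $(0,1)$) are graded derivations with $(d^{\rm hor})^2=(d^{\rm ver})^2=d^{\rm hor}d^{\rm ver}+d^{\rm ver}d^{\rm hor}=0$. (2) For every connection $\nabla$ on $A$, $W(A,\nabla)$ with $d^{\rm hor}_\nabla$, $d^{\rm ver}_\nabla$ is a differential bigraded algebra in the same sense, and $W(A)$ is canonically isomorphic to it: there is exactly one isomorphism of differential bigraded algebras $\phi_\nabla:W(A)\to W(A,\nabla)$ which is the identity in bidegrees $(0,0)$, $(1,0)$, $(0,1)$ and is given on $c=(c_0,c_1)\in W^{1,1}(A)$ by $$(\phi_\nabla c)_0(\alpha)(X)=c_0(\alpha)(X)+c_1(\nabla_X\alpha),\qquad(\phi_\nabla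 c)_1=c_1 .$$ -/

import Mathlib

open scoped Manifold ContDiff

/-! ## Cochains in three kinds of arguments

Throughout the algebraic part, `R` plays the role of `C^∞(M)`, `X` of the vector fields on `M`
and `G` of the sections of a Lie algebroid `A` over `M`. -/

namespace WeilAlgebra

/-- A family of functions `c w v u (α₁,…,α_w) (β₁,…,β_v) (X₁,…,X_u)`.  The function
`c w v u α β` is the value, on sections `β` and vector fields `X`, of an element of
`Ω^u(M; S^v A^*)` which depends on the `w` sections `α`.  Elements of `S^v A^*` are viewed as
symmetric `v`-linear forms on `A`. -/
abbrev Cochain (R G X : Type*) : Type _ :=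
  ∀ w v u : ℕ, (Fin w → G) → (Fin v → G) → (Fin u → X) → R

/-- Families of functions `P v u (β₁,…,β_v) (X₁,…,X_u)`: (inhomogeneous) elements of
`Ω(M; S A^*)`, written as functions of their arguments. -/
abbrev PolyForm (R G X : Type*) : Type _ :=
  ∀ v u : ℕ, (Fin v → G) → (Fin u → X) → R

/-- Families of functions `Q w v (α₁,…,α_w) (β₁,…,β_v)`: (inhomogeneous) sections of
`Λ A^* ⊗ S A^*`, written as functions of their arguments. -/
abbrev DualTensor (R G : Type*) : Type _ :=
  ∀ w v : ℕ, (Fin w → G) → (Fin v → G) → R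

/-- The operations which enter the formulas below: the action `act x f = L_x f` of vector fields
on functions, the Lie bracket of vector fields, the Lie bracket of sections of `A`, and the
anchor. -/
structure Operations (R G X : Type*) where
  act : X → R → R
  lieX : X → X → X
  lieG : G → G → G
  anchor : G → X

section Formulas

variable {R G X : Type*} [CommRing R]

/-- The Koszul formula
`∑ᵢ (-1)^{i+1} L_{xᵢ}(η(x₁,…,x̂ᵢ,…)) + ∑_{i<j} (-1)^{i+j} η([xᵢ,xⱼ],x₁,…,x̂ᵢ,…,x̂ⱼ,…)`,
written with indices starting at `0`, so that the sign in the first sum is `(-1)^i`.  In the second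
sum the pair `i < j` is `(i.castSucc, j)`. -/
def koszul {P N : Type*} [AddCommGroup N] (br : P → P → P) (L : P → N → N)
    (η : ∀ n, (Fin n → P) → N) : ∀ n, (Fin n → P) → N
  | 0, _ => 0
  | 1, x => L (x 0) (η 0 (Fin.removeNth 0 x))
  | n + 2, x =>
      (∑ i : Fin (n + 2), (-1 : ℤ) ^ (i : ℕ) • L (x i) (η (n + 1) (i.removeNth x))) +
      ∑ j : Fin (n + 2), ∑ i : Fin (n + 1),
        if i.castSucc < j then
          (-1 : ℤ) ^ ((i : ℕ) + (j : ℕ)) •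
            η (n + 1) (Fin.cons (br (x i.castSucc) (x j)) (i.removeNth (j.removeNth x)))
        else 0

/-! ### The product -/

/-- The sign of the shuffle which lists first the elements of `S` and then those of its
complement. -/
def shuffleSign {n : ℕ} (S : Finset (Fin n)) : ℤ :=
  (-1) ^ ((S ×ˢ Sᶜ).filter fun p => p.2 < p.1).card

/-- The arguments with index in `S`, in increasing order. -/
def pick {P : Type*} {n : ℕ} (x : Fin n → P) (S : Finset (Fin n)) : Fin S.card → P :=
  fun i => x (S.orderEmbOfFin rfl i)

/-- The product: the sum over all shuffles of the arguments of each of the three kinds (wedge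
product in the `α`, symmetric product in the `β`, wedge product of forms in the `X`), with the sign
obtained when the form part (of degree `#U`) of the first factor passes the `α`-part (of degree
`#Sᶜ`) of the second factor. -/
def mul (c c' : Cochain R G X) : Cochain R G X := fun w v u α β x =>
  ∑ S : Finset (Fin w), ∑ T : Finset (Fin v), ∑ U : Finset (Fin u),
    (shuffleSign S * shuffleSign U * (-1) ^ (U.card * Sᶜ.card)) •
      (c _ _ _ (pick α S) (pick β T) (pick x U) * c' _ _ _ (pick α Sᶜ) (pick β Tᶜ) (pick x Uᶜ))

/-- The unit: the constant function `1`, in tridegree `(0,0,0)`. -/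
def one : Cochain R G X
  | 0, 0, 0, _, _, _ => 1
  | _, _, _, _, _, _ => 0

/-! ### The differentials of the intrinsic model -/

/-- The operator on `Ω(M; S A^*)` determined by an operator `D` on functions, `eG` on sections of
`A` and `eX` on vector fields by the Leibniz rule for the evaluation. -/
def leibnizForm (D : R → R) (eG : G → G) (eX : X → X) (P : PolyForm R G X) : PolyForm R G X :=
  fun v u β x =>
    D (P v u β x) - (∑ j, P v u (Function.update β j (eG (β j))) x)
      - ∑ a, P v u β (Function.update x a (eX (x a)))

/-- The Lie derivative `L_α` of elements of `Ω(M; S A^*)` along a section `α` of `A`: it is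
`L_{ρ(α)}` on forms and dual to `[α, ·]` on `A^*`. -/
def lieForm (O : Operations R G X) (α : G) : PolyForm R G X → PolyForm R G X :=
  leibnizForm (O.act (O.anchor α)) (O.lieG α) (O.lieX (O.anchor α))

/-- `∑ⱼ (i_{ρ(βⱼ)} c(α₁,…,α_w))(β₁,…,β̂ⱼ,…)`. -/
def anchorTerm (O : Operations R G X) (c : Cochain R G X) : Cochain R G X
  | w, v + 1, u, α, β, x =>
      ∑ j : Fin (v + 1), c w v (u + 1) α (j.removeNth β) (Fin.cons (O.anchor (β j)) x)
  | _, 0, _, _, _, _ => 0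

/-- `∑ⱼ c(βⱼ,α₁,…,α_w)(β₁,…,β̂ⱼ,…)`. -/
def shiftTerm (c : Cochain R G X) : Cochain R G X
  | w, v + 1, u, α, β, x =>
      ∑ j : Fin (v + 1), c (w + 1) v u (Fin.cons (β j) α) (j.removeNth β) x
  | _, 0, _, _, _, _ => 0

/-- The horizontal differential.  On the leading component (`v = 0`) it is the Koszul formula
`∑_{i<j} (-1)^{i+j} c₀([αᵢ,αⱼ],…) + ∑ᵢ (-1)^{i+1} L_{ρ(αᵢ)} c₀(…,α̂ᵢ,…)`; the tail has the
additional term `-(-1)^w ∑ⱼ i_{ρ(βⱼ)} c_{v-1}`, which is what the relation between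
the components of a cochain forces. -/
def dHor (O : Operations R G X) (c : Cochain R G X) : Cochain R G X := fun w v u α β x =>
  koszul O.lieG (lieForm O) (fun n α' v' u' β' x' => c n v' u' α' β' x') w α v u β x
    - (-1) ^ w * anchorTerm O c w v u α β x

/-- The vertical differential.  On the leading component (`v = 0`) it is `(-1)^p d_DR c₀`;
the tail has the additional term `∑ⱼ c_{v-1}(βⱼ, α₁, …)(β₁,…,β̂ⱼ,…)`, which is what the relation
between the components of a cochain forces. -/
def dVer (O : Operations R G X) (c : Cochain R G X) : Cochain R G X := fun w v u α β x =>
  (-1) ^ w * koszul O.lieX O.act (fun n x' => c w v n α β x') u x + shiftTerm c w v u α β x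

/-! ### The differentials determined by a connection -/

section Connection

variable [AddCommGroup G] [AddCommGroup X]

/-- The curvature `R_∇(x, y) α`. -/
def curv (O : Operations R G X) (nabla : X → G → G) (x y : X) (α : G) : G :=
  nabla x (nabla y α) - nabla y (nabla x α) - nabla (O.lieX x y) α

/-- The basic connection on `A`: `∇^bas_α β = ∇_{ρ(β)} α + [α, β]`. -/
def basG (O : Operations R G X) (nabla : X → G → G) (α β : G) : G :=
  nabla (O.anchor β) α + O.lieG α β

/-- The basic connection on `TM`: `∇^bas_α x = ρ(∇_x α) + [ρ(α), x]`. -/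
def basX (O : Operations R G X) (nabla : X → G → G) (α : G) (x : X) : X :=
  O.anchor (nabla x α) + O.lieX (O.anchor α) x

/-- The basic curvature `R^bas_∇(α, β) x`. -/
def basCurv (O : Operations R G X) (nabla : X → G → G) (α β : G) (x : X) : G :=
  nabla x (O.lieG α β) - O.lieG (nabla x α) β - O.lieG α (nabla x β)
    - nabla (basX O nabla β x) α + nabla (basX O nabla α x) β

/-- The connection induced by `∇` on `Λ A^* ⊗ S A^*`. -/
def nablaDual (O : Operations R G X) (nabla : X → G → G) (x : X) (Q : DualTensor R G) :
    DualTensor R G := fun w v α β =>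
  O.act x (Q w v α β) - (∑ k, Q w v (Function.update α k (nabla x (α k))) β)
    - ∑ j, Q w v α (Function.update β j (nabla x (β j)))

/-- The `A`-connection induced by the basic connections on `Λ T^*M ⊗ S A^*`. -/
def basForm (O : Operations R G X) (nabla : X → G → G) (α : G) : PolyForm R G X → PolyForm R G X :=
  leibnizForm (O.act (O.anchor α)) (basG O nabla α) (basX O nabla α)

/-- The extension by the graded derivation rule of the operator `S¹A^* → Ω²(M; Λ¹A^*)`,
`μ ↦ ((α | x, y) ↦ μ(R_∇(x, y) α))`. -/
def curvTerm (O : Operations R G X) (nabla : X → G → G) (c : Cochain R G X) : Cochain R G X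
  | w + 1, v, u + 2, α, β, x =>
      ∑ k : Fin (w + 1), ∑ b : Fin (u + 2), ∑ a : Fin (u + 1),
        if a.castSucc < b then
          (-1) ^ ((k : ℕ) + (a : ℕ) + (b : ℕ) + 1) *
            c w (v + 1) u (k.removeNth α)
              (Fin.cons (curv O nabla (x a.castSucc) (x b) (α k)) β) (a.removeNth (b.removeNth x))
        else 0
  | _, _, _, _, _, _ => 0

/-- The extension by the graded derivation rule of the operator `S¹A^* → Ω²(A; T^*M)`,
`μ ↦ ((α, α' | x) ↦ μ(R^bas_∇(α, α') x))`. -/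
def basCurvTerm (O : Operations R G X) (nabla : X → G → G) (c : Cochain R G X) : Cochain R G X
  | w + 2, v, u + 1, α, β, x =>
      ∑ j : Fin (w + 2), ∑ i : Fin (w + 1), ∑ a : Fin (u + 1),
        if i.castSucc < j then
          (-1) ^ (w + (i : ℕ) + (j : ℕ) + 1 + (a : ℕ)) *
            c w (v + 1) u (i.removeNth (j.removeNth α))
              (Fin.cons (basCurv O nabla (α i.castSucc) (α j) (x a)) β) (a.removeNth x)
        else 0
  | _, _, _, _, _, _ => 0

/-- The structure operator of the symmetric powers of the coadjoint representation up to homotopy,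
conjugated: `-ρ^* + (∇^bas)^* + (R^bas_∇)^*`. -/
def dHorConn (O : Operations R G X) (nabla : X → G → G) (c : Cochain R G X) : Cochain R G X :=
  fun w v u α β x =>
    koszul O.lieG (basForm O nabla) (fun n α' v' u' β' x' => c n v' u' α' β' x') w α v u β x
      - (-1) ^ w * anchorTerm O c w v u α β x + basCurvTerm O nabla c w v u α β x

/-- The structure operator of the symmetric powers of the dual of the double of `A`:
`Id^* + ∇^* + (R_∇)^*`. -/
def dVerConn (O : Operations R G X) (nabla : X → G → G) (c : Cochain R G X) : Cochain R G X :=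
  fun w v u α β x =>
    (-1) ^ w * koszul O.lieX (nablaDual O nabla) (fun n x' w' v' α' β' => c w' v' n α' β' x')
        u x w v α β
      + shiftTerm c w v u α β x + curvTerm O nabla c w v u α β x

end Connection

/-! ### The bigraded pieces -/

/-- `(df ∧ η)(x₁,…,x_u) = ∑ₐ (-1)^{a+1} L_{xₐ}(f) η(x₁,…,x̂ₐ,…)` for a family of functions `η`. -/
def dWedge (O : Operations R G X) (f : R) (η : ∀ u, (Fin u → X) → R) : ∀ u, (Fin u → X) → R
  | 0, _ => 0
  | u + 1, x => ∑ a : Fin (u + 1), (-1) ^ (a : ℕ) * O.act (x a) f * η u (a.removeNth x)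

theorem dWedge_add (O : Operations R G X) (f : R) (η θ : ∀ u, (Fin u → X) → R) (u : ℕ)
    (x : Fin u → X) :
    dWedge O f (fun n y => η n y + θ n y) u x = dWedge O f η u x + dWedge O f θ u x := by
  cases u with
  | zero => simp [dWedge]
  | succ u => simp [dWedge, mul_add, Finset.sum_add_distrib]

theorem dWedge_smul [Algebra ℝ R] (O : Operations R G X) (f : R) (r : ℝ) (η : ∀ u, (Fin u → X) → R) (u : ℕ)
    (x : Fin u → X) :
    dWedge O f (fun n y => r • η n y) u x = r • dWedge O f η u x := by
  cases u with
  | zero => simp [dWedge]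
  | succ u => simp [dWedge, Finset.smul_sum]

section Pieces

variable [AddCommGroup G] [Module R G] [AddCommGroup X] [Module R X]

/-- `c` is concentrated in the tridegrees `(w, v, u)` with `v + w = p` and `u + v = q`, and for
fixed `α` each component is an element of `Ω^u(M; S^v A^*)`: alternating and `R`-multilinear in `x`,
symmetric and `R`-multilinear in `β`. -/
structure IsFormValued (p q : ℕ) (c : Cochain R G X) : Prop where
  support : ∀ w v u, ¬ (v + w = p ∧ u + v = q) → c w v u = 0
  form : ∀ w v u α β, ∃ m : X [⋀^Fin u]→ₗ[R] R, ∀ x, c w v u α β x = m x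
  poly : ∀ w v u α x, ∃ m : MultilinearMap R (fun _ : Fin v => G) R, ∀ β, c w v u α β x = m β
  symm : ∀ w v u α β x (σ : Equiv.Perm (Fin v)), c w v u α (β ∘ σ) x = c w v u α β x

theorem IsFormValued.zero (p q : ℕ) : IsFormValued p q (0 : Cochain R G X) where
  support _ _ _ _ := rfl
  form _ _ _ _ _ := ⟨0, fun _ => rfl⟩
  poly _ _ _ _ _ := ⟨0, fun _ => rfl⟩
  symm _ _ _ _ _ _ _ := rfl

theorem IsFormValued.add {p q : ℕ} {c d : Cochain R G X} (hc : IsFormValued p q c)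
    (hd : IsFormValued p q d) : IsFormValued p q (c + d) where
  support w v u h := by
    change c w v u + d w v u = 0
    rw [hc.support w v u h, hd.support w v u h, add_zero]
  form w v u α β := by
    obtain ⟨m, hm⟩ := hc.form w v u α β
    obtain ⟨n, hn⟩ := hd.form w v u α β
    exact ⟨m + n, fun x => by simp [hm, hn]⟩
  poly w v u α x := by
    obtain ⟨m, hm⟩ := hc.poly w v u α x
    obtain ⟨n, hn⟩ := hd.poly w v u α x
    exact ⟨m + n, fun β => by simp [hm, hn]⟩
  symm w v u α β x σ := by
    simp [hc.symm w v u α β x σ, hd.symm w v u α β x σ]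

theorem IsFormValued.smul [Algebra ℝ R] {p q : ℕ} {c : Cochain R G X} (r : ℝ) (hc : IsFormValued p q c) :
    IsFormValued p q (r • c) where
  support w v u h := by
    change r • c w v u = 0
    rw [hc.support w v u h, smul_zero]
  form w v u α β := by
    obtain ⟨m, hm⟩ := hc.form w v u α β
    exact ⟨algebraMap ℝ R r • m, fun x => by simp [hm, Algebra.smul_def]⟩
  poly w v u α x := by
    obtain ⟨m, hm⟩ := hc.poly w v u α x
    exact ⟨algebraMap ℝ R r • m, fun β => by simp [hm, Algebra.smul_def]⟩
  symm w v u α β x σ := by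
    simp [hc.symm w v u α β x σ]

/-- The piece `W^{p,q}(A)` of the intrinsic model: strings `c = (c₀, c₁, …)` of antisymmetric
`ℝ`-multilinear maps `c_v : Γ(A)^{p-v} → Ω^{q-v}(M; S^v A^*)` such that
`c_v(α₁,…,f α_{p-v}) = f c_v(α₁,…,α_{p-v}) - df ∧ c_{v+1}(α₁,…,α_{p-v-1})(α_{p-v})`. -/
def intrinsicPiece [Algebra ℝ R] [Module ℝ G] (O : Operations R G X) (p q : ℕ) : Submodule ℝ (Cochain R G X) where
  carrier := {c | IsFormValued p q c ∧
    (∀ w v u β x, ∃ m : G [⋀^Fin w]→ₗ[ℝ] R, ∀ α, c w v u α β x = m α) ∧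
    ∀ (w v u : ℕ) (α : Fin w → G) (a : G) (f : R) (β : Fin v → G) (x : Fin u → X),
      c (w + 1) v u (Fin.snoc α (f • a)) β x =
        f * c (w + 1) v u (Fin.snoc α a) β x
          - dWedge O f (fun n y => c w (v + 1) n α (Fin.cons a β) y) u x}
  zero_mem' := by
    refine ⟨.zero p q, fun _ _ _ _ _ => ⟨0, fun _ => rfl⟩, fun w v u α a f β x => ?_⟩
    cases u <;> simp [dWedge]
  add_mem' := by
    rintro c d ⟨hc, hc', hc''⟩ ⟨hd, hd', hd''⟩
    refine ⟨hc.add hd, fun w v u β x => ?_, fun w v u α a f β x => ?_⟩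
    · obtain ⟨m, hm⟩ := hc' w v u β x
      obtain ⟨n, hn⟩ := hd' w v u β x
      exact ⟨m + n, fun α => by simp [hm, hn]⟩
    · simp only [Pi.add_apply, dWedge_add, hc'', hd'']
      ring
  smul_mem' := by
    rintro r c ⟨hc, hc', hc''⟩
    refine ⟨hc.smul r, fun w v u β x => ?_, fun w v u α a f β x => ?_⟩
    · obtain ⟨m, hm⟩ := hc' w v u β x
      exact ⟨r • m, fun α => by simp [hm]⟩
    · simp only [Pi.smul_apply, dWedge_smul, hc'', smul_sub, mul_smul_comm]

variable (R G X) in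
/-- The piece `W^{p,q}(A,∇) = ⨁_v Γ(Λ^{q-v}T^*M ⊗ S^v A^* ⊗ Λ^{p-v}A^*)` of the connection
dependent model (as a vector space it does not involve the connection): families of functions
which are `R`-multilinear in all arguments, alternating in `α`, symmetric in `β` and
alternating in `x`. -/
def tensorPiece [Algebra ℝ R] (p q : ℕ) : Submodule ℝ (Cochain R G X) where
  carrier := {c | IsFormValued p q c ∧
    ∀ w v u β x, ∃ m : G [⋀^Fin w]→ₗ[R] R, ∀ α, c w v u α β x = m α}
  zero_mem' := ⟨.zero p q, fun _ _ _ _ _ => ⟨0, fun _ => rfl⟩⟩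
  add_mem' := by
    rintro c d ⟨hc, hc'⟩ ⟨hd, hd'⟩
    refine ⟨hc.add hd, fun w v u β x => ?_⟩
    obtain ⟨m, hm⟩ := hc' w v u β x
    obtain ⟨n, hn⟩ := hd' w v u β x
    exact ⟨m + n, fun α => by simp [hm, hn]⟩
  smul_mem' := by
    rintro r c ⟨hc, hc'⟩
    refine ⟨hc.smul r, fun w v u β x => ?_⟩
    obtain ⟨m, hm⟩ := hc' w v u β x
    exact ⟨algebraMap ℝ R r • m, fun α => by simp [hm, Algebra.smul_def]⟩

end Pieces

end Formulas

/-! ## Differential bigraded algebras -/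

section Bigraded

variable {V V' : Type*} [AddCommGroup V] [Module ℝ V] [AddCommGroup V'] [Module ℝ V']

/-- The sum of all the bigraded pieces. -/
def total (W : ℕ → ℕ → Submodule ℝ V) : Submodule ℝ V := ⨆ pq : ℕ × ℕ, W pq.1 pq.2

/-- The subspaces `W p q` of `V`, with the given unit, product and operators, form a differential
bigraded algebra `⨁ W p q`: an associative unital `ℝ`-algebra, bigraded, commutative in
the graded sense for the total degree `p + q`, with a horizontal differential of
bidegree `(1, 0)` and a vertical differential of bidegree `(0, 1)` which are graded derivations,
square to zero and commute in the graded sense. -/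
structure IsDifferentialBigradedAlgebra (W : ℕ → ℕ → Submodule ℝ V) (one : V)
    (mul : V → V → V) (dh dv : V → V) : Prop where
  direct : iSupIndep fun pq : ℕ × ℕ => W pq.1 pq.2
  one_mem : one ∈ W 0 0
  mul_mem : ∀ {p q p' q' x y}, x ∈ W p q → y ∈ W p' q' → mul x y ∈ W (p + p') (q + q')
  add_mul : ∀ {x y z}, x ∈ total W → y ∈ total W → z ∈ total W →
    mul (x + y) z = mul x z + mul y z
  mul_add : ∀ {x y z}, x ∈ total W → y ∈ total W → z ∈ total W →
    mul x (y + z) = mul x y + mul x z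
  smul_mul : ∀ (r : ℝ) {x y}, x ∈ total W → y ∈ total W → mul (r • x) y = r • mul x y
  mul_smul : ∀ (r : ℝ) {x y}, x ∈ total W → y ∈ total W → mul x (r • y) = r • mul x y
  one_mul : ∀ {x}, x ∈ total W → mul one x = x
  mul_one : ∀ {x}, x ∈ total W → mul x one = x
  mul_assoc : ∀ {x y z}, x ∈ total W → y ∈ total W → z ∈ total W →
    mul (mul x y) z = mul x (mul y z)
  mul_comm : ∀ {p q p' q' x y}, x ∈ W p q → y ∈ W p' q' →
    mul x y = (-1 : ℝ) ^ ((p + q) * (p' + q')) • mul y x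
  dh_mem : ∀ {p q x}, x ∈ W p q → dh x ∈ W (p + 1) q
  dv_mem : ∀ {p q x}, x ∈ W p q → dv x ∈ W p (q + 1)
  dh_add : ∀ {x y}, x ∈ total W → y ∈ total W → dh (x + y) = dh x + dh y
  dv_add : ∀ {x y}, x ∈ total W → y ∈ total W → dv (x + y) = dv x + dv y
  dh_smul : ∀ (r : ℝ) {x}, x ∈ total W → dh (r • x) = r • dh x
  dv_smul : ∀ (r : ℝ) {x}, x ∈ total W → dv (r • x) = r • dv x
  dh_dh : ∀ {x}, x ∈ total W → dh (dh x) = 0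
  dv_dv : ∀ {x}, x ∈ total W → dv (dv x) = 0
  dh_dv : ∀ {x}, x ∈ total W → dh (dv x) + dv (dh x) = 0
  dh_mul : ∀ {p q p' q' x y}, x ∈ W p q → y ∈ W p' q' →
    dh (mul x y) = mul (dh x) y + (-1 : ℝ) ^ (p + q) • mul x (dh y)
  dv_mul : ∀ {p q p' q' x y}, x ∈ W p q → y ∈ W p' q' →
    dv (mul x y) = mul (dv x) y + (-1 : ℝ) ^ (p + q) • mul x (dv y)

/-- A linear bijection `φ` is an isomorphism of differential bigraded algebras: it respects the
bigrading, the unit, the product and both differentials.  (Equations such as `z = mul x y` are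
between elements of the ambient space.) -/
structure IsDBGAIso {W : ℕ → ℕ → Submodule ℝ V} {W' : ℕ → ℕ → Submodule ℝ V'}
    (one : V) (mul : V → V → V) (dh dv : V → V)
    (one' : V') (mul' : V' → V' → V') (dh' dv' : V' → V')
    (φ : total W ≃ₗ[ℝ] total W') : Prop where
  map_mem : ∀ p q (x : total W), (x : V) ∈ W p q ↔ (φ x : V') ∈ W' p q
  map_one : ∀ x : total W, (x : V) = one → (φ x : V') = one'
  map_mul : ∀ x y z : total W, (z : V) = mul x y → (φ z : V') = mul' (φ x) (φ y)
  map_dh : ∀ x y : total W, (y : V) = dh x → (φ y : V') = dh' (φ x)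
  map_dv : ∀ x y : total W, (y : V) = dv x → (φ y : V') = dv' (φ x)

end Bigraded

/-! ## Lie algebroids and connections -/

section Geometry

/-- `C^∞(M)`. -/
abbrev SmoothFun (n : ℕ) (M : Type*) [TopologicalSpace M]
    [ChartedSpace (EuclideanSpace ℝ (Fin n)) M] : Type _ :=
  C^∞⟮𝓡 n, M; 𝓘(ℝ, ℝ), ℝ⟯

/-- The smooth vector fields on `M`. -/
abbrev VectorFields (n : ℕ) (M : Type*) [TopologicalSpace M]
    [ChartedSpace (EuclideanSpace ℝ (Fin n)) M] [IsManifold (𝓡 n) ∞ M] : Type _ :=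
  Cₛ^∞⟮𝓡 n; EuclideanSpace ℝ (Fin n), (fun x : M => TangentSpace (𝓡 n) x)⟯

/-- The smooth sections of a vector bundle `A` with model fibre `F`. -/
abbrev Sections (n : ℕ) {M : Type*} [TopologicalSpace M]
    [ChartedSpace (EuclideanSpace ℝ (Fin n)) M]
    (F : Type*) [NormedAddCommGroup F] [NormedSpace ℝ F]
    (A : M → Type*) [TopologicalSpace (Bundle.TotalSpace F A)] [∀ x, TopologicalSpace (A x)]
    [FiberBundle F A] : Type _ :=
  Cₛ^∞⟮𝓡 n; F, A⟯

variable {n : ℕ} {M : Type*} [TopologicalSpace M] [ChartedSpace (EuclideanSpace ℝ (Fin n)) M]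

section Module

variable {F : Type*} [NormedAddCommGroup F] [NormedSpace ℝ F]
  {A : M → Type*} [TopologicalSpace (Bundle.TotalSpace F A)]
  [∀ x, AddCommGroup (A x)] [∀ x, Module ℝ (A x)] [∀ x, TopologicalSpace (A x)]
  [FiberBundle F A] [VectorBundle ℝ F A]

/-- Sections form a module over `C^∞(M)` by pointwise multiplication. -/
noncomputable instance sectionModule : Module (SmoothFun n M) (Sections n F A) where
  smul f s := ⟨fun x => f x • s x, f.contMDiff.smul_section s.contMDiff⟩
  one_smul s := by ext x; exact one_smul ℝ (s x)
  mul_smul f g s := by ext x; exact mul_smul (f x) (g x) (s x)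
  smul_zero f := by ext x; exact smul_zero (f x)
  smul_add f s t := by ext x; exact smul_add (f x) (s x) (t x)
  add_smul f g s := by ext x; exact add_smul (f x) (g x) (s x)
  zero_smul s := by ext x; exact zero_smul ℝ (s x)

end Module

variable [IsManifold (𝓡 n) ∞ M]

/-- The derivative `L_X(f) = df(X)` of a function along a vector field. -/
noncomputable def actFun (X : VectorFields n M) (f : SmoothFun n M) : SmoothFun n M :=
  ⟨fun x => mvfderiv (𝓡 n) f x (X x), by
    have h : ContMDiff (𝓡 n) 𝓘(ℝ, ℝ).tangent ∞
        (tangentMap (𝓡 n) 𝓘(ℝ, ℝ) f ∘ fun x => (⟨x, X x⟩ : TangentBundle (𝓡 n) M)) :=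
      (f.contMDiff.contMDiff_tangentMap (m := ∞) le_rfl).comp X.contMDiff
    exact (contMDiff_snd_tangentBundle_modelSpace ℝ 𝓘(ℝ, ℝ)).comp h⟩

/-- The Lie bracket of vector fields. -/
noncomputable def lieField (X Y : VectorFields n M) : VectorFields n M :=
  ⟨VectorField.mlieBracket (𝓡 n) X Y, by
    have : IsManifold (𝓡 n) (minSmoothness ℝ 2) M :=
      IsManifold.of_le (n := ∞) (by simpa using (WithTop.coe_le_coe.2 le_top : ((2 : ℕ∞) : ℕ∞ω) ≤ ∞))
    have : IsManifold (𝓡 n) ((⊤ : ℕ∞) + 1 : ℕ∞ω) M := by simpa using ‹IsManifold (𝓡 n) ∞ M›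
    exact ContDiff.mlieBracket_vectorField (m := ⊤) (n := ⊤) X.contMDiff Y.contMDiff (by simp)⟩

variable (n) (F : Type*) [NormedAddCommGroup F] [NormedSpace ℝ F]
  (A : M → Type*) [TopologicalSpace (Bundle.TotalSpace F A)]
  [∀ x, AddCommGroup (A x)] [∀ x, Module ℝ (A x)] [∀ x, TopologicalSpace (A x)]
  [FiberBundle F A] [VectorBundle ℝ F A]

/-- A Lie algebroid structure on a vector bundle `A` over `M`: a smooth bundle map `ρ : A → TM`
over the identity and a Lie bracket on the sections of `A` satisfying the Leibniz identity. -/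
structure LieAlgebroid where
  anchor : ∀ x : M, A x →ₗ[ℝ] TangentSpace (𝓡 n) x
  anchor_smooth : ContMDiff ((𝓡 n).prod 𝓘(ℝ, F)) (𝓡 n).tangent ∞
    fun a : Bundle.TotalSpace F A => (⟨a.1, anchor a.1 a.2⟩ : TangentBundle (𝓡 n) M)
  lie : Sections n F A → Sections n F A → Sections n F A
  add_lie : ∀ α β γ, lie (α + β) γ = lie α γ + lie β γ
  lie_add : ∀ α β γ, lie α (β + γ) = lie α β + lie α γ
  lie_self : ∀ α, lie α α = 0
  jacobi : ∀ α β γ, lie α (lie β γ) = lie (lie α β) γ + lie β (lie α γ)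
  leibniz : ∀ (α β : Sections n F A) (f : SmoothFun n M) (x : M),
    lie α (f • β) x = f x • lie α β x + mvfderiv (𝓡 n) f x (anchor x (α x)) • β x

/-- A (linear) connection on the vector bundle `A`. -/
structure Connection where
  nabla : VectorFields n M → Sections n F A → Sections n F A
  add_left : ∀ X Y α, nabla (X + Y) α = nabla X α + nabla Y α
  add_right : ∀ X α β, nabla X (α + β) = nabla X α + nabla X β
  smul_left : ∀ (f : SmoothFun n M) X α, nabla (f • X) α = f • nabla X α
  leibniz : ∀ (f : SmoothFun n M) X α, nabla X (f • α) = f • nabla X α + actFun X f • α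

variable {n F A}

/-- The map induced by the anchor on sections. -/
noncomputable def LieAlgebroid.anchorSection (L : LieAlgebroid n F A) (α : Sections n F A) :
    VectorFields n M :=
  ⟨fun x => L.anchor x (α x), L.anchor_smooth.comp α.contMDiff⟩

/-- The operations of a Lie algebroid. -/
noncomputable def LieAlgebroid.ops (L : LieAlgebroid n F A) :
    Operations (SmoothFun n M) (Sections n F A) (VectorFields n M) where
  act := actFun
  lieX := lieField
  lieG := L.lie
  anchor := L.anchorSection

end Geometry

end WeilAlgebra

/-! All cochains, without any symmetry or linearity, form a ring `Co` under the shuffle product. A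
cochain is determined by its value without arguments and by its contractions `iA`, `iB`, `kX` with a
first argument of each kind, and these contractions satisfy Leibniz rules: `iA` and `kX` are odd,
`iB` is even. Identities are therefore proved by induction on the number of arguments: both sides
agree without arguments and obey the same recursion under contraction. Associativity and graded
commutativity arise in this way, and so does the derivation property of the differentials, where the
recursion is Cartan's formula: the graded commutator of a Koszul differential with a contraction is
a Lie derivative, an even derivation.

Both models are treated by one pair of operators `dH O nabla`, `dV O nabla`, defined for an
arbitrary map `nabla`. For a connection they are the differentials of the second model. The zero map
is not a connection, but for it the curvature terms insert `0` and the basic connections become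
brackets, so on multilinear cochains the operators are the intrinsic differentials (`dHor_eq`,
`dVer_eq`). The computations on generators need only biadditivity of `nabla`, hence serve both
models.

The intrinsic model is locally generated by functions `f`, sections `θ` of the dual bundle, the
forms `df`, and the vertical differentials of the `θ` (`Wint.induction`). For a frame `e_i` with
dual frame `θ_i`, the Euler operator `∑ θ_i · iA e_i + (d^ver θ_i) · iB e_i` multiplies bidegree
`(p, q)` by `p`; in bidegree `(0, q)` the operator `∑ dg_i · kX Y_i` of a coordinate system
multiplies by `q`. These identities hold after multiplication by a power of a function `χ` supported
where frames exist, and `p` and `q` can be divided out over the reals, so induction on the bidegree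
applies. The anticommutator of two odd derivations is a derivation, so the identities between the
differentials reduce to generators, where they are the Jacobi identity, the representation property
of vector fields on functions and the compatibility of the anchor with brackets. A statement about
`χ ^ N • c` descends to `c` by the Leibniz rule.

An intrinsic cochain fails to be function-linear by `iA (f • a) c = f • iA a c - df * iB a c`.
Inserting the one-form `∇a` into a symmetric argument is an operator `gam a` with the opposite
defect, so the corrected contraction `iA a + gam a` is function-linear. Corrected contractions
anticommute and are odd derivations; evaluating cochains by them instead of `iA` gives the
multiplicative map `phi nabla 1`, with inverse `phi nabla (-1)`. It intertwines the differentials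
because it does so on generators, and the identities of the connection-dependent model are
transported along it. For uniqueness, an isomorphism that is the identity in the three lowest
bidegrees is determined on generators by compatibility with `d^ver`, hence everywhere; the formula
in bidegree `(1, 1)` is then a consequence.

The geometric input is the existence of bump functions, which give the `χ`, and the observation that
the Jacobi and Leibniz identities force the anchor to preserve brackets. -/

set_option linter.unusedSectionVars false
set_option linter.unusedSimpArgs false

namespace WeilAlgebra

/-! ## Subsets of `Fin (n + 1)` and shuffles -/

section Shuffles

/-- The subset `S` shifted by one, not containing `0`. -/
def shiftSet {n : ℕ} (S : Finset (Fin n)) : Finset (Fin (n + 1)) := S.map (Fin.succEmb n)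

/-- The subset `S` shifted by one, together with `0`. -/
def consSet {n : ℕ} (S : Finset (Fin n)) : Finset (Fin (n + 1)) := insert 0 (shiftSet S)

variable {n : ℕ} (S : Finset (Fin n))

@[simp] theorem zero_notMem_shiftSet : (0 : Fin (n + 1)) ∉ shiftSet S := by simp [shiftSet]
@[simp] theorem succ_mem_shiftSet (i : Fin n) : i.succ ∈ shiftSet S ↔ i ∈ S := by simp [shiftSet]
@[simp] theorem zero_mem_consSet : (0 : Fin (n + 1)) ∈ consSet S := by simp [consSet]
@[simp] theorem succ_mem_consSet (i : Fin n) : i.succ ∈ consSet S ↔ i ∈ S := by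
  simp [consSet, Fin.succ_ne_zero]

@[simp] theorem card_shiftSet : (shiftSet S).card = S.card := by simp [shiftSet]
@[simp] theorem card_consSet : (consSet S).card = S.card + 1 := by simp [consSet]

theorem compl_shiftSet : (shiftSet S)ᶜ = consSet Sᶜ := by
  ext i; cases i using Fin.cases <;> simp

theorem compl_consSet : (consSet S)ᶜ = shiftSet Sᶜ := by
  ext i; cases i using Fin.cases <;> simp

/-- A subset of `Fin (n + 1)` amounts to its trace on the successors together with the decision
whether `0` belongs to it. This splitting of shuffles is the source of the Leibniz rules for
contractions. -/
theorem sum_finset_fin_succ {N : Type*} [AddCommMonoid N] (g : Finset (Fin (n + 1)) → N) :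
    ∑ S, g S = ∑ S : Finset (Fin n), g (consSet S) + ∑ S : Finset (Fin n), g (shiftSet S) := by
  have h1 : (Finset.univ : Finset (Fin (n + 1))) =
      insert 0 ((Finset.univ : Finset (Fin n)).map (Fin.succEmb n)) := by
    ext i; cases i using Fin.cases <;> simp
  have h2 : ∀ h : Finset (Fin (n + 1)) → N,
      ∑ t ∈ ((Finset.univ : Finset (Fin n)).map (Fin.succEmb n)).powerset, h t =
        ∑ S : Finset (Fin n), h (shiftSet S) := by
    intro h
    rw [← Finset.sum_image (s := Finset.univ) (g := fun S : Finset (Fin n) => shiftSet S) (f := h)]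
    · apply Finset.sum_congr _ fun _ _ => rfl
      ext t
      simp only [Finset.mem_powerset, Finset.mem_image, Finset.mem_univ, true_and]
      constructor
      · intro ht
        refine ⟨Finset.univ.filter fun i => i.succ ∈ t, ?_⟩
        ext i; cases i using Fin.cases with
        | zero =>
          simp only [zero_notMem_shiftSet, false_iff]
          intro h0; simpa [Fin.succ_ne_zero] using ht h0
        | succ i => simp
      · rintro ⟨S, rfl⟩ i hi
        cases i using Fin.cases with
        | zero => simp at hi
        | succ i => simp
    · intro S _ T _ h
      exact Finset.map_injective _ h
  rw [← Finset.powerset_univ, h1, Finset.sum_powerset_insert (by simp [Fin.succ_ne_zero]), h2, h2,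
    add_comm]
  rfl

theorem shuffleSign_eq : shuffleSign S =
    (-1) ^ ∑ i, ∑ j, if i ∈ S ∧ j ∉ S ∧ j < i then 1 else 0 := by
  rw [shuffleSign, Finset.card_eq_sum_ones, Finset.sum_filter, ← Fintype.sum_prod_type',
    ← Finset.sum_filter, ← Finset.sum_filter]
  congr 1
  apply Finset.sum_congr _ fun _ _ => rfl
  ext ⟨i, j⟩; simp [and_assoc]

/-- An element `0` of the first block precedes everything and creates no inversion. -/
theorem shuffleSign_consSet : shuffleSign (consSet S) = shuffleSign S := by
  simp only [shuffleSign_eq, Fin.sum_univ_succ, zero_mem_consSet, succ_mem_consSet,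
    Fin.succ_lt_succ_iff, Fin.not_lt_zero]
  simp

/-- An element `0` of the second block forms an inversion with every element of the first. -/
theorem shuffleSign_shiftSet : shuffleSign (shiftSet S) = (-1) ^ S.card * shuffleSign S := by
  simp only [shuffleSign_eq, Fin.sum_univ_succ, zero_notMem_shiftSet, succ_mem_shiftSet]
  simp only [false_and, if_false, Finset.sum_const_zero, zero_add, not_false_eq_true,
    Fin.succ_lt_succ_iff, Fin.succ_pos, true_and, and_true, Finset.sum_add_distrib, pow_add]
  congr 2
  simp

variable {P N : Type*}

/-- The number of picked arguments is a cardinality that is only propositionally the expected one.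
Evaluating a family `F` defined for all lengths lets the length be exchanged without casts. -/
theorem eval_pick (F : ∀ k, (Fin k → P) → N) {k : ℕ} (x : Fin n → P) (h : S.card = k) :
    F S.card (pick x S) = F k fun i => x (S.orderEmbOfFin h i) := by
  subst h; rfl

theorem eval_pick_consSet (F : ∀ k, (Fin k → P) → N) (x : Fin (n + 1) → P)
    {T : Finset (Fin (n + 1))} (hT : T = consSet S) :
    F T.card (pick x T) = F (S.card + 1) (Fin.cons (x 0) (pick (Fin.tail x) S)) := by
  subst hT
  rw [eval_pick _ F x (card_consSet S)]
  congr 1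
  -- The increasing enumeration of a finite set is unique, so it suffices that this one is
  -- increasing with values in the set.
  have : (fun i : Fin (S.card + 1) => (Fin.cons 0 (fun i => (S.orderEmbOfFin rfl i).succ) :
      Fin (S.card + 1) → Fin (n + 1)) i) = (consSet S).orderEmbOfFin (card_consSet S) := by
    apply Finset.orderEmbOfFin_unique
    · intro i; cases i using Fin.cases with
      | zero => simp
      | succ i => simp [Finset.orderEmbOfFin_mem]
    · intro i j hij
      cases j using Fin.cases with
      | zero => exact absurd hij (Fin.not_lt_zero i)
      | succ j =>
        cases i using Fin.cases with
        | zero => simp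
        | succ i => simpa using hij
  funext i
  rw [← this]
  cases i using Fin.cases with
  | zero => simp
  | succ i => simp [pick, Fin.tail]

theorem eval_pick_shiftSet (F : ∀ k, (Fin k → P) → N) (x : Fin (n + 1) → P)
    {T : Finset (Fin (n + 1))} (hT : T = shiftSet S) :
    F T.card (pick x T) = F S.card (pick (Fin.tail x) S) := by
  subst hT
  rw [eval_pick _ F x (card_shiftSet S)]
  congr 1
  have : (fun i : Fin S.card => (S.orderEmbOfFin rfl i).succ) =
      (shiftSet S).orderEmbOfFin (card_shiftSet S) := by
    apply Finset.orderEmbOfFin_unique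
    · intro i; simp [Finset.orderEmbOfFin_mem]
    · intro i j hij; simpa using hij
  funext i
  rw [← this]
  simp [pick, Fin.tail]

end Shuffles

/-! ## The algebra of cochains -/

/-- Cochains, as a ring with the product `mul`. -/
def Co (R G X : Type*) : Type _ := Cochain R G X

namespace Co

variable {R G X : Type*} [CommRing R]

instance : AddCommGroup (Co R G X) := inferInstanceAs (AddCommGroup (Cochain R G X))
instance : Module R (Co R G X) := inferInstanceAs (Module R (Cochain R G X))

section Apply

variable (c d : Co R G X) (w v u : ℕ) (α : Fin w → G) (β : Fin v → G) (x : Fin u → X)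

@[simp] theorem add_app : (c + d) w v u α β x = c w v u α β x + d w v u α β x := rfl
@[simp] theorem sub_app : (c - d) w v u α β x = c w v u α β x - d w v u α β x := rfl
@[simp] theorem neg_app : (-c) w v u α β x = -c w v u α β x := rfl
@[simp] theorem zero_app : (0 : Co R G X) w v u α β x = 0 := rfl
@[simp] theorem smul_app (f : R) : (f • c) w v u α β x = f * c w v u α β x := rfl

/-- Contraction with a section in the first exterior argument. -/
def iA (a : G) (c : Co R G X) : Co R G X := fun w v u α β x => c (w + 1) v u (Fin.cons a α) β x

/-- Contraction with a section in the first symmetric argument. -/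
def iB (b : G) (c : Co R G X) : Co R G X := fun w v u α β x => c w (v + 1) u α (Fin.cons b β) x

/-- Contraction with a vector field, with the sign which makes it a graded derivation. -/
def kX (y : X) (c : Co R G X) : Co R G X :=
  fun w v u α β x => (-1) ^ w * c w v (u + 1) α β (Fin.cons y x)

/-- The grading involution. -/
def tw (c : Co R G X) : Co R G X := fun w v u α β x => (-1) ^ (w + u) * c w v u α β x

theorem iA_app (a : G) : iA a c w v u α β x = c (w + 1) v u (Fin.cons a α) β x := rfl
theorem iB_app (b : G) : iB b c w v u α β x = c w (v + 1) u α (Fin.cons b β) x := rfl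
theorem kX_app (y : X) :
    kX y c w v u α β x = (-1) ^ w * c w v (u + 1) α β (Fin.cons y x) := rfl
theorem tw_app : tw c w v u α β x = (-1) ^ (w + u) * c w v u α β x := rfl

end Apply

@[ext] theorem ext {c d : Co R G X} (h : ∀ w v u α β x, c w v u α β x = d w v u α β x) : c = d := by
  funext w v u α β x; exact h w v u α β x

section Linear

variable (c d : Co R G X) (f : R) (a b : G) (x y : X)

@[simp] theorem iA_add : iA a (c + d) = iA a c + iA a d := rfl
@[simp] theorem iA_sub : iA a (c - d) = iA a c - iA a d := rfl
@[simp] theorem iA_neg : iA a (-c) = -iA a c := rfl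
@[simp] theorem iA_zero : iA a (0 : Co R G X) = 0 := rfl
@[simp] theorem iA_smul : iA a (f • c) = f • iA a c := rfl
@[simp] theorem iB_add : iB a (c + d) = iB a c + iB a d := rfl
@[simp] theorem iB_sub : iB a (c - d) = iB a c - iB a d := rfl
@[simp] theorem iB_neg : iB a (-c) = -iB a c := rfl
@[simp] theorem iB_zero : iB a (0 : Co R G X) = 0 := rfl
@[simp] theorem iB_smul : iB a (f • c) = f • iB a c := rfl
@[simp] theorem kX_add : kX x (c + d) = kX x c + kX x d := by ext; simp [kX_app, mul_add]
@[simp] theorem kX_sub : kX x (c - d) = kX x c - kX x d := by ext; simp [kX_app, mul_sub]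
@[simp] theorem kX_neg : kX x (-c) = -kX x c := by ext; simp [kX_app]
@[simp] theorem kX_zero : kX x (0 : Co R G X) = 0 := by ext; simp [kX_app]
@[simp] theorem kX_smul : kX x (f • c) = f • kX x c := by ext; simp [kX_app, mul_left_comm]
@[simp] theorem tw_add : tw (c + d) = tw c + tw d := by ext; simp [tw_app, mul_add]
@[simp] theorem tw_sub : tw (c - d) = tw c - tw d := by ext; simp [tw_app, mul_sub]
@[simp] theorem tw_neg : tw (-c) = -tw c := by ext; simp [tw_app]
@[simp] theorem tw_zero : tw (0 : Co R G X) = 0 := by ext; simp [tw_app]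
@[simp] theorem tw_smul : tw (f • c) = f • tw c := by ext; simp [tw_app, mul_left_comm]
@[simp] theorem tw_tw : tw (tw c) = c := by ext; simp [tw_app, ← mul_assoc, ← mul_pow]

theorem iA_tw : iA a (tw c) = -tw (iA a c) := by
  ext; simp [tw_app, iA_app]; ring
theorem iB_tw : iB a (tw c) = tw (iB a c) := rfl
theorem kX_tw : kX x (tw c) = -tw (kX x c) := by
  ext; simp [tw_app, kX_app]; ring
theorem iA_iB : iA a (iB b c) = iB b (iA a c) := rfl
theorem iB_kX : iB a (kX x c) = kX x (iB a c) := rfl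
theorem iA_kX : iA a (kX x c) = -kX x (iA a c) := by
  ext; simp [kX_app, iA_app, pow_succ]

end Linear

/-- Agreement on at most `n` arguments. -/
def Agree (n : ℕ) (c d : Co R G X) : Prop := ∀ w v u, w + v + u ≤ n → c w v u = d w v u

theorem eq_of_agree {c d : Co R G X} (h : ∀ n, Agree n c d) : c = d := by
  funext w v u; exact h _ w v u le_rfl

theorem Agree.refl (n : ℕ) (c : Co R G X) : Agree n c c := fun _ _ _ _ => rfl

theorem Agree.of_eq {n : ℕ} {c d : Co R G X} (h : c = d) : Agree n c d := h ▸ .refl n c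

theorem Agree.trans {n : ℕ} {c d e : Co R G X} (h : Agree n c d) (h' : Agree n d e) :
    Agree n c e := fun w v u hn => (h w v u hn).trans (h' w v u hn)

theorem Agree.add {n : ℕ} {c d c' d' : Co R G X} (h : Agree n c d) (h' : Agree n c' d') :
    Agree n (c + c') (d + d') := fun w v u hn => by
  change c w v u + c' w v u = d w v u + d' w v u
  rw [h w v u hn, h' w v u hn]

theorem Agree.neg {n : ℕ} {c d : Co R G X} (h : Agree n c d) : Agree n (-c) (-d) :=
  fun w v u hn => by
    change -c w v u = -d w v u
    rw [h w v u hn]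

theorem Agree.sub {n : ℕ} {c d c' d' : Co R G X} (h : Agree n c d) (h' : Agree n c' d') :
    Agree n (c - c') (d - d') := by
  rw [sub_eq_add_neg, sub_eq_add_neg]; exact h.add h'.neg

theorem Agree.smul {n : ℕ} {c d : Co R G X} (f : R) (h : Agree n c d) : Agree n (f • c) (f • d) :=
  fun w v u hn => by
    change f • c w v u = f • d w v u
    rw [h w v u hn]

theorem agree_zero {c d : Co R G X} (h : c 0 0 0 ![] ![] ![] = d 0 0 0 ![] ![] ![]) :
    Agree 0 c d := by
  intro w v u hn
  obtain ⟨rfl, rfl, rfl⟩ : w = 0 ∧ v = 0 ∧ u = 0 := by omega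
  funext α β x
  rw [Subsingleton.elim α ![], Subsingleton.elim β ![], Subsingleton.elim x ![]]
  exact h

/-- The bound counts arguments of all kinds together, so that peeling off the first argument of
whichever kind is present lowers it by one. -/
theorem agree_succ {n : ℕ} {c d : Co R G X} (h : c 0 0 0 ![] ![] ![] = d 0 0 0 ![] ![] ![])
    (hA : ∀ a, Agree n (iA a c) (iA a d)) (hB : ∀ b, Agree n (iB b c) (iB b d))
    (hX : ∀ y, Agree n (kX y c) (kX y d)) : Agree (n + 1) c d := by
  intro w v u hn
  funext α β x
  cases w with
  | succ w =>
    rw [← Fin.cons_self_tail α]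
    exact congrFun (congrFun (congrFun (hA (α 0) w v u (by omega)) _) _) _
  | zero =>
    cases v with
    | succ v =>
      rw [← Fin.cons_self_tail β]
      exact congrFun (congrFun (congrFun (hB (β 0) 0 v u (by omega)) _) _) _
    | zero =>
      cases u with
      | succ u =>
        rw [← Fin.cons_self_tail x]
        have := congrFun (congrFun (congrFun (hX (x 0) 0 0 u (by omega)) α) β) (Fin.tail x)
        simpa [kX_app] using this
      | zero => exact congrFun (congrFun (congrFun (agree_zero h 0 0 0 le_rfl) _) _) _

/-- Cochains are equal if their values without arguments agree, and the agreement is inherited by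
contractions. -/
theorem eq_of_contractions {ι : Sort*} (c d : ι → Co R G X)
    (h : ∀ i, c i 0 0 0 ![] ![] ![] = d i 0 0 0 ![] ![] ![])
    (hA : ∀ n, (∀ i, Agree n (c i) (d i)) → ∀ i a, Agree n (iA a (c i)) (iA a (d i)))
    (hB : ∀ n, (∀ i, Agree n (c i) (d i)) → ∀ i a, Agree n (iB a (c i)) (iB a (d i)))
    (hX : ∀ n, (∀ i, Agree n (c i) (d i)) → ∀ i y, Agree n (kX y (c i)) (kX y (d i))) (i : ι) :
    c i = d i := by
  suffices H : ∀ n i, Agree n (c i) (d i) from eq_of_agree fun n => H n i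
  intro n
  induction n with
  | zero => exact fun i => agree_zero (h i)
  | succ n ih => exact fun i => agree_succ (h i) (hA n ih i) (hB n ih i) (hX n ih i)

theorem eq_of_contr {c d : Co R G X} (h : c 0 0 0 ![] ![] ![] = d 0 0 0 ![] ![] ![])
    (hA : ∀ a, iA a c = iA a d) (hB : ∀ b, iB b c = iB b d) (hX : ∀ y, kX y c = kX y d) : c = d :=
  eq_of_contractions (ι := Unit) (fun _ => c) (fun _ => d) (fun _ => h)
    (fun _ _ _ a => .of_eq (hA a)) (fun _ _ _ a => .of_eq (hB a)) (fun _ _ _ a => .of_eq (hX a)) ()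

/-! ### The product -/

instance : Mul (Co R G X) := ⟨mul⟩
instance : One (Co R G X) := ⟨one⟩

theorem one_def : (1 : Co R G X) = one := rfl

theorem mul_app (c d : Co R G X) (w v u : ℕ) (α : Fin w → G) (β : Fin v → G) (x : Fin u → X) :
    (c * d) w v u α β x =
      ∑ S : Finset (Fin w), ∑ T : Finset (Fin v), ∑ U : Finset (Fin u),
        ((shuffleSign S : ℤ) : R) * ((shuffleSign U : ℤ) : R) * (-1) ^ (U.card * Sᶜ.card) *
          (c _ _ _ (pick α S) (pick β T) (pick x U) *
            d _ _ _ (pick α Sᶜ) (pick β Tᶜ) (pick x Uᶜ)) := by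
  change mul c d w v u α β x = _
  simp only [mul, zsmul_eq_mul]
  push_cast
  rfl

theorem eval_pick_zero {P N : Type*} (F : ∀ k, (Fin k → P) → N) (y : Fin 0 → P)
    (S : Finset (Fin 0)) : F S.card (pick y S) = F 0 ![] := by
  obtain rfl : S = ∅ := Subsingleton.elim _ _
  exact congrArg (F 0) (Subsingleton.elim (α := Fin 0 → P) _ _)

@[simp] theorem mul_app_zero (c d : Co R G X) (α β x) :
    (c * d) 0 0 0 α β x = c 0 0 0 ![] ![] ![] * d 0 0 0 ![] ![] ![] := by
  rw [mul_app]
  simp only [Finset.univ_unique, Finset.sum_singleton]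
  rw [eval_pick_zero (fun k y => c k _ _ y (pick β default) (pick x default)) α default,
    eval_pick_zero (fun k y => c _ k _ _ y (pick x default)) β default,
    eval_pick_zero (fun k y => c _ _ k _ _ y) x default,
    eval_pick_zero (fun k y => d k _ _ y (pick β defaultᶜ) (pick x defaultᶜ)) α defaultᶜ,
    eval_pick_zero (fun k y => d _ k _ _ y (pick x defaultᶜ)) β defaultᶜ,
    eval_pick_zero (fun k y => d _ _ k _ _ y) x defaultᶜ]
  have h0 : (default : Finset (Fin 0)) = ∅ := rfl
  simp [shuffleSign, h0]

/-- The new first argument goes to one of the two factors. On its way to the second it passes the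
exterior arguments of the first factor (shuffle sign) and its form arguments (explicit sign of the
product), which together give `tw c`. -/
theorem iA_mul (a : G) (c d : Co R G X) : iA a (c * d) = iA a c * d + tw c * iA a d := by
  ext w v u α β x
  rw [iA_app, add_app, mul_app, mul_app, mul_app, sum_finset_fin_succ]
  congr 1
  · refine Finset.sum_congr rfl fun S _ => Finset.sum_congr rfl fun T _ =>
      Finset.sum_congr rfl fun U _ => ?_
    rw [eval_pick_consSet S (fun k y => c k _ _ y _ _) _ rfl,
      eval_pick_shiftSet Sᶜ (fun k y => d k _ _ y _ _) _ (compl_consSet S), shuffleSign_consSet,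
      compl_consSet, card_shiftSet]
    rfl
  · refine Finset.sum_congr rfl fun S _ => Finset.sum_congr rfl fun T _ =>
      Finset.sum_congr rfl fun U _ => ?_
    rw [eval_pick_shiftSet S (fun k y => c k _ _ y _ _) _ rfl,
      eval_pick_consSet Sᶜ (fun k y => d k _ _ y _ _) _ (compl_shiftSet S), shuffleSign_shiftSet,
      compl_shiftSet, card_consSet]
    simp only [tw_app, iA_app, Fin.cons_zero, Fin.tail_cons]
    push_cast
    ring

theorem iB_mul (b : G) (c d : Co R G X) : iB b (c * d) = iB b c * d + c * iB b d := by
  ext w v u α β x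
  rw [iB_app, add_app, mul_app, mul_app, mul_app, ← Finset.sum_add_distrib]
  refine Finset.sum_congr rfl fun S _ => ?_
  rw [sum_finset_fin_succ]
  congr 1
  · refine Finset.sum_congr rfl fun T _ => Finset.sum_congr rfl fun U _ => ?_
    rw [eval_pick_consSet T (fun k y => c _ k _ _ y _) _ rfl,
      eval_pick_shiftSet Tᶜ (fun k y => d _ k _ _ y _) _ (compl_consSet T)]
    rfl
  · refine Finset.sum_congr rfl fun T _ => Finset.sum_congr rfl fun U _ => ?_
    rw [eval_pick_shiftSet T (fun k y => c _ k _ _ y _) _ rfl,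
      eval_pick_consSet Tᶜ (fun k y => d _ k _ _ y _) _ (compl_shiftSet T)]
    rfl

theorem neg_one_pow_card {w : ℕ} (S : Finset (Fin w)) :
    (-1 : R) ^ w = (-1) ^ S.card * (-1) ^ Sᶜ.card := by
  rw [← pow_add, Finset.card_add_card_compl, Fintype.card_fin]

/-- A new form argument of the first factor changes the explicit sign of the product by `(-1) ^
#Sᶜ`. The normalisation of `kX` by `(-1) ^ w`, with `w = #S + #Sᶜ`, absorbs this and leaves the sign
`(-1) ^ #S` of `kX y c`. -/
theorem kX_mul (y : X) (c d : Co R G X) : kX y (c * d) = kX y c * d + tw c * kX y d := by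
  ext w v u α β x
  rw [kX_app, add_app, mul_app, mul_app, mul_app, Finset.mul_sum, ← Finset.sum_add_distrib]
  refine Finset.sum_congr rfl fun S _ => ?_
  rw [Finset.mul_sum, ← Finset.sum_add_distrib]
  refine Finset.sum_congr rfl fun T _ => ?_
  rw [sum_finset_fin_succ, mul_add, Finset.mul_sum, Finset.mul_sum, neg_one_pow_card S]
  have h : ((-1 : R) ^ Sᶜ.card) * (-1) ^ Sᶜ.card = 1 := by rw [← mul_pow]; simp
  congr 1
  · refine Finset.sum_congr rfl fun U _ => ?_
    rw [eval_pick_consSet U (fun k y => c _ _ k _ _ y) _ rfl,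
      eval_pick_shiftSet Uᶜ (fun k y => d _ _ k _ _ y) _ (compl_consSet U), shuffleSign_consSet,
      card_consSet, kX_app]
    simp only [Fin.cons_zero, Fin.tail_cons, add_mul, one_mul, pow_add]
    linear_combination ((shuffleSign S : ℤ) : R) * ((shuffleSign U : ℤ) : R) *
      (-1) ^ (U.card * Sᶜ.card) * (-1) ^ S.card *
      (c _ _ _ (pick α S) (pick β T) (Fin.cons y (pick x U)) *
            d _ _ _ (pick α Sᶜ) (pick β Tᶜ) (pick x Uᶜ)) * h
  · refine Finset.sum_congr rfl fun U _ => ?_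
    rw [eval_pick_shiftSet U (fun k y => c _ _ k _ _ y) _ rfl,
      eval_pick_consSet Uᶜ (fun k y => d _ _ k _ _ y) _ (compl_shiftSet U), shuffleSign_shiftSet,
      card_shiftSet, kX_app, tw_app]
    simp only [Fin.cons_zero, Fin.tail_cons]
    push_cast
    ring

theorem add_mul' (c d e : Co R G X) : (c + d) * e = c * e + d * e := by
  ext w v u α β x
  simp only [mul_app, add_app, add_mul, mul_add, Finset.sum_add_distrib]

theorem mul_add' (c d e : Co R G X) : c * (d + e) = c * d + c * e := by
  ext w v u α β x
  simp only [mul_app, add_app, mul_add, Finset.sum_add_distrib]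

theorem smul_mul' (f : R) (c d : Co R G X) : (f • c) * d = f • (c * d) := by
  ext w v u α β x
  simp only [mul_app, smul_app, Finset.mul_sum]
  refine Finset.sum_congr rfl fun S _ => Finset.sum_congr rfl fun T _ =>
      Finset.sum_congr rfl fun U _ => by ring

theorem mul_smul' (f : R) (c d : Co R G X) : c * (f • d) = f • (c * d) := by
  ext w v u α β x
  simp only [mul_app, smul_app, Finset.mul_sum]
  refine Finset.sum_congr rfl fun S _ => Finset.sum_congr rfl fun T _ =>
      Finset.sum_congr rfl fun U _ => by ring

theorem neg_mul' (c d : Co R G X) : (-c) * d = -(c * d) := by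
  simpa using smul_mul' (-1) c d

theorem mul_neg' (c d : Co R G X) : c * (-d) = -(c * d) := by
  simpa using mul_smul' (-1) c d

theorem zero_mul' (d : Co R G X) : (0 : Co R G X) * d = 0 := by
  simpa using smul_mul' (0 : R) (0 : Co R G X) d

theorem mul_zero' (d : Co R G X) : d * (0 : Co R G X) = 0 := by
  simpa using mul_smul' (0 : R) d (0 : Co R G X)

theorem tw_mul (c d : Co R G X) : tw (c * d) = tw c * tw d := by
  refine eq_of_contractions (fun p : Co R G X × Co R G X => tw (p.1 * p.2))
    (fun p => tw p.1 * tw p.2) ?_ ?_ ?_ ?_ (c, d)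
  · intro i; simp [tw_app]
  · intro n ih i a
    simp only [iA_mul, iA_tw, tw_add, neg_add_rev, tw_tw, neg_mul', mul_neg']
    rw [add_comm]
    refine (ih (iA a i.1, i.2)).neg.add ?_
    simpa using (ih (tw i.1, iA a i.2)).neg
  · intro n ih i a
    simp only [iB_mul, iB_tw, tw_add]
    exact (ih (iB a i.1, i.2)).add (ih (i.1, iB a i.2))
  · intro n ih i a
    simp only [kX_mul, kX_tw, tw_add, neg_add_rev, tw_tw, neg_mul', mul_neg']
    rw [add_comm]
    refine (ih (kX a i.1, i.2)).neg.add ?_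
    simpa using (ih (tw i.1, kX a i.2)).neg

/-- Both bracketings expand under contraction into the same three terms, because `tw` is
multiplicative; no combinatorics of triple shuffles is needed. -/
theorem mul_assoc' (c d e : Co R G X) : c * d * e = c * (d * e) := by
  refine eq_of_contractions (fun p : Co R G X × Co R G X × Co R G X => p.1 * p.2.1 * p.2.2)
    (fun p => p.1 * (p.2.1 * p.2.2)) ?_ ?_ ?_ ?_ (c, d, e)
  · intro i; simp [mul_assoc]
  · intro n ih i a
    simp only [iA_mul, add_mul', mul_add', tw_mul, ← add_assoc]
    exact ((ih (iA a i.1, i.2)).add (ih (tw i.1, iA a i.2.1, i.2.2))).add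
      (ih (tw i.1, tw i.2.1, iA a i.2.2))
  · intro n ih i a
    simp only [iB_mul, add_mul', mul_add', ← add_assoc]
    exact ((ih (iB a i.1, i.2)).add (ih (i.1, iB a i.2.1, i.2.2))).add
      (ih (i.1, i.2.1, iB a i.2.2))
  · intro n ih i a
    simp only [kX_mul, add_mul', mul_add', tw_mul, ← add_assoc]
    exact ((ih (kX a i.1, i.2)).add (ih (tw i.1, kX a i.2.1, i.2.2))).add
      (ih (tw i.1, tw i.2.1, kX a i.2.2))

/-- A function, as a cochain without arguments. -/
def cst (f : R) : Co R G X
  | 0, 0, 0, _, _, _ => f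
  | _, _, _, _, _, _ => 0

@[simp] theorem cst_app (f : R) (α β x) : (cst f : Co R G X) 0 0 0 α β x = f := rfl
@[simp] theorem iA_cst (a : G) (f : R) : iA a (cst f : Co R G X) = 0 := rfl
@[simp] theorem iB_cst (a : G) (f : R) : iB a (cst f : Co R G X) = 0 := by
  ext w v u α β x; cases w <;> rfl
@[simp] theorem kX_cst (y : X) (f : R) : kX y (cst f : Co R G X) = 0 := by
  ext w v u α β x; cases w <;> cases v <;> simp [kX_app, cst]
@[simp] theorem tw_cst (f : R) : tw (cst f : Co R G X) = cst f := by
  refine eq_of_contr (by simp [tw_app]) ?_ ?_ ?_ <;> intro a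
  · simp [iA_tw]
  · simp [iB_tw]
  · simp [kX_tw]

theorem cst_one : cst 1 = (1 : Co R G X) := by
  ext w v u α β x; cases w <;> cases v <;> cases u <;> rfl

theorem cst_mul (f : R) (c : Co R G X) : cst f * c = f • c := by
  refine eq_of_contractions (fun c : Co R G X => cst f * c) (fun c => f • c) ?_ ?_ ?_ ?_ c
  · intro i; simp
  · intro n ih i a
    simpa [iA_mul, zero_mul'] using ih (iA a i)
  · intro n ih i a
    simpa [iB_mul, zero_mul'] using ih (iB a i)
  · intro n ih i a
    simpa [kX_mul, zero_mul'] using ih (kX a i)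

theorem mul_cst (f : R) (c : Co R G X) : c * cst f = f • c := by
  refine eq_of_contractions (fun c : Co R G X => c * cst f) (fun c => f • c) ?_ ?_ ?_ ?_ c
  · intro i; simp [mul_comm]
  · intro n ih i a
    simpa [iA_mul, mul_zero'] using ih (iA a i)
  · intro n ih i a
    simpa [iB_mul, mul_zero'] using ih (iB a i)
  · intro n ih i a
    simpa [kX_mul, mul_zero'] using ih (kX a i)

instance : Ring (Co R G X) :=
  { (inferInstance : AddCommGroup (Co R G X)), (inferInstance : Mul (Co R G X)),
    (inferInstance : One (Co R G X)) with
    left_distrib := mul_add'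
    right_distrib := add_mul'
    zero_mul := zero_mul'
    mul_zero := mul_zero'
    mul_assoc := mul_assoc'
    one_mul := fun c => by rw [← cst_one, cst_mul, one_smul]
    mul_one := fun c => by rw [← cst_one, mul_cst, one_smul] }

instance : IsScalarTower R (Co R G X) (Co R G X) := ⟨smul_mul'⟩
instance : SMulCommClass R (Co R G X) (Co R G X) := ⟨fun f c d => (mul_smul' f c d).symm⟩

/-- Graded commutativity. -/
theorem mul_comm_of_parity (m n : ℕ) (c d : Co R G X) (hc : tw c = (-1 : R) ^ m • c)
    (hd : tw d = (-1 : R) ^ n • d) : c * d = (-1 : R) ^ (m * n) • (d * c) := by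
  have hodd : ∀ {m : ℕ} {c c' : Co R G X}, tw c = (-1 : R) ^ m • c → -tw c' = (-1 : R) ^ m • c' →
      tw c' = (-1 : R) ^ (m + 1) • c' := by
    intro m c c' _ h
    rw [pow_succ, mul_neg_one, neg_smul, ← h, neg_neg]
  have hA : ∀ {m : ℕ} {c : Co R G X} (a : G), tw c = (-1 : R) ^ m • c →
      tw (iA a c) = (-1 : R) ^ (m + 1) • iA a c := fun a h => by
    refine hodd h ?_
    rw [← iA_tw, h, iA_smul]
  have hX : ∀ {m : ℕ} {c : Co R G X} (a : X), tw c = (-1 : R) ^ m • c →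
      tw (kX a c) = (-1 : R) ^ (m + 1) • kX a c := fun a h => by
    refine hodd h ?_
    rw [← kX_tw, h, kX_smul]
  have hB : ∀ {m : ℕ} {c : Co R G X} (a : G), tw c = (-1 : R) ^ m • c →
      tw (iB a c) = (-1 : R) ^ m • iB a c := fun a h => by
    rw [← iB_tw, h, iB_smul]
  have sq : ∀ k : ℕ, (-1 : R) ^ k * (-1) ^ k = 1 := fun k => by rw [← mul_pow]; simp
  -- Parities are hypotheses on `tw`, not degrees: an odd contraction replaces `m` by `m + 1`, which
  -- has the parity of `m - 1` and needs no subtraction.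
  refine eq_of_contractions
    (ι := {p : (ℕ × ℕ) × (Co R G X × Co R G X) //
      tw p.2.1 = (-1 : R) ^ p.1.1 • p.2.1 ∧ tw p.2.2 = (-1 : R) ^ p.1.2 • p.2.2})
    (fun p => p.1.2.1 * p.1.2.2) (fun p => (-1 : R) ^ (p.1.1.1 * p.1.1.2) • (p.1.2.2 * p.1.2.1))
    ?_ ?_ ?_ ?_ ⟨((m, n), (c, d)), hc, hd⟩
  · rintro ⟨⟨⟨m, n⟩, ⟨c, d⟩⟩, hc, hd⟩
    dsimp only at hc hd ⊢
    -- For odd `m` the value without arguments equals its own negative, so the sign `(-1) ^ (m * n)`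
    -- has no effect on it.
    have h1 : m % 2 = 0 ∨ c 0 0 0 ![] ![] ![] = -c 0 0 0 ![] ![] ![] := by
      rcases Nat.mod_two_eq_zero_or_one m with h | h
      · exact .inl h
      · right
        have := congrArg (fun e : Co R G X => e 0 0 0 ![] ![] ![]) hc
        simpa [tw_app, (Nat.odd_iff.2 h).neg_one_pow] using this
    have h2 : (-1 : R) ^ (m * n) * c 0 0 0 ![] ![] ![] = c 0 0 0 ![] ![] ![] := by
      rcases h1 with h1 | h1
      · simp [(Nat.even_iff.2 h1).mul_right n |>.neg_one_pow]
      · rcases neg_one_pow_eq_or R (m * n) with h | h <;> rw [h]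
        · simp
        · simpa using h1.symm
    simp only [mul_app_zero, smul_app]
    rw [mul_left_comm, h2, mul_comm]
  · rintro k ih ⟨⟨⟨m, n⟩, ⟨c, d⟩⟩, hc, hd⟩ a
    dsimp only at hc hd ⊢
    have e1 := ih ⟨((m + 1, n), (iA a c, d)), hA a hc, hd⟩
    have e2 := (ih ⟨((m, n + 1), (c, iA a d)), hc, hA a hd⟩).smul ((-1) ^ m)
    simp only [iA_mul, iA_smul, hc, hd, smul_mul_assoc, smul_add, smul_smul] at e1 e2 ⊢
    rw [add_comm (((-1 : R) ^ (m * n)) • _)]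
    convert e1.add e2 using 3
    · ring
    · rw [Nat.mul_succ, pow_add, mul_left_comm, sq, mul_one]
  · rintro k ih ⟨⟨⟨m, n⟩, ⟨c, d⟩⟩, hc, hd⟩ a
    dsimp only at hc hd ⊢
    have e1 := ih ⟨((m, n), (iB a c, d)), hB a hc, hd⟩
    have e2 := (ih ⟨((m, n), (c, iB a d)), hc, hB a hd⟩)
    simp only [iB_mul, iB_smul, smul_add] at e1 e2 ⊢
    rw [add_comm (((-1 : R) ^ (m * n)) • _)]
    exact e1.add e2
  · rintro k ih ⟨⟨⟨m, n⟩, ⟨c, d⟩⟩, hc, hd⟩ a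
    dsimp only at hc hd ⊢
    have e1 := ih ⟨((m + 1, n), (kX a c, d)), hX a hc, hd⟩
    have e2 := (ih ⟨((m, n + 1), (c, kX a d)), hc, hX a hd⟩).smul ((-1) ^ m)
    simp only [kX_mul, kX_smul, hc, hd, smul_mul_assoc, smul_add, smul_smul] at e1 e2 ⊢
    rw [add_comm (((-1 : R) ^ (m * n)) • _)]
    convert e1.add e2 using 3
    · ring
    · rw [Nat.mul_succ, pow_add, mul_left_comm, sq, mul_one]

end Co

/-! ## Alternating sums over the arguments of a family of functions -/

section AltSum

variable {P N : Type*} [AddCommGroup N]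

/-- Insertion of a fixed first argument. -/
def contr (a : P) (η : ∀ n, (Fin n → P) → N) : ∀ n, (Fin n → P) → N :=
  fun n x => η (n + 1) (Fin.cons a x)

/-- `∑ᵢ (-1)^i g(xᵢ)(x₀,…,x̂ᵢ,…)`. -/
def altSum (g : P → ∀ n, (Fin n → P) → N) : ∀ n, (Fin n → P) → N
  | 0, _ => 0
  | n + 1, x => ∑ i : Fin (n + 1), (-1 : ℤ) ^ (i : ℕ) • g (x i) n (i.removeNth x)

/-- `∑_{i<j} (-1)^{i+j} g(xᵢ,xⱼ)(x₀,…,x̂ᵢ,…,x̂ⱼ,…)`. -/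
def altSum₂ (g : P → P → ∀ n, (Fin n → P) → N) : ∀ n, (Fin n → P) → N
  | n + 2, x => ∑ j : Fin (n + 2), ∑ i : Fin (n + 1),
      if i.castSucc < j then
        (-1 : ℤ) ^ ((i : ℕ) + (j : ℕ)) • g (x i.castSucc) (x j) n (i.removeNth (j.removeNth x))
      else 0
  | _, _ => 0

theorem removeNth_succ_cons {n : ℕ} (i : Fin (n + 1)) (a : P) (x : Fin (n + 1) → P) :
    i.succ.removeNth (Fin.cons a x : Fin (n + 2) → P) = Fin.cons a (i.removeNth x) := by
  conv_lhs => rw [← Fin.insertNth_self_removeNth i x]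
  have := Fin.insertNth_succ_cons i (x i) a (i.removeNth x)
  rw [← this]
  exact Fin.removeNth_insertNth _ _ _

theorem removeNth_zero_cons {n : ℕ} (a : P) (x : Fin n → P) :
    (0 : Fin (n + 1)).removeNth (Fin.cons a x : Fin (n + 1) → P) = x := by
  rw [Fin.removeNth_zero, Fin.tail_cons]

/-- The index `0` selects `a` itself; every other summand keeps `a` in front and has its index
shifted by one, hence the minus sign. -/
theorem contr_altSum (a : P) (g : P → ∀ n, (Fin n → P) → N) :
    contr a (altSum g) = g a - altSum fun b => contr a (g b) := by
  funext n x
  cases n with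
  | zero => simp [contr, altSum]
  | succ n =>
    simp only [contr, altSum, Pi.sub_apply, Fin.sum_univ_succ, Fin.val_zero, Fin.val_succ,
      Fin.cons_zero, Fin.cons_succ, removeNth_zero_cons, removeNth_succ_cons, pow_succ, pow_zero,
      one_smul]
    simp [neg_add_rev, sub_eq_add_neg, add_comm]

/-- Pairs starting with `0` give a single alternating sum. In the other pairs both indices are
shifted, so their sign is unchanged. -/
theorem contr_altSum₂ (a : P) (g : P → P → ∀ n, (Fin n → P) → N) :
    contr a (altSum₂ g) = (altSum₂ fun b c => contr a (g b c)) - altSum (g a) := by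
  funext n x
  cases n with
  | zero => simp [contr, altSum, altSum₂]
  | succ n =>
    change (∑ j : Fin (n + 2), ∑ i : Fin (n + 1),
      if i.castSucc < j then
        (-1 : ℤ) ^ ((i : ℕ) + (j : ℕ)) • g ((Fin.cons a x : Fin (n + 2) → P) i.castSucc)
          ((Fin.cons a x : Fin (n + 2) → P) j) n
          (i.removeNth (j.removeNth (Fin.cons a x : Fin (n + 2) → P)))
      else 0) = _
    rw [Fin.sum_univ_succ]
    simp only [Fin.not_lt_zero, if_false, Finset.sum_const_zero, zero_add, Fin.cons_succ,
      removeNth_succ_cons, Pi.sub_apply]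
    have e : ∀ j : Fin (n + 1), (∑ i : Fin (n + 1), if i.castSucc < j.succ then
        (-1 : ℤ) ^ ((i : ℕ) + (j.succ : ℕ)) • g ((Fin.cons a x : Fin (n + 2) → P) i.castSucc)
          (x j) n (i.removeNth (Fin.cons a (j.removeNth x) : Fin (n + 1) → P)) else 0) =
        -((-1 : ℤ) ^ (j : ℕ) • g a (x j) n (j.removeNth x)) +
        ∑ i : Fin n, if i.succ.castSucc < j.succ then
          (-1 : ℤ) ^ ((i.succ : ℕ) + (j.succ : ℕ)) •
            g ((Fin.cons a x : Fin (n + 2) → P) i.succ.castSucc)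
            (x j) n (i.succ.removeNth (Fin.cons a (j.removeNth x) : Fin (n + 1) → P)) else 0 := by
      intro j
      rw [Fin.sum_univ_succ]
      congr 1
      simp [pow_succ]
    rw [Finset.sum_congr rfl fun j _ => e j, Finset.sum_add_distrib, Finset.sum_neg_distrib,
      neg_add_eq_sub]
    congr 1
    cases n with
    | zero => simp [altSum₂]
    | succ n =>
      refine Finset.sum_congr rfl fun j _ => Finset.sum_congr rfl fun i _ => ?_
      have e2 : (-1 : ℤ) ^ ((i : ℕ) + 1 + ((j : ℕ) + 1)) = (-1) ^ ((i : ℕ) + j) := by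
        rw [show (i : ℕ) + 1 + ((j : ℕ) + 1) = i + j + 2 by ring, pow_add]; simp
      simp only [removeNth_succ_cons, contr, ← Fin.succ_castSucc, Fin.cons_succ, Fin.val_succ,
        Fin.succ_lt_succ_iff, e2]

theorem altSum_add (g h : P → ∀ n, (Fin n → P) → N) :
    altSum (fun a => g a + h a) = altSum g + altSum h := by
  funext n x
  cases n <;> simp [altSum, Finset.sum_add_distrib]

theorem altSum₂_add (g h : P → P → ∀ n, (Fin n → P) → N) :
    altSum₂ (fun a b => g a b + h a b) = altSum₂ g + altSum₂ h := by
  funext n x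
  match n, x with
  | 0, x => simp [altSum₂]
  | 1, x => simp [altSum₂]
  | n + 2, x =>
    simp only [altSum₂, Pi.add_apply, ← Finset.sum_add_distrib]
    refine Finset.sum_congr rfl fun j _ => Finset.sum_congr rfl fun i _ => ?_
    split_ifs <;> simp

/-- The additive map may vary with the number of arguments, as signs and weights do; the offset `k +
1` accounts for the argument that is removed. -/
theorem altSum_apply_congr {N' : Type*} [AddCommGroup N'] (s : ℕ → N →+ N')
    (g : P → ∀ n, (Fin n → P) → N) (n : ℕ) (x : Fin n → P) :
    altSum (fun a k y => s (k + 1) (g a k y)) n x = s n (altSum g n x) := by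
  cases n with
  | zero => simp [altSum]
  | succ n => simp [altSum]

theorem altSum₂_apply_congr {N' : Type*} [AddCommGroup N'] (s : ℕ → N →+ N')
    (g : P → P → ∀ n, (Fin n → P) → N) (n : ℕ) (x : Fin n → P) :
    altSum₂ (fun a b k y => s (k + 2) (g a b k y)) n x = s n (altSum₂ g n x) := by
  match n, x with
  | 0, x => simp [altSum₂]
  | 1, x => simp [altSum₂]
  | n + 2, x =>
    simp only [altSum₂, map_sum]
    refine Finset.sum_congr rfl fun j _ => Finset.sum_congr rfl fun i _ => ?_
    split_ifs <;> simp

/-- The position of an argument may be changed at the expense of a sign. -/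
def IsAnti (η : ∀ n, (Fin n → P) → N) : Prop :=
  ∀ n (i : Fin (n + 1)) (a : P) (x : Fin n → P),
    η (n + 1) (i.insertNth a x) = (-1 : ℤ) ^ (i : ℕ) • η (n + 1) (Fin.cons a x)

theorem IsAnti.contr_contr {η : ∀ n, (Fin n → P) → N} (h : IsAnti η) (a b : P) :
    contr a (contr b η) = -contr b (contr a η) := by
  funext n x
  have := h (n + 1) 1 a (Fin.cons b x)
  have e : (1 : Fin (n + 2)) = Fin.succ 0 := rfl
  rw [e, Fin.insertNth_succ_cons, Fin.insertNth_zero'] at this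
  simpa [contr] using this

theorem IsAnti.contr {η : ∀ n, (Fin n → P) → N} (h : IsAnti η) (a : P) : IsAnti (contr a η) := by
  intro n i b x
  have h1 := h (n + 1) i.succ b (Fin.cons a x)
  rw [Fin.insertNth_succ_cons] at h1
  have h2 := congrFun (congrFun (h.contr_contr a b) n) x
  simp only [WeilAlgebra.contr, Pi.neg_apply] at h1 h2 ⊢
  rw [h1, h2]
  simp [pow_succ]

/-- If the first two arguments anticommute in all iterated contractions, an argument in position `i`
can be moved to the front by `i` transpositions of neighbours. The set `S` records the stability
under contraction that the induction needs. -/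
theorem isAnti_of_closed {S : Set (∀ n, (Fin n → P) → N)} (hS : ∀ η ∈ S, ∀ a, contr a η ∈ S)
    (h : ∀ η ∈ S, ∀ a b, contr a (contr b η) = -contr b (contr a η)) :
    ∀ η ∈ S, IsAnti η := by
  intro η hη n
  induction n generalizing η with
  | zero =>
    intro i a x
    obtain rfl : i = 0 := Fin.fin_one_eq_zero i
    simp
  | succ n ih =>
    intro i a x
    cases i using Fin.cases with
    | zero => simp
    | succ i =>
      rw [← Fin.cons_self_tail x, Fin.insertNth_succ_cons]
      have h1 := ih _ (hS η hη (x 0)) i a (Fin.tail x)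
      have h2 := congrFun (congrFun (h η hη (x 0) a) n) (Fin.tail x)
      simp only [WeilAlgebra.contr, Pi.neg_apply] at h1 h2
      rw [h1, h2]
      simp [pow_succ]

theorem IsAnti.update {η : ∀ n, (Fin n → P) → N} (h : IsAnti η) (n : ℕ) (i : Fin (n + 1))
    (x : Fin (n + 1) → P) (a : P) :
    η (n + 1) (Function.update x i a) =
      (-1 : ℤ) ^ (i : ℕ) • η (n + 1) (Fin.cons a (i.removeNth x)) := by
  rw [← h]
  congr 1
  exact (Fin.insertNth_removeNth i a x).symm

theorem IsAnti.altSum_contr {η : ∀ n, (Fin n → P) → N} (h : IsAnti η) (e : P → P) (n : ℕ)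
    (x : Fin n → P) :
    altSum (fun b => WeilAlgebra.contr (e b) η) n x =
      ∑ i, η n (Function.update x i (e (x i))) := by
  cases n with
  | zero => simp [altSum]
  | succ n => simp only [altSum, h.update, WeilAlgebra.contr]

theorem koszul_eq (br : P → P → P) (L : P → N → N) (η : ∀ n, (Fin n → P) → N) :
    koszul br L η = altSum (fun b n x => L b (η n x)) + altSum₂ fun b c => contr (br b c) η := by
  funext n x
  match n, x with
  | 0, x => simp [koszul, altSum, altSum₂]
  | 1, x => simp [koszul, altSum, altSum₂]
  | n + 2, x => rfl

/-- Cartan's formula. The single sum contributes `L a`; the pairs containing `a` contribute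
insertions of `br a`, which antisymmetry rewrites as updates in place. -/
theorem contr_koszul (br : P → P → P) (L : P → N → N) {η : ∀ n, (Fin n → P) → N} (h : IsAnti η)
    (a : P) : contr a (koszul br L η) =
      (fun n x => L a (η n x) - ∑ i, η n (Function.update x i (br a (x i)))) -
        koszul br L (contr a η) := by
  have hc : contr a (altSum (fun b n x => L b (η n x)) + altSum₂ fun b c => contr (br b c) η) =
    contr a (altSum (fun b n x => L b (η n x))) + contr a (altSum₂ fun b c => contr (br b c) η) :=
    rfl
  rw [koszul_eq, koszul_eq, hc, contr_altSum, contr_altSum₂]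
  have h2 : (altSum₂ fun b c => contr a (contr (br b c) η)) =
      -altSum₂ fun b c => contr (br b c) (contr a η) := by
    simp only [fun b => h.contr_contr a b]
    funext n x
    exact altSum₂_apply_congr (fun _ => -AddMonoidHom.id N) _ n x
  rw [h2]
  funext n x
  simp only [Pi.add_apply, Pi.sub_apply, Pi.neg_apply, h.altSum_contr (br a)]
  change L a (η n x) - altSum (fun b n x => L b (contr a η n x)) n x + _ = _
  abel

end AltSum

namespace Co

variable {R G X : Type*} [CommRing R]

/-! ## Symmetry of cochains -/

/-- `c` is antisymmetric in the first and third kind of arguments and symmetric in the second. -/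
structure Anti (c : Co R G X) : Prop where
  A : ∀ v u β x, IsAnti fun n α => c n v u α β x
  B : ∀ w v u α (i : Fin (v + 1)) b β x,
    c w (v + 1) u α (i.insertNth b β) x = c w (v + 1) u α (Fin.cons b β) x
  X : ∀ w v α β, IsAnti fun n x => c w v n α β x

namespace Anti

variable {c d : Co R G X}

theorem iA_iA (h : Anti c) (a b : G) : iA a (iA b c) = -iA b (iA a c) := by
  ext w v u α β x
  exact congrFun (congrFun ((h.A v u β x).contr_contr a b) w) α

theorem iB_iB (h : Anti c) (a b : G) : iB a (iB b c) = iB b (iB a c) := by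
  ext w v u α β x
  have := h.B w (v + 1) u α 1 a (Fin.cons b β) x
  rw [show (1 : Fin (v + 2)) = Fin.succ 0 from rfl, Fin.insertNth_succ_cons,
    Fin.insertNth_zero'] at this
  exact this

theorem kX_kX (h : Anti c) (y z : X) : kX y (kX z c) = -kX z (kX y c) := by
  ext w v u α β x
  have := congrFun (congrFun ((h.X w v α β).contr_contr y z) u) x
  simp only [contr, Pi.neg_apply] at this
  simp [kX_app, this]

/-- Symmetry in all positions follows from the commutation of two successive contractions throughout
a set that is stable under contraction. -/
theorem of_closed {S : Set (Co R G X)}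
    (hA : ∀ c ∈ S, ∀ a, Co.iA a c ∈ S) (hB : ∀ c ∈ S, ∀ a, Co.iB a c ∈ S)
    (hX : ∀ c ∈ S, ∀ a, Co.kX a c ∈ S)
    (hAA : ∀ c ∈ S, ∀ a b, Co.iA a (Co.iA b c) = -Co.iA b (Co.iA a c))
    (hBB : ∀ c ∈ S, ∀ a b, Co.iB a (Co.iB b c) = Co.iB b (Co.iB a c))
    (hXX : ∀ c ∈ S, ∀ a b, Co.kX a (Co.kX b c) = -Co.kX b (Co.kX a c)) :
    ∀ c ∈ S, Anti c := by
  intro c hc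
  constructor
  · intro v u β x
    refine isAnti_of_closed (S := {η | ∃ c ∈ S, η = fun n α => c n v u α β x}) ?_ ?_ _
      ⟨c, hc, rfl⟩
    · rintro _ ⟨c, hc, rfl⟩ a
      exact ⟨_, hA c hc a, rfl⟩
    · rintro _ ⟨c, hc, rfl⟩ a b
      funext w α
      exact congrArg (fun c : Co R G X => c w v u α β x) (hAA c hc a b)
  · intro w v
    induction v generalizing c with
    | zero =>
      intro u α i a β x
      obtain rfl : i = 0 := Fin.fin_one_eq_zero i
      simp
    | succ n ih =>
      intro u α i a β x
      cases i using Fin.cases with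
      | zero => simp
      | succ i =>
        rw [← Fin.cons_self_tail β, Fin.insertNth_succ_cons]
        have h1 := ih _ (hB c hc (β 0)) u α i a (Fin.tail β) x
        have h2 := congrArg (fun c : Co R G X => c w n u α (Fin.tail β) x) (hBB c hc (β 0) a)
        exact h1.trans h2.symm
  · intro w v α β
    -- The exponent `k` absorbs the sign `(-1) ^ w` in `kX`, which makes the set stable under the
    -- unsigned contraction.
    refine isAnti_of_closed
      (S := {η | ∃ c ∈ S, ∃ k : ℕ, η = fun n x => (-1 : R) ^ k * c w v n α β x}) ?_ ?_ _
      ⟨c, hc, 0, by simp⟩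
    · rintro _ ⟨c, hc, k, rfl⟩ a
      refine ⟨_, hX c hc a, k + w, ?_⟩
      funext n x
      simp only [kX_app, contr, pow_add]
      have e : (-1 : R) ^ w * (-1) ^ w = 1 := by rw [← mul_pow]; simp
      linear_combination (-(-1) ^ k * c w v (n + 1) α β (Fin.cons a x)) * e
    · rintro _ ⟨c, hc, k, rfl⟩ a b
      funext u x
      have := congrArg (fun c : Co R G X => c w v u α β x) (hXX c hc a b)
      simp only [kX_app, neg_app, ← mul_assoc, ← mul_pow] at this
      simp only [neg_mul_neg, one_mul, one_pow] at this
      simp [contr, this]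

theorem add (hc : Anti c) (hd : Anti d) : Anti (c + d) where
  A v u β x n i a y := by
    have h1 := hc.A v u β x n i a y
    have h2 := hd.A v u β x n i a y
    simp only [add_app] at *
    rw [h1, h2, smul_add]
  B w v u α i b β x := by simp only [add_app, hc.B, hd.B]
  X w v α β n i a y := by
    have h1 := hc.X w v α β n i a y
    have h2 := hd.X w v α β n i a y
    simp only [add_app] at *
    rw [h1, h2, smul_add]

/-- Multiplication by scalars depending on the tridegree. -/
theorem scale (hc : Anti c) (s : ℕ → ℕ → ℕ → R) :
    Anti (fun w v u α β x => s w v u * c w v u α β x : Co R G X) where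
  A v u β x n i a y := by
    have h1 := hc.A v u β x n i a y
    simp only at *
    rw [h1, mul_smul_comm]
  B w v u α i b β x := by simp only [hc.B]
  X w v α β n i a y := by
    have h1 := hc.X w v α β n i a y
    simp only at *
    rw [h1, mul_smul_comm]

theorem smul (hc : Anti c) (f : R) : Anti (f • c) := hc.scale fun _ _ _ => f

theorem neg (hc : Anti c) : Anti (-c) := by simpa using hc.smul (-1)

theorem tw (hc : Anti c) : Anti (tw c) := hc.scale fun w _ u => (-1) ^ (w + u)

theorem zero : Anti (0 : Co R G X) :=
  ⟨fun _ _ _ _ _ _ _ _ => by simp, fun _ _ _ _ _ _ _ _ => rfl,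
    fun _ _ _ _ _ _ _ _ => by simp⟩

theorem iA (hc : Anti c) (a : G) : Anti (iA a c) where
  A v u β x := (hc.A v u β x).contr a
  B _ _ _ _ _ _ _ _ := hc.B _ _ _ _ _ _ _ _
  X _ _ _ _ := hc.X _ _ _ _

theorem iB (hc : Anti c) (a : G) : Anti (iB a c) where
  A v u β x := hc.A _ _ _ _
  B w v u α i b β x := by
    have h1 := hc.B w (v + 1) u α i.succ b (Fin.cons a β) x
    have h2 := congrArg (fun c : Co R G X => c w v u α β x) (hc.iB_iB a b)
    rw [Fin.insertNth_succ_cons] at h1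
    exact h1.trans h2
  X w v α β := hc.X _ _ _ _

theorem kX (hc : Anti c) (y : X) : Anti (kX y c) := by
  have : Anti (fun w v u α β x => c w v (u + 1) α β (Fin.cons y x) : Co R G X) :=
    { A := fun v u β x => hc.A _ _ _ _
      B := fun w v u α i b β x => hc.B _ _ _ _ _ _ _ _
      X := fun w v α β => (hc.X w v α β).contr y }
  exact this.scale fun w _ _ => (-1) ^ w

theorem cst (f : R) : Anti (cst f : Co R G X) := by
  refine of_closed (S := {c : Co R G X | c = Co.cst f ∨ c = 0}) ?_ ?_ ?_ ?_ ?_ ?_ _ (.inl rfl)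
  all_goals rintro _ (rfl | rfl) a <;> simp

/-- Contractions of products are sums of products, so the stable set is the additive group generated
by products of symmetric factors. On a product the mixed terms of two contractions cancel or match
by the Leibniz rules. -/
theorem mul (hc : Anti c) (hd : Anti d) : Anti (c * d) := by
  let S := AddSubgroup.closure {e : Co R G X | ∃ c d : Co R G X, Anti c ∧ Anti d ∧ e = c * d}
  have hmem : ∀ {c d : Co R G X}, Anti c → Anti d → c * d ∈ S := fun hc hd =>
    AddSubgroup.subset_closure ⟨_, _, hc, hd, rfl⟩
  have ind : ∀ (p : Co R G X → Prop), p 0 → (∀ c d, p c → p d → p (c + d)) →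
      (∀ c, p c → p (-c)) → (∀ c d, Anti c → Anti d → p (c * d)) → ∀ c ∈ S, p c := by
    intro p h0 h1 h2 h3 c hc
    induction hc using AddSubgroup.closure_induction with
    | mem x hx => obtain ⟨c, d, hc, hd, rfl⟩ := hx; exact h3 c d hc hd
    | zero => exact h0
    | add x y _ _ hx hy => exact h1 _ _ hx hy
    | neg x _ hx => exact h2 _ hx
  refine of_closed (S := (S : Set (Co R G X))) ?_ ?_ ?_ ?_ ?_ ?_ _ (hmem hc hd)
  · refine fun c hc a => ind (fun c => Co.iA a c ∈ S) S.zero_mem (fun _ _ => S.add_mem)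
      (fun _ => S.neg_mem) (fun c d hc hd => ?_) c hc
    rw [iA_mul]
    exact S.add_mem (hmem (hc.iA a) hd) (hmem hc.tw (hd.iA a))
  · refine fun c hc a => ind (fun c => Co.iB a c ∈ S) S.zero_mem (fun _ _ => S.add_mem)
      (fun _ => S.neg_mem) (fun c d hc hd => ?_) c hc
    rw [iB_mul]
    exact S.add_mem (hmem (hc.iB a) hd) (hmem hc (hd.iB a))
  · refine fun c hc a => ind (fun c => Co.kX a c ∈ S) (by simpa using S.zero_mem)
      (fun c d h1 h2 => by rw [kX_add]; exact S.add_mem h1 h2)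
      (fun c h => by rw [kX_neg]; exact S.neg_mem h) (fun c d hc hd => ?_) c hc
    rw [kX_mul]
    exact S.add_mem (hmem (hc.kX a) hd) (hmem hc.tw (hd.kX a))
  · refine fun c hc a b => ind (fun c => Co.iA a (Co.iA b c) = -Co.iA b (Co.iA a c)) (by simp)
      (fun c d h1 h2 => by simp [h1, h2, add_comm]) (fun c h => by simp [h])
      (fun c d hc hd => ?_) c hc
    simp only [iA_mul, iA_add, iA_tw, tw_tw, hc.iA_iA a b, hd.iA_iA a b]
    noncomm_ring
  · refine fun c hc a b => ind (fun c => Co.iB a (Co.iB b c) = Co.iB b (Co.iB a c)) (by simp)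
      (fun c d h1 h2 => by simp [h1, h2]) (fun c h => by simp [h])
      (fun c d hc hd => ?_) c hc
    simp only [iB_mul, iB_add, hc.iB_iB a b, hd.iB_iB a b]
    abel
  · refine fun c hc a b => ind (fun c => Co.kX a (Co.kX b c) = -Co.kX b (Co.kX a c)) (by simp)
      (fun c d h1 h2 => by simp [h1, h2, add_comm]) (fun c h => by simp [h])
      (fun c d hc hd => ?_) c hc
    simp only [kX_mul, kX_add, kX_tw, tw_tw, hc.kX_kX a b, hd.kX_kX a b]
    noncomm_ring

end Anti

/-! ## Graded derivations -/

/-- Even derivations (of (anti)symmetric cochains). -/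
structure EvenOp (T : Co R G X → Co R G X) : Prop where
  add : ∀ c d, T (c + d) = T c + T d
  tw : ∀ c, T (tw c) = Co.tw (T c)
  mul : ∀ c d, Anti c → Anti d → T (c * d) = T c * d + c * T d

/-- Odd derivations (of (anti)symmetric cochains). -/
structure OddOp (T : Co R G X → Co R G X) : Prop where
  add : ∀ c d, T (c + d) = T c + T d
  tw : ∀ c, T (tw c) = -Co.tw (T c)
  mul : ∀ c d, Anti c → Anti d → T (c * d) = T c * d + Co.tw c * T d

theorem OddOp.zero {T : Co R G X → Co R G X} (h : OddOp T) : T 0 = 0 := by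
  simpa using h.add 0 0

theorem OddOp.map_neg {T : Co R G X → Co R G X} (h : OddOp T) (c : Co R G X) : T (-c) = -T c := by
  have := h.add c (-c)
  rw [add_neg_cancel, h.zero] at this
  exact (neg_eq_of_add_eq_zero_right this.symm).symm

theorem EvenOp.neg {T : Co R G X → Co R G X} (h : EvenOp T) : EvenOp fun c => -T c :=
  ⟨fun c d => by rw [h.add, neg_add], fun c => by rw [h.tw, tw_neg],
    fun c d hc hd => by rw [h.mul c d hc hd]; noncomm_ring⟩

theorem OddOp.neg {T : Co R G X → Co R G X} (h : OddOp T) : OddOp fun c => -T c :=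
  ⟨fun c d => by rw [h.add, neg_add], fun c => by rw [h.tw, tw_neg],
    fun c d hc hd => by rw [h.mul c d hc hd]; noncomm_ring⟩

theorem OddOp.add_op {T U : Co R G X → Co R G X} (h : OddOp T) (h' : OddOp U) :
    OddOp fun c => T c + U c :=
  ⟨fun c d => by rw [h.add, h'.add]; abel, fun c => by rw [h.tw, h'.tw, tw_add, neg_add],
    fun c d hc hd => by rw [h.mul c d hc hd, h'.mul c d hc hd]; noncomm_ring⟩

theorem iA_oddOp (a : G) : OddOp (iA a : Co R G X → Co R G X) :=
  ⟨fun _ _ => rfl, fun c => iA_tw c a, fun c d _ _ => iA_mul a c d⟩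

theorem iB_evenOp (a : G) : EvenOp (iB a : Co R G X → Co R G X) :=
  ⟨fun _ _ => rfl, fun c => iB_tw c a, fun c d _ _ => iB_mul a c d⟩

theorem kX_oddOp (a : X) : OddOp (kX a : Co R G X → Co R G X) :=
  ⟨fun c d => kX_add c d a, fun c => kX_tw c a, fun c d _ _ => kX_mul a c d⟩

/-! ### Derivations characterised by their commutators with contractions -/

section Recursion

/-- The part of a cochain without arguments of the first kind vanishes. -/
def VanA (c : Co R G X) : Prop := ∀ v u α β x, c 0 v u α β x = 0
/-- The part of a cochain without arguments of the second kind vanishes. -/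
def VanB (c : Co R G X) : Prop := ∀ w u α β x, c w 0 u α β x = 0
/-- The part of a cochain without arguments of the third kind vanishes. -/
def VanX (c : Co R G X) : Prop := ∀ w v α β x, c w v 0 α β x = 0

theorem card_fin_zero (S : Finset (Fin 0)) : S.card = 0 := by
  obtain rfl : S = ∅ := Subsingleton.elim _ _
  rfl

variable {c d : Co R G X}

theorem VanA.app (hc : VanA c) {w : ℕ} (hw : w = 0) (v u α β x) : c w v u α β x = 0 := by
  subst hw; exact hc v u α β x
theorem VanB.app (hc : VanB c) {v : ℕ} (hv : v = 0) (w u α β x) : c w v u α β x = 0 := by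
  subst hv; exact hc w u α β x
theorem VanX.app (hc : VanX c) {u : ℕ} (hu : u = 0) (w v α β x) : c w v u α β x = 0 := by
  subst hu; exact hc w v α β x

theorem VanA.mul_right (hc : VanA c) (d : Co R G X) : VanA (c * d) := fun v u α β x => by
  simp [mul_app, fun S => hc.app (card_fin_zero S)]
theorem VanA.mul_left (hd : VanA d) (c : Co R G X) : VanA (c * d) := fun v u α β x => by
  simp [mul_app, fun S => hd.app (card_fin_zero S)]
theorem VanB.mul_right (hc : VanB c) (d : Co R G X) : VanB (c * d) := fun v u α β x => by
  simp [mul_app, fun S => hc.app (card_fin_zero S)]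
theorem VanB.mul_left (hd : VanB d) (c : Co R G X) : VanB (c * d) := fun v u α β x => by
  simp [mul_app, fun S => hd.app (card_fin_zero S)]
theorem VanX.mul_right (hc : VanX c) (d : Co R G X) : VanX (c * d) := fun v u α β x => by
  simp [mul_app, fun S => hc.app (card_fin_zero S)]
theorem VanX.mul_left (hd : VanX d) (c : Co R G X) : VanX (c * d) := fun v u α β x => by
  simp [mul_app, fun S => hd.app (card_fin_zero S)]

/-- Equality may be tested by contracting arguments of the first kind. -/
theorem eq_of_iA {ι : Sort*} (c d : ι → Co R G X)
    (h0 : ∀ i v u α β x, c i 0 v u α β x = d i 0 v u α β x)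
    (h : ∀ n, (∀ i v u α β x, c i n v u α β x = d i n v u α β x) →
      ∀ i a v u α β x, iA a (c i) n v u α β x = iA a (d i) n v u α β x) (i : ι) : c i = d i := by
  ext w v u α β x
  induction w generalizing i v u β x with
  | zero => exact h0 i v u α β x
  | succ w ih =>
    rw [← Fin.cons_self_tail α]
    exact h w (fun i v u α β x => ih i v u α β x) i (α 0) v u _ β x

theorem eq_of_iB {ι : Sort*} (c d : ι → Co R G X)
    (h0 : ∀ i w u α β x, c i w 0 u α β x = d i w 0 u α β x)
    (h : ∀ n, (∀ i w u α β x, c i w n u α β x = d i w n u α β x) →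
      ∀ i a w u α β x, iB a (c i) w n u α β x = iB a (d i) w n u α β x) (i : ι) : c i = d i := by
  ext w v u α β x
  induction v generalizing i w u α x with
  | zero => exact h0 i w u α β x
  | succ v ih =>
    rw [← Fin.cons_self_tail β]
    exact h v (fun i w u α β x => ih i w u α β x) i (β 0) w u α _ x

theorem eq_of_kX {ι : Sort*} (c d : ι → Co R G X)
    (h0 : ∀ i w v α β x, c i w v 0 α β x = d i w v 0 α β x)
    (h : ∀ n, (∀ i w v α β x, c i w v n α β x = d i w v n α β x) →
      ∀ i a w v α β x, kX a (c i) w v n α β x = kX a (d i) w v n α β x) (i : ι) : c i = d i := by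
  ext w v u α β x
  induction u generalizing i w v α β with
  | zero => exact h0 i w v α β x
  | succ u ih =>
    rw [← Fin.cons_self_tail x]
    have := h u (fun i w v α β x => ih i w v α β x) i (x 0) w v α β (Fin.tail x)
    simp only [kX_app] at this
    have e : ∀ r : R, (-1 : R) ^ w * ((-1) ^ w * r) = r := fun r => by
      rw [← mul_assoc, ← mul_pow]; simp
    rw [← e (c i _ _ _ _ _ _), this, e]

/-- The pairs of (anti)symmetric cochains. -/
abbrev AntiPair (R G X : Type*) [CommRing R] : Type _ :=
  {p : Co R G X × Co R G X // Anti p.1 ∧ Anti p.2}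

/-- If the commutators of `T` with contractions are derivations, the Leibniz defect of `T` obeys a
homogeneous recursion. It starts from zero because `T` takes values without a component of exterior
degree zero. The variants below treat the other kinds of arguments and parities alike. -/
theorem oddOp_of_iA {T : Co R G X → Co R G X} (T' : G → Co R G X → Co R G X)
    (h0 : ∀ c, VanA (T c)) (hadd : ∀ c d, T (c + d) = T c + T d)
    (htw : ∀ c, T (tw c) = -tw (T c)) (hT' : ∀ a, EvenOp (T' a))
    (hT : ∀ a c, Anti c → iA a (T c) = T' a c - T (iA a c)) : OddOp T where
  add := hadd
  tw := htw
  mul c d hc hd := by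
    refine eq_of_iA (ι := AntiPair R G X) (fun p => T (p.1.1 * p.1.2))
      (fun p => T p.1.1 * p.1.2 + tw p.1.1 * T p.1.2) ?_ ?_ ⟨(c, d), hc, hd⟩
    · rintro ⟨⟨c, d⟩, hc, hd⟩ v u α β x
      dsimp only
      rw [add_app, h0, (h0 c).mul_right, (h0 d).mul_left, add_zero]
    · rintro n ih ⟨⟨c, d⟩, hc, hd⟩ a v u α β x
      have e1 := ih ⟨(iA a c, d), hc.iA a, hd⟩ v u α β x
      have e2 := ih ⟨(tw c, iA a d), hc.tw, hd.iA a⟩ v u α β x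
      dsimp only at e1 e2 ⊢
      rw [hT a _ (hc.mul hd), (hT' a).mul c d hc hd, iA_mul, hadd]
      simp only [iA_add, iA_mul, hT a c hc, hT a d hd, iA_tw, tw_tw, htw,
        add_app, sub_app, e1, e2]
      simp only [← add_app, ← sub_app]
      refine congrArg (fun e : Co R G X => e _ _ _ _ _ _) ?_
      noncomm_ring

theorem evenOp_of_iA {T : Co R G X → Co R G X} (T' : G → Co R G X → Co R G X)
    (h0 : ∀ c, VanA (T c)) (hadd : ∀ c d, T (c + d) = T c + T d)
    (htw : ∀ c, T (tw c) = tw (T c)) (hT' : ∀ a, OddOp (T' a))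
    (hT : ∀ a c, Anti c → iA a (T c) = T' a c + T (iA a c)) : EvenOp T where
  add := hadd
  tw := htw
  mul c d hc hd := by
    refine eq_of_iA (ι := AntiPair R G X) (fun p => T (p.1.1 * p.1.2))
      (fun p => T p.1.1 * p.1.2 + p.1.1 * T p.1.2) ?_ ?_ ⟨(c, d), hc, hd⟩
    · rintro ⟨⟨c, d⟩, hc, hd⟩ v u α β x
      dsimp only
      rw [add_app, h0, (h0 c).mul_right, (h0 d).mul_left, add_zero]
    · rintro n ih ⟨⟨c, d⟩, hc, hd⟩ a v u α β x
      have e1 := ih ⟨(iA a c, d), hc.iA a, hd⟩ v u α β x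
      have e2 := ih ⟨(tw c, iA a d), hc.tw, hd.iA a⟩ v u α β x
      dsimp only at e1 e2 ⊢
      rw [hT a _ (hc.mul hd), (hT' a).mul c d hc hd, iA_mul, hadd]
      simp only [iA_add, iA_mul, hT a c hc, hT a d hd, htw,
        add_app, e1, e2]
      simp only [← add_app]
      refine congrArg (fun e : Co R G X => e _ _ _ _ _ _) ?_
      noncomm_ring

theorem oddOp_of_iB {T : Co R G X → Co R G X} (T' : G → Co R G X → Co R G X)
    (h0 : ∀ c, VanB (T c)) (hadd : ∀ c d, T (c + d) = T c + T d)
    (htw : ∀ c, T (tw c) = -tw (T c)) (hT' : ∀ a, OddOp (T' a))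
    (hT : ∀ a c, iB a (T c) = T' a c + T (iB a c)) : OddOp T where
  add := hadd
  tw := htw
  mul c d hc hd := by
    refine eq_of_iB (ι := AntiPair R G X) (fun p => T (p.1.1 * p.1.2))
      (fun p => T p.1.1 * p.1.2 + tw p.1.1 * T p.1.2) ?_ ?_ ⟨(c, d), hc, hd⟩
    · rintro ⟨⟨c, d⟩, hc, hd⟩ v u α β x
      dsimp only
      rw [add_app, h0, (h0 c).mul_right, (h0 d).mul_left, add_zero]
    · rintro n ih ⟨⟨c, d⟩, hc, hd⟩ a v u α β x
      have e1 := ih ⟨(iB a c, d), hc.iB a, hd⟩ v u α β x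
      have e2 := ih ⟨(c, iB a d), hc, hd.iB a⟩ v u α β x
      dsimp only at e1 e2 ⊢
      rw [hT a _, (hT' a).mul c d hc hd, iB_mul, hadd]
      simp only [iB_add, iB_mul, hT a c, hT a d, iB_tw, add_app, e1, e2]
      simp only [← add_app]
      refine congrArg (fun e : Co R G X => e _ _ _ _ _ _) ?_
      noncomm_ring

theorem oddOp_of_kX {T : Co R G X → Co R G X} (T' : X → Co R G X → Co R G X)
    (h0 : ∀ c, VanX (T c)) (hadd : ∀ c d, T (c + d) = T c + T d)
    (htw : ∀ c, T (tw c) = -tw (T c)) (hT' : ∀ a, EvenOp (T' a))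
    (hT : ∀ a c, Anti c → kX a (T c) = T' a c - T (kX a c)) : OddOp T where
  add := hadd
  tw := htw
  mul c d hc hd := by
    refine eq_of_kX (ι := AntiPair R G X) (fun p => T (p.1.1 * p.1.2))
      (fun p => T p.1.1 * p.1.2 + tw p.1.1 * T p.1.2) ?_ ?_ ⟨(c, d), hc, hd⟩
    · rintro ⟨⟨c, d⟩, hc, hd⟩ v u α β x
      dsimp only
      rw [add_app, h0, (h0 c).mul_right, (h0 d).mul_left, add_zero]
    · rintro n ih ⟨⟨c, d⟩, hc, hd⟩ a v u α β x
      have e1 := ih ⟨(kX a c, d), hc.kX a, hd⟩ v u α β x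
      have e2 := ih ⟨(tw c, kX a d), hc.tw, hd.kX a⟩ v u α β x
      dsimp only at e1 e2 ⊢
      rw [hT a _ (hc.mul hd), (hT' a).mul c d hc hd, kX_mul, hadd]
      simp only [kX_add, kX_mul, hT a c hc, hT a d hd, kX_tw, tw_tw, htw,
        add_app, sub_app, e1, e2]
      simp only [← add_app, ← sub_app]
      refine congrArg (fun e : Co R G X => e _ _ _ _ _ _) ?_
      noncomm_ring

theorem evenOp_of_kX {T : Co R G X → Co R G X} (T' : X → Co R G X → Co R G X)
    (h0 : ∀ c, VanX (T c)) (hadd : ∀ c d, T (c + d) = T c + T d)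
    (htw : ∀ c, T (tw c) = tw (T c)) (hT' : ∀ a, OddOp (T' a))
    (hT : ∀ a c, Anti c → kX a (T c) = T' a c + T (kX a c)) : EvenOp T where
  add := hadd
  tw := htw
  mul c d hc hd := by
    refine eq_of_kX (ι := AntiPair R G X) (fun p => T (p.1.1 * p.1.2))
      (fun p => T p.1.1 * p.1.2 + p.1.1 * T p.1.2) ?_ ?_ ⟨(c, d), hc, hd⟩
    · rintro ⟨⟨c, d⟩, hc, hd⟩ v u α β x
      dsimp only
      rw [add_app, h0, (h0 c).mul_right, (h0 d).mul_left, add_zero]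
    · rintro n ih ⟨⟨c, d⟩, hc, hd⟩ a v u α β x
      have e1 := ih ⟨(kX a c, d), hc.kX a, hd⟩ v u α β x
      have e2 := ih ⟨(tw c, kX a d), hc.tw, hd.kX a⟩ v u α β x
      dsimp only at e1 e2 ⊢
      rw [hT a _ (hc.mul hd), (hT' a).mul c d hc hd, kX_mul, hadd]
      simp only [kX_add, kX_mul, hT a c hc, hT a d hd, htw,
        add_app, e1, e2]
      simp only [← add_app]
      refine congrArg (fun e : Co R G X => e _ _ _ _ _ _) ?_
      noncomm_ring

end Recursion

end Co

namespace Co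

variable {R G X : Type*} [CommRing R]

/-! ## Building blocks of the differentials -/

/-- Multiplication by scalars depending on the bidegree. -/
def wt (s : ℕ → ℕ → ℤ) (c : Co R G X) : Co R G X :=
  fun w v u α β x => ((s (w + v) (u + v) : ℤ) : R) * c w v u α β x

theorem wt_app (s : ℕ → ℕ → ℤ) (c : Co R G X) (w v u α β x) :
    wt s c w v u α β x = ((s (w + v) (u + v) : ℤ) : R) * c w v u α β x := rfl

theorem tw_eq_wt (c : Co R G X) : tw c = wt (fun p q => (-1) ^ (p + q)) c := by
  ext w v u α β x
  rw [tw_app, wt_app, show w + v + (u + v) = w + u + 2 * v by ring, pow_add _ (w + u), pow_mul]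
  push_cast
  simp

/-- `T` shifts the bidegree by `(k - i, l - j)`. -/
def HasWt (T : Co R G X → Co R G X) (i j k l : ℕ) : Prop :=
  ∀ (s : ℕ → ℕ → ℤ) (c : Co R G X),
    T (wt (fun p q => s (p + i) (q + j)) c) = wt (fun p q => s (p + k) (q + l)) (T c)

/-- The involution `tw` is the weight `(-1) ^ (p + q)`, so the parity of the shift decides whether
`T` commutes or anticommutes with it. Using two offsets on each side avoids subtraction of degrees.
-/
theorem HasWt.tw_comm {T : Co R G X → Co R G X} {i j k l : ℕ} (h : HasWt T i j k l)
    (hadd : ∀ c d, T (c + d) = T c + T d) (c : Co R G X) :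
    T (tw c) = (-1 : R) ^ (i + j + k + l) • tw (T c) := by
  have h0 : T 0 = 0 := by simpa using hadd 0 0
  have hneg : ∀ c, T (-c) = -T c := fun c => by
    have := hadd c (-c)
    rw [add_neg_cancel, h0] at this
    exact (neg_eq_of_add_eq_zero_right this.symm).symm
  have hsm : ∀ (n : ℕ) c, T ((-1 : R) ^ n • c) = (-1 : R) ^ n • T c := fun n c => by
    rcases neg_one_pow_eq_or R n with e | e <;> simp [e, hneg]
  have e1 : tw c = (-1 : R) ^ (i + j) • wt (fun p q => (-1) ^ (p + i + (q + j))) c := by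
    rw [tw_eq_wt]
    ext w v u α β x
    simp only [wt_app, smul_app]
    push_cast
    rw [show w + v + i + (u + v + j) = w + v + (u + v) + (i + j) by ring, pow_add _ _ (i + j),
      mul_assoc, mul_left_comm, ← mul_assoc ((-1 : R) ^ (i + j)), ← mul_pow]
    simp
  rw [e1, hsm, h (fun p q => (-1) ^ (p + q)) c, tw_eq_wt]
  ext w v u α β x
  simp only [wt_app, smul_app]
  push_cast
  ring

section Weights

variable (a : G) (y : X)

theorem iA_hasWt : HasWt (iA a : Co R G X → Co R G X) 0 0 1 0 := fun s c => by
  ext w v u α β x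
  simp only [iA_app, wt_app, add_zero]
  rw [show w + 1 + v = w + v + 1 by ring]

theorem iB_hasWt : HasWt (iB a : Co R G X → Co R G X) 0 0 1 1 := fun s c => by
  ext w v u α β x
  simp only [iB_app, wt_app, add_zero]
  rfl

theorem kX_hasWt : HasWt (kX y : Co R G X → Co R G X) 0 0 0 1 := fun s c => by
  ext w v u α β x
  simp only [kX_app, wt_app, add_zero]
  rw [show u + 1 + v = u + v + 1 by ring]
  ring

theorem HasWt.add_op {T U : Co R G X → Co R G X} {i j k l : ℕ} (h : HasWt T i j k l)
    (h' : HasWt U i j k l) : HasWt (fun c => T c + U c) i j k l := fun s c => by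
  dsimp only; rw [h, h']; ext; simp [wt_app, mul_add]

theorem HasWt.neg {T : Co R G X → Co R G X} {i j k l : ℕ} (h : HasWt T i j k l) :
    HasWt (fun c => -T c) i j k l := fun s c => by
  dsimp only; rw [h]; ext; simp [wt_app]

theorem HasWt.shift {T : Co R G X → Co R G X} {i j k l : ℕ} (h : HasWt T i j k l) (m n : ℕ) :
    HasWt T (i + m) (j + n) (k + m) (l + n) := fun s c => by
  have := h (fun p q => s (p + m) (q + n)) c
  simpa only [add_assoc] using this

end Weights

/-! ### Sums over arguments -/

/-- `∑ᵢ (-1)^i (U αᵢ c)(…,α̂ᵢ,…)`. -/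
def altA (U : G → Co R G X → Co R G X) (c : Co R G X) : Co R G X := fun w v u α β x =>
  altSum (fun a n α' => U a c n v u α' β x) w α

/-- `∑_{i<j} (-1)^{i+j} (U αᵢ αⱼ c)(…,α̂ᵢ,…,α̂ⱼ,…)`. -/
def altA₂ (U : G → G → Co R G X → Co R G X) (c : Co R G X) : Co R G X := fun w v u α β x =>
  altSum₂ (fun a b n α' => U a b c n v u α' β x) w α

/-- `(-1)^w ∑ᵢ (-1)^i (U xᵢ c)(…,x̂ᵢ,…)`. -/
def altX (U : X → Co R G X → Co R G X) (c : Co R G X) : Co R G X := fun w v u α β x =>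
  (-1) ^ w * altSum (fun y n x' => U y c w v n α β x') u x

/-- `∑_{i<j} (-1)^{i+j} (U xᵢ xⱼ c)(…,x̂ᵢ,…,x̂ⱼ,…)`. -/
def altX₂ (U : X → X → Co R G X → Co R G X) (c : Co R G X) : Co R G X := fun w v u α β x =>
  altSum₂ (fun y z n x' => U y z c w v n α β x') u x

theorem iA_altA (U : G → Co R G X → Co R G X) (c : Co R G X) (a : G) :
    iA a (altA U c) = U a c - altA (fun b _ => iA a (U b c)) c := by
  ext w v u α β x
  exact congrFun (congrFun (contr_altSum a fun b n α' => U b c n v u α' β x) w) α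

theorem iA_altA₂ (U : G → G → Co R G X → Co R G X) (c : Co R G X) (a : G) :
    iA a (altA₂ U c) = altA₂ (fun b d _ => iA a (U b d c)) c - altA (U a) c := by
  ext w v u α β x
  exact congrFun (congrFun (contr_altSum₂ a fun b d n α' => U b d c n v u α' β x) w) α

theorem neg_one_pow_mul_self (w : ℕ) : (-1 : R) ^ w * (-1) ^ w = 1 := by rw [← mul_pow]; simp

theorem altSum_mul {P : Type*} (r : R) (g : P → ∀ n, (Fin n → P) → R) (n : ℕ) (x : Fin n → P) :
    altSum (fun a k y => r * g a k y) n x = r * altSum g n x :=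
  altSum_apply_congr (fun _ => AddMonoidHom.mulLeft r) g n x

theorem altSum₂_mul {P : Type*} (r : R) (g : P → P → ∀ n, (Fin n → P) → R) (n : ℕ)
    (x : Fin n → P) :
    altSum₂ (fun a b k y => r * g a b k y) n x = r * altSum₂ g n x :=
  altSum₂_apply_congr (fun _ => AddMonoidHom.mulLeft r) g n x

theorem kX_altX (U : X → Co R G X → Co R G X) (c : Co R G X) (y : X) :
    kX y (altX U c) = U y c - altX (fun z _ => kX y (U z c)) c := by
  ext w v u α β x
  have h := congrFun (congrFun (contr_altSum y fun z n x' => U z c w v n α β x') u) x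
  simp only [contr, Pi.sub_apply] at h
  simp only [kX_app, altX, sub_app, altSum_mul, h]
  rw [← mul_assoc, neg_one_pow_mul_self, one_mul, ← mul_assoc, neg_one_pow_mul_self, one_mul]
  rfl

theorem kX_altX₂ (U : X → X → Co R G X → Co R G X) (c : Co R G X) (y : X) :
    kX y (altX₂ U c) = altX₂ (fun b d _ => kX y (U b d c)) c - altX (U y) c := by
  ext w v u α β x
  have h := congrFun (congrFun (contr_altSum₂ y fun b d n x' => U b d c w v n α β x') u) x
  simp only [contr, Pi.sub_apply] at h
  simp only [kX_app, altX, altX₂, sub_app, altSum₂_mul, h]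
  rw [mul_sub]
  rfl

theorem altA_hasWt {U : G → Co R G X → Co R G X} {i j k l : ℕ}
    (hU : ∀ a, HasWt (U a) i j (k + 1) l) : HasWt (altA U) i j k l := fun s c => by
  ext w v u α β x
  simp only [altA, hU _ s c, wt_app]
  refine Eq.trans ?_ (altSum_apply_congr
    (fun n => AddMonoidHom.mulLeft ((s (n + v + k) (u + v + l) : ℤ) : R)) _ w α)
  congr 1; funext a n α'
  simp only [AddMonoidHom.coe_mulLeft]
  congr 3; ring

theorem altA₂_hasWt {U : G → G → Co R G X → Co R G X} {i j k l : ℕ}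
    (hU : ∀ a b, HasWt (U a b) i j (k + 2) l) : HasWt (altA₂ U) i j k l := fun s c => by
  ext w v u α β x
  simp only [altA₂, hU _ _ s c, wt_app]
  refine Eq.trans ?_ (altSum₂_apply_congr
    (fun n => AddMonoidHom.mulLeft ((s (n + v + k) (u + v + l) : ℤ) : R)) _ w α)
  congr 1; funext a b n α'
  simp only [AddMonoidHom.coe_mulLeft]
  congr 3; ring

theorem altX_hasWt {U : X → Co R G X → Co R G X} {i j k l : ℕ}
    (hU : ∀ a, HasWt (U a) i j k (l + 1)) : HasWt (altX U) i j k l := fun s c => by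
  ext w v u α β x
  simp only [altX, hU _ s c, wt_app]
  rw [mul_left_comm]
  congr 1
  refine Eq.trans ?_ (altSum_apply_congr
    (fun n => AddMonoidHom.mulLeft ((s (w + v + k) (n + v + l) : ℤ) : R)) _ u x)
  congr 1; funext a n α'
  simp only [AddMonoidHom.coe_mulLeft]
  congr 3; ring

theorem altX₂_hasWt {U : X → X → Co R G X → Co R G X} {i j k l : ℕ}
    (hU : ∀ a b, HasWt (U a b) i j k (l + 2)) : HasWt (altX₂ U) i j k l := fun s c => by
  ext w v u α β x
  simp only [altX₂, hU _ _ s c, wt_app]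
  refine Eq.trans ?_ (altSum₂_apply_congr
    (fun n => AddMonoidHom.mulLeft ((s (w + v + k) (n + v + l) : ℤ) : R)) _ u x)
  congr 1; funext a b n α'
  simp only [AddMonoidHom.coe_mulLeft]
  congr 3; ring

theorem altA_add {U : G → Co R G X → Co R G X} (hU : ∀ a c d, U a (c + d) = U a c + U a d)
    (c d : Co R G X) : altA U (c + d) = altA U c + altA U d := by
  ext w v u α β x
  simp only [altA, hU, add_app]
  exact congrFun (congrFun (altSum_add (fun a n α' => U a c n v u α' β x)
    (fun a n α' => U a d n v u α' β x)) w) α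

theorem altA₂_add {U : G → G → Co R G X → Co R G X}
    (hU : ∀ a b c d, U a b (c + d) = U a b c + U a b d)
    (c d : Co R G X) : altA₂ U (c + d) = altA₂ U c + altA₂ U d := by
  ext w v u α β x
  simp only [altA₂, hU, add_app]
  exact congrFun (congrFun (altSum₂_add (fun a b n α' => U a b c n v u α' β x)
    (fun a b n α' => U a b d n v u α' β x)) w) α

theorem altX_add {U : X → Co R G X → Co R G X} (hU : ∀ a c d, U a (c + d) = U a c + U a d)
    (c d : Co R G X) : altX U (c + d) = altX U c + altX U d := by
  ext w v u α β x
  simp only [altX, hU, add_app, ← mul_add]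
  congr 1
  exact congrFun (congrFun (altSum_add (fun a n x' => U a c w v n α β x')
    (fun a n x' => U a d w v n α β x')) u) x

theorem altX₂_add {U : X → X → Co R G X → Co R G X}
    (hU : ∀ a b c d, U a b (c + d) = U a b c + U a b d)
    (c d : Co R G X) : altX₂ U (c + d) = altX₂ U c + altX₂ U d := by
  ext w v u α β x
  simp only [altX₂, hU, add_app]
  exact congrFun (congrFun (altSum₂_add (fun a b n x' => U a b c w v n α β x')
    (fun a b n x' => U a b d w v n α β x')) u) x

theorem altA_vanA (U : G → Co R G X → Co R G X) (c : Co R G X) : VanA (altA U c) :=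
  fun _ _ _ _ _ => rfl
theorem altA₂_vanA (U : G → G → Co R G X → Co R G X) (c : Co R G X) : VanA (altA₂ U c) :=
  fun _ _ _ _ _ => rfl
theorem altX_vanX (U : X → Co R G X → Co R G X) (c : Co R G X) : VanX (altX U c) :=
  fun _ _ _ _ _ => by simp [altX, altSum]
theorem altX₂_vanX (U : X → X → Co R G X → Co R G X) (c : Co R G X) : VanX (altX₂ U c) :=
  fun _ _ _ _ _ => rfl

theorem iA_altA_of_comm {U : G → Co R G X → Co R G X}
    (hc : ∀ a b c, iA a (U b c) = U b (iA a c)) (a : G) (c : Co R G X) :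
    iA a (altA U c) = U a c - altA U (iA a c) := by
  rw [iA_altA]; simp only [hc]; rfl

theorem kX_altX_of_comm {U : X → Co R G X → Co R G X}
    (hc : ∀ a b c, kX a (U b c) = U b (kX a c)) (a : X) (c : Co R G X) :
    kX a (altX U c) = U a c - altX U (kX a c) := by
  rw [kX_altX]; simp only [hc]; rfl

/-- The commutator of `altA U` with `iA a` is `U a`. The weights `i j k l` serve only to fix the
parity. -/
theorem altA_oddOp {U : G → Co R G X → Co R G X} (hU : ∀ a, EvenOp (U a))
    (hw : ∃ i j k l, Even (i + j + k + l + 1) ∧ ∀ a, HasWt (U a) i j (k + 1) l)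
    (hc : ∀ a b c, iA a (U b c) = U b (iA a c)) : OddOp (altA U) := by
  have hadd := altA_add fun a => (hU a).add
  refine oddOp_of_iA U (altA_vanA U) hadd (fun c => ?_) hU fun a c _ => iA_altA_of_comm hc a c
  obtain ⟨i, j, k, l, he, hw⟩ := hw
  rw [(altA_hasWt hw).tw_comm hadd]
  rw [show (-1 : R) ^ (i + j + k + l) = -1 from Odd.neg_one_pow (by
    rcases Nat.even_or_odd (i + j + k + l) with h | h
    · exact absurd he (Nat.not_even_iff_odd.2 h.add_one)
    · exact h)]
  simp

theorem altX_oddOp {U : X → Co R G X → Co R G X} (hU : ∀ a, EvenOp (U a))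
    (hw : ∃ i j k l, Even (i + j + k + l + 1) ∧ ∀ a, HasWt (U a) i j k (l + 1))
    (hc : ∀ a b c, kX a (U b c) = U b (kX a c)) : OddOp (altX U) := by
  have hadd := altX_add fun a => (hU a).add
  refine oddOp_of_kX U (altX_vanX U) hadd (fun c => ?_) hU fun a c _ => kX_altX_of_comm hc a c
  obtain ⟨i, j, k, l, he, hw⟩ := hw
  rw [(altX_hasWt hw).tw_comm hadd]
  rw [show (-1 : R) ^ (i + j + k + l) = -1 from Odd.neg_one_pow (by
    rcases Nat.even_or_odd (i + j + k + l) with h | h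
    · exact absurd he (Nat.not_even_iff_odd.2 h.add_one)
    · exact h)]
  simp

/-- Contraction turns the sum over pairs into minus the single sum `altA (U a)`, which is odd by the
previous case. -/
theorem altA₂_evenOp {U : G → G → Co R G X → Co R G X} (hU : ∀ a b, EvenOp (U a b))
    (hw : ∃ i j k l, Even (i + j + k + l) ∧ ∀ a b, HasWt (U a b) i j (k + 2) l)
    (hc : ∀ a b d c, iA a (U b d c) = U b d (iA a c)) : EvenOp (altA₂ U) := by
  have hadd := altA₂_add fun a b => (hU a b).add
  obtain ⟨i, j, k, l, he, hw⟩ := hw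
  refine evenOp_of_iA (fun a c => -altA (U a) c) (altA₂_vanA U) hadd (fun c => ?_)
    (fun a => (altA_oddOp (hU a) ⟨i, j, k + 1, l, ?_, hw a⟩ fun b d c => hc b a d c).neg)
    fun a c _ => ?_
  · rw [(altA₂_hasWt hw).tw_comm hadd, he.neg_one_pow, one_smul]
  · rw [show i + j + (k + 1) + l + 1 = i + j + k + l + 2 by ring]
    exact he.add even_two
  · rw [iA_altA₂]; simp only [hc]
    rw [neg_add_eq_sub]; rfl

theorem altX₂_evenOp {U : X → X → Co R G X → Co R G X} (hU : ∀ a b, EvenOp (U a b))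
    (hw : ∃ i j k l, Even (i + j + k + l) ∧ ∀ a b, HasWt (U a b) i j k (l + 2))
    (hc : ∀ a b d c, kX a (U b d c) = U b d (kX a c)) : EvenOp (altX₂ U) := by
  have hadd := altX₂_add fun a b => (hU a b).add
  obtain ⟨i, j, k, l, he, hw⟩ := hw
  refine evenOp_of_kX (fun a c => -altX (U a) c) (altX₂_vanX U) hadd (fun c => ?_)
    (fun a => (altX_oddOp (hU a) ⟨i, j, k, l + 1, ?_, hw a⟩ fun b d c => hc b a d c).neg)
    fun a c _ => ?_
  · rw [(altX₂_hasWt hw).tw_comm hadd, he.neg_one_pow, one_smul]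
  · rw [show i + j + k + (l + 1) + 1 = i + j + k + l + 2 by ring]
    exact he.add even_two
  · rw [kX_altX₂]; simp only [hc]
    rw [neg_add_eq_sub]; rfl

/-! ### Lie derivatives -/

/-- The Leibniz rule for the evaluation, in all the arguments. -/
def lieDer (D : R → R) (eA eB : G → G) (eX : X → X) (c : Co R G X) : Co R G X :=
  fun w v u α β x =>
    D (c w v u α β x) - (∑ k, c w v u (Function.update α k (eA (α k))) β x)
      - (∑ j, c w v u α (Function.update β j (eB (β j))) x)
      - ∑ i, c w v u α β (Function.update x i (eX (x i)))

section LieDer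

variable (D : R → R) (eA eB : G → G) (eX : X → X)

theorem iA_lieDer (c : Co R G X) (a : G) :
    iA a (lieDer D eA eB eX c) = lieDer D eA eB eX (iA a c) - iA (eA a) c := by
  ext w v u α β x
  simp only [iA_app, lieDer, sub_app, Fin.sum_univ_succ, Fin.cons_zero, Fin.cons_succ,
    Fin.update_cons_zero, Fin.cons_update]
  ring

theorem iB_lieDer (c : Co R G X) (a : G) :
    iB a (lieDer D eA eB eX c) = lieDer D eA eB eX (iB a c) - iB (eB a) c := by
  ext w v u α β x
  simp only [iB_app, lieDer, sub_app, Fin.sum_univ_succ, Fin.cons_zero, Fin.cons_succ,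
    Fin.update_cons_zero, Fin.cons_update]
  ring

variable {D} (hadd : ∀ f g, D (f + g) = D f + D g)
include hadd

theorem map_neg_one_pow (n : ℕ) (f : R) : D ((-1) ^ n * f) = (-1) ^ n * D f := by
  have h0 : D 0 = 0 := by simpa using hadd 0 0
  have hn : D (-f) = -D f := by
    have := hadd f (-f)
    rw [add_neg_cancel, h0] at this
    exact (neg_eq_of_add_eq_zero_right this.symm).symm
  rcases neg_one_pow_eq_or R n with e | e <;> simp [e, hn]

theorem kX_lieDer (c : Co R G X) (a : X) :
    kX a (lieDer D eA eB eX c) = lieDer D eA eB eX (kX a c) - kX (eX a) c := by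
  ext w v u α β x
  simp only [kX_app, lieDer, sub_app, Fin.sum_univ_succ, Fin.cons_zero, Fin.cons_succ,
    Fin.update_cons_zero, Fin.cons_update, map_neg_one_pow hadd, ← Finset.mul_sum]
  ring

theorem lieDer_tw (c : Co R G X) : lieDer D eA eB eX (tw c) = tw (lieDer D eA eB eX c) := by
  ext w v u α β x
  simp only [tw_app, lieDer, map_neg_one_pow hadd, ← Finset.mul_sum]
  ring

/-- The commutator with a contraction along `a` is, up to sign, the contraction along the image of
`a`, which is itself a derivation. Hence `eA`, `eB`, `eX` may be arbitrary maps; that `D` is a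
derivation is used only for the value without arguments and to commute with signs and sums. -/
theorem lieDer_evenOp (hmul : ∀ f g, D (f * g) = D f * g + f * D g) :
    EvenOp (lieDer D eA eB eX) where
  add c d := by
    ext w v u α β x
    simp only [lieDer, add_app, hadd, Finset.sum_add_distrib]
    ring
  tw := lieDer_tw eA eB eX hadd
  mul c d _ _ := by
    have hl : ∀ c d, lieDer D eA eB eX (c + d) = lieDer D eA eB eX c + lieDer D eA eB eX d := by
      intro c d
      ext w v u α β x
      simp only [lieDer, add_app, hadd, Finset.sum_add_distrib]
      ring
    have htw := lieDer_tw (X := X) (G := G) eA eB eX hadd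
    refine eq_of_contractions (fun p : Co R G X × Co R G X => lieDer D eA eB eX (p.1 * p.2))
      (fun p => lieDer D eA eB eX p.1 * p.2 + p.1 * lieDer D eA eB eX p.2) ?_ ?_ ?_ ?_ (c, d)
    · intro i
      simp only [add_app, mul_app_zero]
      simp [lieDer, hmul]
    · intro n ih i a
      have e := ((ih (iA a i.1, i.2)).add (ih (tw i.1, iA a i.2))).sub
        (.of_eq (iA_mul (eA a) i.1 i.2))
      refine (Agree.of_eq ?_).trans (e.trans (.of_eq ?_))
      · simp only [iA_lieDer, iA_mul, hl]
      · simp only [iA_add, iA_lieDer, iA_mul, htw]; noncomm_ring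
    · intro n ih i a
      have e := ((ih (iB a i.1, i.2)).add (ih (i.1, iB a i.2))).sub
        (.of_eq (iB_mul (eB a) i.1 i.2))
      refine (Agree.of_eq ?_).trans (e.trans (.of_eq ?_))
      · simp only [iB_lieDer, iB_mul, hl]
      · simp only [iB_add, iB_lieDer, iB_mul]; noncomm_ring
    · intro n ih i a
      have e := ((ih (kX a i.1, i.2)).add (ih (tw i.1, kX a i.2))).sub
        (.of_eq (kX_mul (eX a) i.1 i.2))
      refine (Agree.of_eq ?_).trans (e.trans (.of_eq ?_))
      · simp only [kX_lieDer eA eB eX hadd, kX_mul, hl]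
      · simp only [kX_add, kX_lieDer eA eB eX hadd, kX_mul, htw]; noncomm_ring

end LieDer

/-! ### Sums over the symmetric arguments -/

/-- `∑ⱼ (U βⱼ c)(…,β̂ⱼ,…)`. -/
def sumB (U : G → Co R G X → Co R G X) (c : Co R G X) : Co R G X
  | w, v + 1, u, α, β, x => ∑ j : Fin (v + 1), U (β j) c w v u α (j.removeNth β) x
  | _, 0, _, _, _, _ => 0

theorem sumB_vanB (U : G → Co R G X → Co R G X) (c : Co R G X) : VanB (sumB U c) :=
  fun _ _ _ _ _ => rfl

theorem sumB_add {U : G → Co R G X → Co R G X} (hU : ∀ a c d, U a (c + d) = U a c + U a d)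
    (c d : Co R G X) : sumB U (c + d) = sumB U c + sumB U d := by
  ext w v u α β x
  cases v <;> simp [sumB, hU, Finset.sum_add_distrib]

theorem sumB_hasWt {U : G → Co R G X → Co R G X} {i j k l : ℕ}
    (hU : ∀ a, HasWt (U a) i j (k + 1) (l + 1)) : HasWt (sumB U) i j k l := fun s c => by
  ext w v u α β x
  cases v with
  | zero => simp [sumB, wt_app]
  | succ v =>
    simp only [sumB, hU _ s c, wt_app, Finset.mul_sum]
    refine Finset.sum_congr rfl fun b _ => ?_
    congr 3 <;> ring

theorem iB_sumB {U : G → Co R G X → Co R G X} (hc : ∀ a b c, iB a (U b c) = U b (iB a c))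
    (a : G) (c : Co R G X) : iB a (sumB U c) = U a c + sumB U (iB a c) := by
  ext w v u α β x
  rw [iB_app, add_app]
  cases v with
  | zero => simp [sumB]
  | succ v =>
    simp only [sumB]
    rw [Fin.sum_univ_succ]
    simp only [Fin.cons_zero, removeNth_zero_cons, Fin.cons_succ, removeNth_succ_cons, ← hc,
      iB_app]

/-- The commutator with `iB a` is the odd derivation `U a`; this covers the terms `-ρ^*` and `Id^*`.
-/
theorem sumB_oddOp {U : G → Co R G X → Co R G X} (hU : ∀ a, OddOp (U a))
    (hw : ∃ i j k l, Odd (i + j + k + l) ∧ ∀ a, HasWt (U a) i j (k + 1) (l + 1))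
    (hc : ∀ a b c, iB a (U b c) = U b (iB a c)) : OddOp (sumB U) := by
  have hadd := sumB_add fun a => (hU a).add
  refine oddOp_of_iB U (sumB_vanB U) hadd (fun c => ?_) hU fun a c => iB_sumB hc a c
  obtain ⟨i, j, k, l, he, hw⟩ := hw
  rw [(sumB_hasWt hw).tw_comm hadd, he.neg_one_pow]
  simp

end Co

/-- The vector fields act by derivations on functions. -/
structure IsDerivationAction {R G X : Type*} [CommRing R] (O : Operations R G X) : Prop where
  act_add : ∀ x f g, O.act x (f + g) = O.act x f + O.act x g
  act_mul : ∀ x f g, O.act x (f * g) = O.act x f * g + f * O.act x g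

namespace Co

variable {R G X : Type*} [CommRing R]

/-! ## The differentials as sums of derivations -/

theorem altSum_eval {P N : Type*} [AddCommGroup N] (e : N →+ R) (g : P → ∀ n, (Fin n → P) → N)
    (n : ℕ) (x : Fin n → P) : e (altSum g n x) = altSum (fun a k y => e (g a k y)) n x :=
  (altSum_apply_congr (fun _ => e) g n x).symm

theorem altSum₂_eval {P N : Type*} [AddCommGroup N] (e : N →+ R)
    (g : P → P → ∀ n, (Fin n → P) → N)
    (n : ℕ) (x : Fin n → P) : e (altSum₂ g n x) = altSum₂ (fun a b k y => e (g a b k y)) n x :=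
  (altSum₂_apply_congr (fun _ => e) g n x).symm

theorem map_int_mul {D : R → R} (hadd : ∀ f g, D (f + g) = D f + D g) (n : ℤ) (f : R) :
    D ((n : R) * f) = n * D f := by
  simpa [zsmul_eq_mul] using map_zsmul (AddMonoidHom.mk' D hadd) n f

variable [AddCommGroup G] [AddCommGroup X] (O : Operations R G X) (nabla : X → G → G)

/-- The part of the Lie derivative which does not involve the arguments of the first kind. -/
def basOp (b : G) (c : Co R G X) : Co R G X := fun w v u α β x =>
  basForm O nabla b (fun v u β x => c w v u α β x) v u β x

/-- The part of the Lie derivative which does not involve the arguments of the third kind. -/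
def nablaOp (y : X) (c : Co R G X) : Co R G X := fun w v u α β x =>
  nablaDual O nabla y (fun w v α β => c w v u α β x) w v α β

/-- The Koszul part of the horizontal differential. -/
def horK (c : Co R G X) : Co R G X := fun w v u α β x =>
  koszul O.lieG (basForm O nabla) (fun n α' v' u' β' x' => c n v' u' α' β' x') w α v u β x

/-- The Koszul part of the vertical differential. -/
def verK (c : Co R G X) : Co R G X := fun w v u α β x =>
  (-1) ^ w * koszul O.lieX (nablaDual O nabla) (fun n x' w' v' α' β' => c w' v' n α' β' x') u x
    w v α β

/-- The contraction with the basic curvature. -/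
def basCurvOp : Co R G X → Co R G X :=
  altX fun y c => -altA₂ (fun a b => iB (basCurv O nabla a b y)) c

/-- The contraction with the curvature. -/
def curvOp : Co R G X → Co R G X :=
  altA fun a c => -altX₂ (fun y z => iB (curv O nabla y z a)) c

/-- The horizontal differential, on the ring of cochains. -/
def dH (c : Co R G X) : Co R G X := dHorConn O nabla c

/-- The vertical differential, on the ring of cochains. -/
def dV (c : Co R G X) : Co R G X := dVerConn O nabla c

/-- The contraction with the anchor. -/
def anchorOp (O : Operations R G X) (c : Co R G X) : Co R G X :=
  -sumB (fun b => kX (O.anchor b)) c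

theorem horK_eq (c : Co R G X) :
    horK O nabla c = altA (basOp O nabla) c + altA₂ (fun a b => iA (O.lieG a b)) c := by
  ext w v u α β x
  let e : PolyForm R G X →+ R := ⟨⟨fun P => P v u β x, rfl⟩, fun _ _ => rfl⟩
  rw [horK, koszul_eq]
  have h1 := altSum_eval e
    (fun b n α' => basForm O nabla b (fun v' u' β' x' => c n v' u' α' β' x')) w α
  have h2 := altSum₂_eval e
    (fun b d n α' v' u' β' x' => c (n + 1) v' u' (Fin.cons (O.lieG b d) α') β' x') w α
  exact congrArg₂ (· + ·) h1 h2

theorem verK_eq (c : Co R G X) :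
    verK O nabla c = altX (nablaOp O nabla) c + altX₂ (fun a b => kX (O.lieX a b)) c := by
  ext w v u α β x
  let e : DualTensor R G →+ R := ⟨⟨fun P => P w v α β, rfl⟩, fun _ _ => rfl⟩
  rw [verK, koszul_eq, add_app]
  refine (mul_add _ (e _) (e _)).trans (congrArg₂ (· + ·) ?_ ?_)
  · exact congrArg _ (altSum_eval e
      (fun b n x' => nablaDual O nabla b (fun w' v' α' β' => c w' v' n α' β' x')) u x)
  · have h2 := altSum₂_eval e
      (fun b d n x' w' v' α' β' => c w' v' (n + 1) α' β' (Fin.cons (O.lieX b d) x')) u x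
    exact (congrArg _ h2).trans (altSum₂_mul ((-1 : R) ^ w) _ u x).symm

/-- Nesting a sum over form arguments around a sum over pairs of sections exhibits the curvature
term as built from the derivations `iB`, so its Leibniz rule comes from the general lemmas. -/
theorem basCurvOp_app (c : Co R G X) (w v u : ℕ) (α : Fin w → G) (β : Fin v → G) (x : Fin u → X) :
    basCurvOp O nabla c w v u α β x = basCurvTerm O nabla c w v u α β x := by
  rw [basCurvOp, altX]
  match w, u, α, x with
  | 0, 0, α, x => simp [altSum, basCurvTerm]
  | 0, u + 1, α, x => simp [altSum, altA₂, altSum₂, basCurvTerm]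
  | 1, 0, α, x => simp [altSum, basCurvTerm]
  | 1, u + 1, α, x => simp [altSum, altA₂, altSum₂, basCurvTerm]
  | w + 2, 0, α, x => simp [altSum, basCurvTerm]
  | w + 2, u + 1, α, x =>
    simp only [altSum, altA₂, altSum₂, basCurvTerm, neg_app, zsmul_eq_mul, Finset.mul_sum,
      ← Finset.sum_neg_distrib]
    rw [Finset.sum_comm]
    refine Finset.sum_congr rfl fun j _ => ?_
    rw [Finset.sum_comm]
    refine Finset.sum_congr rfl fun i _ => Finset.sum_congr rfl fun a _ => ?_
    split_ifs
    · rw [iB_app]; push_cast; ring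
    · simp

theorem curvOp_app (c : Co R G X) (w v u : ℕ) (α : Fin w → G) (β : Fin v → G) (x : Fin u → X) :
    curvOp O nabla c w v u α β x = curvTerm O nabla c w v u α β x := by
  rw [curvOp, altA]
  match w, u, α, x with
  | 0, 0, α, x => simp [altSum, curvTerm]
  | 0, 1, α, x => simp [altSum, curvTerm]
  | w + 1, 0, α, x => simp [altSum, altX₂, altSum₂, curvTerm]
  | w + 1, 1, α, x => simp [altSum, altX₂, altSum₂, curvTerm]
  | 0, u + 2, α, x => simp [altSum, curvTerm]
  | w + 1, u + 2, α, x =>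
    simp only [altSum, altX₂, altSum₂, curvTerm, neg_app, zsmul_eq_mul, Finset.mul_sum,
      ← Finset.sum_neg_distrib]
    refine Finset.sum_congr rfl fun k _ => Finset.sum_congr rfl fun b _ =>
      Finset.sum_congr rfl fun a _ => ?_
    split_ifs
    · rw [iB_app]; push_cast; ring
    · simp

theorem dH_eq (c : Co R G X) :
    dH O nabla c = horK O nabla c + anchorOp O c + basCurvOp O nabla c := by
  ext w v u α β x
  rw [add_app, add_app, basCurvOp_app]
  change horK O nabla c w v u α β x - (-1) ^ w * anchorTerm O c w v u α β x + _ = _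
  rw [sub_eq_add_neg]
  congr 2
  rw [anchorOp, neg_app]
  congr 1
  cases v with
  | zero => simp [anchorTerm, sumB]
  | succ v => simp only [anchorTerm, sumB, Finset.mul_sum]; rfl

theorem dV_eq (c : Co R G X) :
    dV O nabla c = verK O nabla c + sumB iA c + curvOp O nabla c := by
  ext w v u α β x
  rw [add_app, add_app, curvOp_app]
  change verK O nabla c w v u α β x + shiftTerm c w v u α β x + _ = _
  congr 2

/-- The Lie derivative along a section, for the connections induced by `nabla`. -/
def lieA (a : G) : Co R G X → Co R G X :=
  lieDer (O.act (O.anchor a)) (O.lieG a) (basG O nabla a) (basX O nabla a)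

/-- The covariant derivative along a vector field. -/
def lieX (y : X) : Co R G X → Co R G X :=
  lieDer (O.act y) (nabla y) (nabla y) (O.lieX y)

/-- `basForm` acts only on the symmetric and form arguments; the bracket terms of the Koszul formula
supply the action on the exterior arguments, completing the Lie derivative. -/
theorem iA_horK {c : Co R G X} (hc : Anti c) (a : G) :
    iA a (horK O nabla c) = lieA O nabla a c - horK O nabla (iA a c) := by
  have h : IsAnti (N := PolyForm R G X) (fun n α v u β x => c n v u α β x) := by
    intro n i b α
    funext v u β x
    exact hc.A v u β x n i b α
  ext w v u α β x
  have := congrFun (congrFun (contr_koszul O.lieG (basForm O nabla) h a) w) α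
  have := congrFun (congrFun (congrFun (congrFun this v) u) β) x
  refine this.trans ?_
  simp only [Pi.sub_apply, Finset.sum_apply]
  rw [sub_app]
  refine congrArg (· - _) ?_
  simp only [basForm, leibnizForm, lieA, lieDer]
  ring

theorem kX_verK {c : Co R G X} (hc : Anti c) (hact : ∀ f g y, O.act y (f + g) = O.act y f + O.act y g)
    (y : X) : kX y (verK O nabla c) = lieX O nabla y c - verK O nabla (kX y c) := by
  have h : IsAnti (N := DualTensor R G) (fun n x w v α β => c w v n α β x) := by
    intro n i b x
    funext w v α β
    exact hc.X w v α β n i b x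
  ext w v u α β x
  have := congrFun (congrFun (contr_koszul O.lieX (nablaDual O nabla) h y) u) x
  have := congrFun (congrFun (congrFun (congrFun this w) v) α) β
  simp only [Pi.sub_apply, Finset.sum_apply] at this
  rw [kX_app, sub_app]
  have e2 : verK O nabla (kX y c) w v u α β x = koszul O.lieX (nablaDual O nabla)
      (contr y fun n x w v α β => c w v n α β x) u x w v α β := by
    -- The operator `verK` preserves the exterior degree, so a sign depending only on that degree,
    -- such as the one in `kX`, can be taken out.
    have key : ∀ s : ℕ → R, (∀ m, s m = 1 ∨ s m = -1) → ∀ c d : Co R G X,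
        (∀ w v u α β x, d w v u α β x = s w * c w v u α β x) →
        verK O nabla d w v u α β x = s w * verK O nabla c w v u α β x := by
      intro s hs c d hd
      have h1 : ∀ m y f, O.act y (s m * f) = s m * O.act y f := by
        intro m y f
        have := map_neg_one_pow (D := O.act y) (fun f g => hact f g y) 1 f
        rcases hs m with e | e <;> rw [e]
        · simp
        · simpa using this
      rw [verK_eq, verK_eq, add_app, add_app, mul_add]
      congr 1
      · simp only [altX, nablaOp, nablaDual, hd, h1, ← Finset.mul_sum, ← mul_sub, altSum_mul]
        ring
      · simp only [altX₂, kX_app, hd, altSum₂_mul, mul_left_comm _ (s w)]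
    have := key (fun m => (-1) ^ m) (fun m => neg_one_pow_eq_or R m)
      (fun w v u α β x => c w v (u + 1) α β (Fin.cons y x)) (kX y c) fun _ _ _ _ _ _ => rfl
    refine this.trans ?_
    change (-1 : R) ^ w * ((-1) ^ w * _) = _
    rw [← mul_assoc, neg_one_pow_mul_self, one_mul]
    rfl
  rw [e2]
  change (-1 : R) ^ w * ((-1) ^ w * _) = _
  rw [← mul_assoc, neg_one_pow_mul_self, one_mul]
  refine this.trans ?_
  rfl

variable (hO : IsDerivationAction O)
include hO

theorem basOp_add (b : G) (c d : Co R G X) :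
    basOp O nabla b (c + d) = basOp O nabla b c + basOp O nabla b d := by
  ext w v u α β x
  simp only [basOp, basForm, leibnizForm, add_app, hO.act_add, Finset.sum_add_distrib]
  ring

theorem nablaOp_add (b : X) (c d : Co R G X) :
    nablaOp O nabla b (c + d) = nablaOp O nabla b c + nablaOp O nabla b d := by
  ext w v u α β x
  simp only [nablaOp, nablaDual, add_app, hO.act_add, Finset.sum_add_distrib]
  ring

theorem basOp_hasWt (b : G) : HasWt (basOp (X := X) O nabla b) 0 0 0 0 := fun s c => by
  ext w v u α β x
  simp only [basOp, basForm, leibnizForm, wt_app, map_int_mul (hO.act_add _), ← Finset.mul_sum]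
  ring

theorem nablaOp_hasWt (b : X) : HasWt (nablaOp O nabla b) 0 0 0 0 := fun s c => by
  ext w v u α β x
  simp only [nablaOp, nablaDual, wt_app, map_int_mul (hO.act_add _), ← Finset.mul_sum]
  ring

theorem horK_add (c d : Co R G X) : horK O nabla (c + d) = horK O nabla c + horK O nabla d := by
  simp only [horK_eq, altA_add (basOp_add O nabla hO), altA₂_add fun a b c d => iA_add c d (O.lieG a b)]
  abel

theorem verK_add (c d : Co R G X) : verK O nabla (c + d) = verK O nabla c + verK O nabla d := by
  simp only [verK_eq, altX_add (nablaOp_add O nabla hO),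
    altX₂_add fun a b c d => kX_add c d (O.lieX a b)]
  abel

theorem horK_hasWt : HasWt (horK O nabla) 1 0 0 0 := by
  have h := (altA_hasWt (k := 0) fun a => (basOp_hasWt O nabla hO a).shift 1 0).add_op
    (altA₂_hasWt (k := 0) fun a b => (iA_hasWt (O.lieG a b)).shift 1 0)
  rw [show horK O nabla = _ from funext (horK_eq O nabla)]
  exact h

theorem verK_hasWt : HasWt (verK O nabla) 0 1 0 0 := by
  have h := (altX_hasWt (l := 0) fun a => (nablaOp_hasWt O nabla hO a).shift 0 1).add_op
    (altX₂_hasWt (l := 0) fun a b => (kX_hasWt (O.lieX a b)).shift 0 1)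
  rw [show verK O nabla = _ from funext (verK_eq O nabla)]
  exact h

theorem horK_oddOp : OddOp (horK O nabla) := by
  refine oddOp_of_iA (lieA O nabla) (fun c v u α β x => rfl) (horK_add O nabla hO) (fun c => ?_)
    (fun a => lieDer_evenOp _ _ _ (hO.act_add _) (hO.act_mul _)) fun a c hc => iA_horK O nabla hc a
  rw [(horK_hasWt O nabla hO).tw_comm (horK_add O nabla hO)]
  simp

theorem verK_oddOp : OddOp (verK O nabla) := by
  refine oddOp_of_kX (lieX O nabla) (fun c w v α β x => ?_) (verK_add O nabla hO) (fun c => ?_)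
    (fun a => lieDer_evenOp _ _ _ (hO.act_add _) (hO.act_mul _))
    fun a c hc => kX_verK O nabla hc (fun f g y => hO.act_add y f g) a
  · simp [verK, koszul]
  · rw [(verK_hasWt O nabla hO).tw_comm (verK_add O nabla hO)]
    simp

omit hO

theorem anchorOp_hasWt : HasWt (anchorOp O) 1 0 0 0 :=
  (sumB_hasWt fun b => (kX_hasWt (O.anchor b)).shift 1 0).neg

theorem shiftOp_hasWt : HasWt (sumB (R := R) (X := X) (G := G) iA) 0 1 0 0 :=
  sumB_hasWt fun b => (iA_hasWt b).shift 0 1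

theorem anchorOp_oddOp : OddOp (anchorOp O) :=
  (sumB_oddOp (fun b => kX_oddOp (O.anchor b))
    ⟨1, 0, 0, 0, by decide, fun b => (kX_hasWt (O.anchor b)).shift 1 0⟩ fun _ _ _ => rfl).neg

theorem shiftOp_oddOp : OddOp (sumB (R := R) (X := X) (G := G) iA) :=
  sumB_oddOp (fun b => iA_oddOp b)
    ⟨0, 1, 0, 0, by decide, fun b => (iA_hasWt b).shift 0 1⟩ fun _ _ _ => rfl

theorem basCurvOp_hasWt : HasWt (basCurvOp O nabla) 1 0 0 0 :=
  altX_hasWt fun y => (altA₂_hasWt (k := 0) fun a b =>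
    (iB_hasWt (basCurv O nabla a b y)).shift 1 0).neg

theorem curvOp_hasWt : HasWt (curvOp O nabla) 0 1 0 0 :=
  altA_hasWt fun a => (altX₂_hasWt (l := 0) fun y z =>
    (iB_hasWt (curv O nabla y z a)).shift 0 1).neg

theorem basCurvOp_oddOp : OddOp (basCurvOp O nabla) := by
  refine altX_oddOp (fun y => (altA₂_evenOp (fun a b => iB_evenOp _) ⟨1, 0, 0, 1, by decide,
    fun a b => (iB_hasWt (basCurv O nabla a b y)).shift 1 0⟩ fun _ _ _ _ => rfl).neg)
    ⟨1, 0, 0, 0, by decide, fun y => (altA₂_hasWt (k := 0) fun a b =>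
    (iB_hasWt (basCurv O nabla a b y)).shift 1 0).neg⟩ fun y z c => ?_
  rw [kX_neg]
  congr 1
  ext w v u α β x
  rw [kX_app]
  -- The inner sum removes two exterior arguments, so the sign `(-1) ^ w` of `kX` is the same inside
  -- and outside.
  refine (altSum₂_apply_congr (fun n => AddMonoidHom.mulLeft ((-1 : R) ^ n)) (fun a b n α' =>
    iB (basCurv O nabla a b z) c n v (u + 1) α' β (Fin.cons y x)) w α).symm.trans ?_
  change _ = altSum₂ _ w α
  congr 1
  funext a b n α'
  simp [kX_app, iB_app, pow_succ]

theorem curvOp_oddOp : OddOp (curvOp O nabla) := by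
  refine altA_oddOp (fun a => (altX₂_evenOp (fun y z => iB_evenOp _) ⟨0, 1, 1, 0, by decide,
    fun y z => (iB_hasWt (curv O nabla y z a)).shift 0 1⟩ fun _ _ _ _ => rfl).neg)
    ⟨0, 1, 0, 0, by decide, fun a => (altX₂_hasWt (l := 0) fun y z =>
    (iB_hasWt (curv O nabla y z a)).shift 0 1).neg⟩ fun _ _ _ => rfl

include hO

theorem dH_oddOp : OddOp (dH O nabla) := by
  rw [show dH O nabla = _ from funext (dH_eq O nabla)]
  exact ((horK_oddOp O nabla hO).add_op (anchorOp_oddOp O)).add_op (basCurvOp_oddOp O nabla)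

theorem dV_oddOp : OddOp (dV O nabla) := by
  rw [show dV O nabla = _ from funext (dV_eq O nabla)]
  exact ((verK_oddOp O nabla hO).add_op shiftOp_oddOp).add_op (curvOp_oddOp O nabla)

theorem dH_hasWt : HasWt (dH O nabla) 1 0 0 0 := by
  rw [show dH O nabla = _ from funext (dH_eq O nabla)]
  exact ((horK_hasWt O nabla hO).add_op (anchorOp_hasWt O)).add_op (basCurvOp_hasWt O nabla)

theorem dV_hasWt : HasWt (dV O nabla) 0 1 0 0 := by
  rw [show dV O nabla = _ from funext (dV_eq O nabla)]
  exact ((verK_hasWt O nabla hO).add_op shiftOp_hasWt).add_op (curvOp_hasWt O nabla)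

end Co

namespace Co

/-! ## Multilinear cochains and the two models -/

section Models

variable {R G X : Type*} [CommRing R] [Algebra ℝ R] [AddCommGroup G] [Module R G]
  [AddCommGroup X] [Module R X]

/-- (Anti)symmetric cochains which are real multilinear in the first kind of arguments and
`R`-multilinear in the others. -/
structure Multi (c : Co R G X) : Prop where
  anti : Anti c
  A_add : ∀ a b, iA (a + b) c = iA a c + iA b c
  A_smul : ∀ (r : ℝ) a, iA (algebraMap ℝ R r • a) c = algebraMap ℝ R r • iA a c
  B_add : ∀ a b, iB (a + b) c = iB a c + iB b c
  B_smul : ∀ (f : R) a, iB (f • a) c = f • iB a c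
  X_add : ∀ a b, kX (a + b) c = kX a c + kX b c
  X_smul : ∀ (f : R) a, kX (f • a) c = f • kX a c

namespace Multi

variable {c d : Co R G X}

theorem add (hc : Multi c) (hd : Multi d) : Multi (c + d) where
  anti := hc.anti.add hd.anti
  A_add a b := by simp only [iA_add, hc.A_add, hd.A_add]; abel
  A_smul r a := by simp only [iA_add, hc.A_smul, hd.A_smul, smul_add]
  B_add a b := by simp only [iB_add, hc.B_add, hd.B_add]; abel
  B_smul r a := by simp only [iB_add, hc.B_smul, hd.B_smul, smul_add]
  X_add a b := by simp only [kX_add, hc.X_add, hd.X_add]; abel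
  X_smul r a := by simp only [kX_add, hc.X_smul, hd.X_smul, smul_add]

theorem smul (hc : Multi c) (f : R) : Multi (f • c) where
  anti := hc.anti.smul f
  A_add a b := by simp only [iA_smul, hc.A_add, smul_add]
  A_smul r a := by simp only [iA_smul, hc.A_smul]; rw [smul_comm]
  B_add a b := by simp only [iB_smul, hc.B_add, smul_add]
  B_smul r a := by simp only [iB_smul, hc.B_smul]; rw [smul_comm]
  X_add a b := by simp only [kX_smul, hc.X_add, smul_add]
  X_smul r a := by simp only [kX_smul, hc.X_smul]; rw [smul_comm]

theorem zero : Multi (0 : Co R G X) where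
  anti := .zero
  A_add a b := by simp
  A_smul r a := by simp
  B_add a b := by simp
  B_smul r a := by simp
  X_add a b := by simp
  X_smul r a := by simp

theorem tw (hc : Multi c) : Multi (tw c) where
  anti := hc.anti.tw
  A_add a b := by simp only [iA_tw, hc.A_add, tw_add]; abel
  A_smul r a := by simp only [iA_tw, hc.A_smul, tw_smul, smul_neg]
  B_add a b := by simp only [iB_tw, hc.B_add, tw_add]
  B_smul r a := by simp only [iB_tw, hc.B_smul, tw_smul]
  X_add a b := by simp only [kX_tw, hc.X_add, tw_add]; abel
  X_smul r a := by simp only [kX_tw, hc.X_smul, tw_smul, smul_neg]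

theorem iA (hc : Multi c) (e : G) : Multi (iA e c) where
  anti := hc.anti.iA e
  A_add a b := by simp only [hc.anti.iA_iA _ e, hc.A_add, iA_add]; abel
  A_smul r a := by simp only [hc.anti.iA_iA _ e, hc.A_smul, iA_smul, smul_neg]
  B_add a b := by simp only [← iA_iB, hc.B_add, iA_add]
  B_smul r a := by simp only [← iA_iB, hc.B_smul, iA_smul]
  X_add a b := by
    have h : ∀ y, Co.kX y (Co.iA e c) = -Co.iA e (Co.kX y c) := fun y => by rw [iA_kX, neg_neg]
    simp only [h, hc.X_add, iA_add]; abel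
  X_smul r a := by
    have h : ∀ y, Co.kX y (Co.iA e c) = -Co.iA e (Co.kX y c) := fun y => by rw [iA_kX, neg_neg]
    simp only [h, hc.X_smul, iA_smul, smul_neg]

theorem iB (hc : Multi c) (e : G) : Multi (iB e c) where
  anti := hc.anti.iB e
  A_add a b := by simp only [iA_iB, hc.A_add, iB_add]
  A_smul r a := by simp only [iA_iB, hc.A_smul, iB_smul]
  B_add a b := by simp only [hc.anti.iB_iB _ e, hc.B_add, iB_add]
  B_smul r a := by simp only [hc.anti.iB_iB _ e, hc.B_smul, iB_smul]
  X_add a b := by simp only [← iB_kX, hc.X_add, iB_add]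
  X_smul r a := by simp only [← iB_kX, hc.X_smul, iB_smul]

theorem kX (hc : Multi c) (e : X) : Multi (kX e c) where
  anti := hc.anti.kX e
  A_add a b := by simp only [iA_kX, hc.A_add, kX_add]; abel
  A_smul r a := by simp only [iA_kX, hc.A_smul, kX_smul, smul_neg]
  B_add a b := by simp only [iB_kX, hc.B_add, kX_add]
  B_smul r a := by simp only [iB_kX, hc.B_smul, kX_smul]
  X_add a b := by simp only [hc.anti.kX_kX _ e, hc.X_add, kX_add]; abel
  X_smul r a := by simp only [hc.anti.kX_kX _ e, hc.X_smul, kX_smul, smul_neg]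

theorem cst (f : R) : Multi (cst f : Co R G X) where
  anti := .cst f
  A_add a b := by simp
  A_smul r a := by simp
  B_add a b := by simp
  B_smul r a := by simp
  X_add a b := by simp
  X_smul r a := by simp

theorem mul (hc : Multi c) (hd : Multi d) : Multi (c * d) where
  anti := hc.anti.mul hd.anti
  A_add a b := by simp only [iA_mul, hc.A_add, hd.A_add]; noncomm_ring
  A_smul r a := by
    simp only [iA_mul, hc.A_smul, hd.A_smul, smul_mul_assoc, mul_smul_comm, smul_add]
  B_add a b := by simp only [iB_mul, hc.B_add, hd.B_add]; noncomm_ring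
  B_smul r a := by
    simp only [iB_mul, hc.B_smul, hd.B_smul, smul_mul_assoc, mul_smul_comm, smul_add]
  X_add a b := by simp only [kX_mul, hc.X_add, hd.X_add]; noncomm_ring
  X_smul r a := by
    simp only [kX_mul, hc.X_smul, hd.X_smul, smul_mul_assoc, mul_smul_comm, smul_add]

end Multi

/-- The one-form `df`. -/
def dfun (O : Operations R G X) (f : R) : Co R G X
  | 0, 0, 1, _, _, x => O.act (x 0) f
  | _, _, _, _, _, _ => 0

variable (O : Operations R G X)

@[simp] theorem iA_dfun (f : R) (a : G) : iA a (dfun O f) = 0 := rfl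
@[simp] theorem iB_dfun (f : R) (a : G) : iB a (dfun O f) = 0 := by
  ext w v u α β x; cases w <;> rfl
@[simp] theorem kX_dfun (f : R) (y : X) : kX y (dfun O f) = cst (O.act y f) := by
  ext w v u α β x
  match w, v, u, α, β, x with
  | 0, 0, 0, _, _, _ => simp [kX_app, dfun, cst]
  | 0, 0, u + 1, _, _, _ => simp [kX_app, dfun, cst]
  | 0, v + 1, 0, _, _, _ => simp [kX_app, dfun, cst]
  | 0, v + 1, u + 1, _, _, _ => simp [kX_app, dfun, cst]
  | w + 1, v, 0, _, _, _ => simp [kX_app, dfun, cst]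
  | w + 1, v, u + 1, _, _, _ => simp [kX_app, dfun, cst]

theorem dfun_vanX (f : R) : VanX (dfun O f) := fun w v α β x => by
  match w, v, α, β with
  | 0, 0, _, _ => rfl
  | 0, v + 1, _, _ => rfl
  | w + 1, 0, _, _ => rfl
  | w + 1, v + 1, _, _ => rfl

@[simp] theorem tw_dfun (f : R) : tw (dfun O f) = -dfun O f := by
  refine eq_of_contr ?_ ?_ ?_ ?_
  · simp [tw_app, (dfun_vanX O f) 0 0 _ _ _]
  · intro a; simp [iA_tw]
  · intro a; simp [iB_tw]
  · intro a; simp [kX_tw]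

/-- Graded commutativity with the odd element `df`, for cochains that need not be homogeneous. It
moves `df` to the front in the Leibniz relation for a product. -/
theorem tw_mul_dfun (c : Co R G X) (f : R) : tw c * dfun O f = dfun O f * c := by
  refine eq_of_contractions (fun c => tw c * dfun O f) (fun c => dfun O f * c) ?_ ?_ ?_ ?_ c
  · intro c; simp [(dfun_vanX O f) 0 0 _ _ _]
  · intro n ih c a
    simpa [iA_mul, iA_tw] using (ih (iA a c)).neg
  · intro n ih c a
    simpa [iB_mul, iB_tw] using ih (iB a c)
  · intro n ih c a
    have := (Agree.refl n (O.act a f • c)).add (ih (kX a c)).neg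
    refine (Agree.of_eq ?_).trans (this.trans (.of_eq ?_))
    · simp only [kX_mul, kX_tw, tw_tw, kX_dfun, mul_cst]; noncomm_ring
    · simp only [kX_mul, kX_dfun, cst_mul, tw_dfun]; noncomm_ring

theorem dfun_multi (h1 : ∀ x y f, O.act (x + y) f = O.act x f + O.act y f)
    (h2 : ∀ (g : R) x f, O.act (g • x) f = g * O.act x f) (f : R) : Multi (dfun O f) where
  anti := by
    refine Anti.of_closed (S := {c | c = dfun O f ∨ ∃ g, c = cst g}) ?_ ?_ ?_ ?_ ?_ ?_ _ (.inl rfl)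
    · rintro _ (rfl | ⟨g, rfl⟩) a
      · exact .inr ⟨0, by ext w v u α β x; cases w <;> cases v <;> cases u <;> rfl⟩
      · exact .inr ⟨0, by ext w v u α β x; cases w <;> cases v <;> cases u <;> rfl⟩
    · rintro _ (rfl | ⟨g, rfl⟩) a
      · exact .inr ⟨0, by rw [iB_dfun]; ext w v u α β x; cases w <;> cases v <;> cases u <;> rfl⟩
      · exact .inr ⟨0, by rw [iB_cst]; ext w v u α β x; cases w <;> cases v <;> cases u <;> rfl⟩
    · rintro _ (rfl | ⟨g, rfl⟩) a
      · exact .inr ⟨_, kX_dfun O f a⟩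
      · exact .inr ⟨0, by rw [kX_cst]; ext w v u α β x; cases w <;> cases v <;> cases u <;> rfl⟩
    all_goals rintro _ (rfl | ⟨g, rfl⟩) a b <;> simp
  A_add a b := by simp
  A_smul r a := by simp
  B_add a b := by simp
  B_smul r a := by simp
  X_add a b := by
    simp only [kX_dfun, h1]
    ext w v u α β x; cases w <;> cases v <;> cases u <;> simp [cst]
  X_smul r a := by
    simp only [kX_dfun, h2]
    ext w v u α β x; cases w <;> cases v <;> cases u <;> simp [cst]

/-- The cochains of the intrinsic model. -/
structure Wint (c : Co R G X) : Prop where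
  multi : Multi c
  leib : ∀ (f : R) a, iA (f • a) c = f • iA a c - dfun O f * iB a c

/-- The cochains of the connection dependent model. -/
structure Wten (c : Co R G X) : Prop where
  multi : Multi c
  lin : ∀ (f : R) a, iA (f • a) c = f • iA a c

variable {O}

namespace Wint

variable {c d : Co R G X}

theorem add (hc : Wint O c) (hd : Wint O d) : Wint O (c + d) :=
  ⟨hc.multi.add hd.multi, fun f a => by
    simp only [iA_add, iB_add, hc.leib, hd.leib, smul_add]; noncomm_ring⟩

theorem smul (hc : Wint O c) (g : R) : Wint O (g • c) :=
  ⟨hc.multi.smul g, fun f a => by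
    simp only [iA_smul, iB_smul, hc.leib, smul_sub, mul_smul_comm]
    rw [smul_comm]⟩

theorem zero : Wint O (0 : Co R G X) := ⟨.zero, fun f a => by simp⟩

theorem neg (hc : Wint O c) : Wint O (-c) := by simpa using hc.smul (-1)

theorem sub (hc : Wint O c) (hd : Wint O d) : Wint O (c - d) := by
  rw [sub_eq_add_neg]; exact hc.add hd.neg

theorem tw (hc : Wint O c) : Wint O (tw c) :=
  ⟨hc.multi.tw, fun f a => by
    simp only [iA_tw, iB_tw, hc.leib, tw_sub, tw_mul, tw_smul, tw_dfun, smul_neg]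
    noncomm_ring⟩

/-- The intrinsic model is stable under `iA` and `iB`. It is not stable under `kX` in general:
contracting `dfun O f * iB a c` with `y` leaves a term `O.act y f • iB a c`. -/
theorem iA (hc : Wint O c) (e : G) : Wint O (iA e c) :=
  ⟨hc.multi.iA e, fun f a => by
    rw [hc.multi.anti.iA_iA _ e, hc.leib, iA_sub, iA_smul, iA_mul, iA_dfun, tw_dfun,
      hc.multi.anti.iA_iA a e, iA_iB, smul_neg]
    noncomm_ring⟩

theorem iB (hc : Wint O c) (e : G) : Wint O (iB e c) :=
  ⟨hc.multi.iB e, fun f a => by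
    rw [iA_iB, hc.leib, iB_sub, iB_smul, iB_mul, iB_dfun, hc.multi.anti.iB_iB a e, iA_iB]
    noncomm_ring⟩

theorem cst (f : R) : Wint O (cst f : Co R G X) := ⟨.cst f, fun f a => by simp⟩

theorem mul (hc : Wint O c) (hd : Wint O d) : Wint O (c * d) :=
  ⟨hc.multi.mul hd.multi, fun f a => by
    have := congrArg (· * Co.iB a d) (tw_mul_dfun O c f)
    simp only [mul_assoc] at this
    simp only [iA_mul, iB_mul, hc.leib, hd.leib, sub_mul, mul_sub, smul_mul_assoc, mul_smul_comm,
      this, mul_add, smul_add, mul_assoc]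
    abel⟩

end Wint

namespace Wten

variable {c d : Co R G X}

theorem add (hc : Wten c) (hd : Wten d) : Wten (c + d) :=
  ⟨hc.multi.add hd.multi, fun f a => by simp only [iA_add, hc.lin, hd.lin, smul_add]⟩

theorem zero : Wten (0 : Co R G X) := ⟨.zero, fun f a => by simp⟩

theorem cst (f : R) : Wten (cst f : Co R G X) := ⟨.cst f, fun f a => by simp⟩

theorem mul (hc : Wten c) (hd : Wten d) : Wten (c * d) :=
  ⟨hc.multi.mul hd.multi, fun f a => by
    simp only [iA_mul, hc.lin, hd.lin, smul_mul_assoc, mul_smul_comm, smul_add]⟩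

end Wten

end Models

/-! ## The isomorphism determined by a connection -/

section Phi

variable {R G X : Type*} [CommRing R]

/-- `(-1)^w ∑ᵢ (-1)^i c(α | ∇_{xᵢ} a, β | …,x̂ᵢ,…)`. -/
def gam (nabla : X → G → G) (a : G) : Co R G X → Co R G X := altX fun y => iB (nabla y a)

variable (nabla : X → G → G) (a b : G) (y : X) {c d : Co R G X}

theorem kX_gam (c : Co R G X) :
    kX y (gam nabla a c) = iB (nabla y a) c - gam nabla a (kX y c) :=
  kX_altX_of_comm (fun _ _ _ => rfl) y c

theorem iA_gam (c : Co R G X) : iA b (gam nabla a c) = -gam nabla a (iA b c) := by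
  ext w v u α β x
  rw [neg_app]
  change (-1 : R) ^ (w + 1) * altSum _ u x = -((-1 : R) ^ w * altSum _ u x)
  rw [pow_succ]
  simp only [mul_neg, mul_one, neg_mul]
  rfl

theorem gam_add (c d : Co R G X) : gam nabla a (c + d) = gam nabla a c + gam nabla a d :=
  altX_add (fun _ _ _ => rfl) c d

theorem gam_smul (f : R) (c : Co R G X) : gam nabla a (f • c) = f • gam nabla a c := by
  ext w v u α β x
  simp only [gam, altX, iB_app, smul_app, altSum_mul]
  ring

theorem gam_neg (c : Co R G X) : gam nabla a (-c) = -gam nabla a c := by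
  simpa using gam_smul nabla a (-1) c

theorem gam_sub (c d : Co R G X) : gam nabla a (c - d) = gam nabla a c - gam nabla a d := by
  rw [sub_eq_add_neg, gam_add, gam_neg, sub_eq_add_neg]

theorem gam_hasWt : HasWt (gam (R := R) nabla a) 0 0 1 0 :=
  altX_hasWt fun y => iB_hasWt (nabla y a)

theorem gam_oddOp : OddOp (gam (R := R) nabla a) :=
  altX_oddOp (fun _ => iB_evenOp _) ⟨0, 0, 1, 0, by decide, fun _ => iB_hasWt _⟩ fun _ _ _ => rfl

theorem iB_gam (hc : Anti c) : iB b (gam nabla a c) = gam nabla a (iB b c) := by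
  ext w v u α β x
  change (-1 : R) ^ w * altSum (fun y n x' => iB b (iB (nabla y a) c) w v n α β x') u x =
    (-1 : R) ^ w * altSum (fun y n x' => iB (nabla y a) (iB b c) w v n α β x') u x
  simp only [hc.iB_iB b]

theorem gam_vanX (c : Co R G X) : VanX (gam nabla a c) := altX_vanX _ _

/-- Each `gam` consumes one form argument and contributes one symmetric argument, so two of them
anticommute. The recursion in `kX` reduces this to commutation with `iB`. -/
theorem gam_gam (hc : Anti c) : gam nabla a (gam nabla b c) = -gam nabla b (gam nabla a c) := by
  refine eq_of_kX (ι := {c : Co R G X // Anti c}) (fun c => gam nabla a (gam nabla b c.1))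
    (fun c => -gam nabla b (gam nabla a c.1)) ?_ ?_ ⟨c, hc⟩
  · intro c w v α β x
    rw [neg_app, gam_vanX _ _ _ w v, gam_vanX _ _ _ w v, neg_zero]
  · rintro n ih ⟨c, hc⟩ y w v α β x
    have e := ih ⟨kX y c, hc.kX y⟩ w v α β x
    simp only at e ⊢
    simp only [kX_neg, kX_gam, iB_gam nabla _ _ hc, gam_sub, neg_app, sub_app] at e ⊢
    rw [e]; ring

/-- Contracting `gam nabla a c` with `y` produces an extra term `iB (nabla y a) c`, so the set
stable under contractions consists of sums of an image of `gam` and a symmetric remainder. -/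
theorem Anti.gam (hc : Anti c) : Anti (Co.gam nabla a c) := by
  have h0 : Co.gam nabla a c = Co.gam nabla a c + 0 := (add_zero _).symm
  refine Anti.of_closed (S := {e : Co R G X | ∃ c d, Anti c ∧ Anti d ∧ e = Co.gam nabla a c + d})
    ?_ ?_ ?_ ?_ ?_ ?_ _ ⟨c, 0, hc, .zero, h0⟩
  · rintro _ ⟨c, d, hc, hd, rfl⟩ b
    exact ⟨-Co.iA b c, Co.iA b d, (hc.iA b).neg, hd.iA b, by rw [iA_add, iA_gam, gam_neg]⟩
  · rintro _ ⟨c, d, hc, hd, rfl⟩ b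
    exact ⟨Co.iB b c, Co.iB b d, hc.iB b, hd.iB b, by rw [iB_add, iB_gam nabla a b hc]⟩
  · rintro _ ⟨c, d, hc, hd, rfl⟩ y
    exact ⟨-Co.kX y c, Co.iB (nabla y a) c + Co.kX y d, (hc.kX y).neg,
      (hc.iB _).add (hd.kX y), by rw [kX_add, kX_gam, gam_neg]; abel⟩
  · rintro _ ⟨c, d, hc, hd, rfl⟩ b b'
    simp only [iA_add, iA_gam, iA_neg, hc.iA_iA b b', hd.iA_iA b b', gam_neg]
    abel
  · rintro _ ⟨c, d, hc, hd, rfl⟩ b b'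
    simp only [iB_add, iB_gam nabla a _ hc, iB_gam nabla a _ (hc.iB _), hc.iB_iB b b',
      hd.iB_iB b b']
  · rintro _ ⟨c, d, hc, hd, rfl⟩ y z
    simp only [kX_add, kX_gam, kX_sub, hc.kX_kX y z, hd.kX_kX y z, gam_neg, iB_kX]
    abel

variable (s : R)

/-- The contraction with a section, corrected by a connection. -/
def corr (a : G) (c : Co R G X) : Co R G X := iA a c + s • gam nabla a c

/-- The evaluation of the iterated corrected contractions. -/
def phiAux : ∀ w : ℕ, Co R G X → ∀ v u : ℕ, (Fin w → G) → (Fin v → G) → (Fin u → X) → R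
  | 0, c => c 0
  | w + 1, c => fun v u α β x => phiAux w (corr nabla s (α 0) c) v u (Fin.tail α) β x

/-- The transformation of cochains obtained by replacing contractions with sections by the
contractions which are corrected by a connection. -/
def phi (c : Co R G X) : Co R G X := fun w => phiAux nabla s w c

theorem phi_zero_app (c : Co R G X) (v u α β x) : phi nabla s c 0 v u α β x = c 0 v u α β x := rfl

theorem iA_phi (c : Co R G X) : iA a (phi nabla s c) = phi nabla s (corr nabla s a c) := rfl

theorem corr_add (c d : Co R G X) :
    corr nabla s a (c + d) = corr nabla s a c + corr nabla s a d := by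
  simp only [corr, iA_add, gam_add, smul_add]; abel

theorem corr_smul (f : R) (c : Co R G X) :
    corr nabla s a (f • c) = f • corr nabla s a c := by
  simp only [corr, iA_smul, gam_smul, smul_add]; rw [smul_comm s f]

theorem corr_tw (c : Co R G X) : corr nabla s a (tw c) = -tw (corr nabla s a c) := by
  simp only [corr, iA_tw, (gam_oddOp nabla a).tw, tw_add, tw_smul, smul_neg]; abel

theorem corr_oddOp : OddOp (corr nabla s a) where
  add := corr_add nabla a s
  tw := corr_tw nabla a s
  mul c d hc hd := by
    simp only [corr, iA_mul, (gam_oddOp nabla a).mul c d hc hd, smul_add, add_mul, mul_add,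
      smul_mul_assoc, mul_smul_comm]
    abel

theorem corr_hasWt : HasWt (corr nabla s a) 0 0 1 0 := fun t c => by
  simp only [corr]
  rw [iA_hasWt a t c, gam_hasWt nabla a t c]
  ext; simp only [wt_app, add_app, smul_app]; ring

theorem Anti.corr (hc : Anti c) : Anti (corr nabla s a c) :=
  (hc.iA a).add ((hc.gam nabla a).smul s)

/-- Any two of the operators `iA` and `gam` involved anticommute, so the corrected contractions can
play the role of contractions with exterior arguments. -/
theorem corr_corr (hc : Anti c) :
    corr nabla s a (corr nabla s b c) = -corr nabla s b (corr nabla s a c) := by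
  simp only [corr, iA_add, gam_add, iA_smul, gam_smul, iA_gam, hc.iA_iA a b,
    gam_gam nabla a b hc, smul_add, smul_neg]
  abel

theorem iB_corr (hc : Anti c) : iB b (corr nabla s a c) = corr nabla s a (iB b c) := by
  simp only [corr, iB_add, iB_smul, iB_gam nabla a b hc, iA_iB]

theorem gam_corr (hc : Anti c) : gam nabla b (corr nabla s a c) = -corr nabla s a (gam nabla b c) := by
  simp only [corr, iA_gam, gam_add, gam_smul, gam_gam nabla b a hc, smul_neg]
  abel

theorem phi_add (c d : Co R G X) : phi nabla s (c + d) = phi nabla s c + phi nabla s d := by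
  refine eq_of_iA (fun p : Co R G X × Co R G X => phi nabla s (p.1 + p.2))
    (fun p => phi nabla s p.1 + phi nabla s p.2) (fun _ _ _ _ _ _ => rfl) ?_ (c, d)
  intro n ih p a v u α β x
  simp only [iA_phi, iA_add, corr_add]
  exact ih (corr nabla s a p.1, corr nabla s a p.2) v u α β x

theorem phi_smul (f : R) (c : Co R G X) : phi nabla s (f • c) = f • phi nabla s c := by
  refine eq_of_iA (fun c : Co R G X => phi nabla s (f • c))
    (fun c => f • phi nabla s c) (fun _ _ _ _ _ _ => rfl) ?_ c
  intro n ih p a v u α β x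
  simp only [iA_phi, iA_smul, corr_smul]
  exact ih (corr nabla s a p) v u α β x

theorem phi_neg (c : Co R G X) : phi nabla s (-c) = -phi nabla s c := by
  simpa using phi_smul nabla s (-1) c

theorem phi_sub (c d : Co R G X) : phi nabla s (c - d) = phi nabla s c - phi nabla s d := by
  rw [sub_eq_add_neg, phi_add, phi_neg, sub_eq_add_neg]

theorem phi_wt (t : ℕ → ℕ → ℤ) (c : Co R G X) : phi nabla s (wt t c) = wt t (phi nabla s c) := by
  refine eq_of_iA (fun p : Co R G X × (ℕ → ℕ → ℤ) => phi nabla s (wt p.2 p.1))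
    (fun p => wt p.2 (phi nabla s p.1)) (fun _ _ _ _ _ _ => rfl) ?_ (c, t)
  intro n ih p a v u α β x
  have h1 := corr_hasWt nabla a s p.2 p.1
  have h2 := iA_hasWt a p.2 (phi nabla s p.1)
  simp only [add_zero] at h1 h2
  simp only [iA_phi] at h2 ⊢
  rw [h1, h2]
  exact ih (corr nabla s a p.1, _) v u α β x

theorem phi_tw (c : Co R G X) : phi nabla s (tw c) = tw (phi nabla s c) := by
  rw [tw_eq_wt, phi_wt, tw_eq_wt]

/-- Corrected contractions are odd derivations just as `iA` is, so the two sides satisfy the same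
recursion; without exterior arguments `phi` changes nothing. -/
theorem phi_mul (hc : Anti c) (hd : Anti d) :
    phi nabla s (c * d) = phi nabla s c * phi nabla s d := by
  refine eq_of_iA (ι := AntiPair R G X) (fun p => phi nabla s (p.1.1 * p.1.2))
    (fun p => phi nabla s p.1.1 * phi nabla s p.1.2) ?_ ?_ ⟨(c, d), hc, hd⟩
  · rintro ⟨⟨c, d⟩, hc, hd⟩ v u α β x
    dsimp only
    have h : ∀ c : Co R G X, VanA (c - phi nabla s c) := fun c v u α β x => by
      rw [sub_app, phi_zero_app, sub_self]
    -- The difference telescopes into products with a factor having no component of exterior degree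
    -- zero.
    have e : c * d - phi nabla s c * phi nabla s d =
        (c - phi nabla s c) * d + phi nabla s c * (d - phi nabla s d) := by noncomm_ring
    have := congrArg (fun c : Co R G X => c 0 v u α β x) e
    simp only [sub_app, add_app, ((h c).mul_right d) v u α β x,
      ((h d).mul_left (phi nabla s c)) v u α β x, add_zero] at this
    rw [phi_zero_app]
    exact sub_eq_zero.1 this
  · rintro n ih ⟨⟨c, d⟩, hc, hd⟩ a v u α β x
    have e1 := ih ⟨(corr nabla s a c, d), hc.corr nabla a s, hd⟩ v u α β x
    have e2 := ih ⟨(tw c, corr nabla s a d), hc.tw, hd.corr nabla a s⟩ v u α β x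
    dsimp only at e1 e2 ⊢
    rw [iA_phi, (corr_oddOp nabla a s).mul c d hc hd, phi_add, add_app, e1, e2, iA_mul, iA_phi,
      iA_phi, phi_tw]
    rfl

theorem iB_phi (hc : Anti c) : iB b (phi nabla s c) = phi nabla s (iB b c) := by
  refine eq_of_iA (ι := {c : Co R G X // Anti c}) (fun c => iB b (phi nabla s c.1))
    (fun c => phi nabla s (iB b c.1)) (fun _ _ _ _ _ _ => rfl) ?_ ⟨c, hc⟩
  rintro n ih ⟨c, hc⟩ a v u α β x
  have e := ih ⟨_, hc.corr nabla a s⟩ v u α β x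
  dsimp only at e ⊢
  rw [iA_iB, iA_phi, e, iA_phi, iB_corr nabla a b s hc]

theorem gam_phi (hc : Anti c) : gam nabla b (phi nabla s c) = phi nabla s (gam nabla b c) := by
  refine eq_of_iA (ι := {c : Co R G X // Anti c}) (fun c => gam nabla b (phi nabla s c.1))
    (fun c => phi nabla s (gam nabla b c.1)) (fun _ _ _ _ _ _ => rfl) ?_ ⟨c, hc⟩
  rintro n ih ⟨c, hc⟩ a v u α β x
  have e := ih ⟨_, hc.corr nabla a s⟩ v u α β x
  dsimp only at e ⊢
  rw [iA_gam, iA_phi, neg_app, e, iA_phi, gam_corr nabla a b s hc, phi_neg, neg_app, neg_neg]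

/-- As `gam` commutes with `phi`, the two corrections add up under the outer contraction: `corr
(-s)` applied to `phi s c` is `phi s` of `iA + s • gam - s • gam`, which is `iA`. -/
theorem phi_phi (hc : Anti c) : phi nabla (-s) (phi nabla s c) = c := by
  refine eq_of_iA (ι := {c : Co R G X // Anti c}) (fun c => phi nabla (-s) (phi nabla s c.1))
    (fun c => c.1) (fun _ _ _ _ _ _ => rfl) ?_ ⟨c, hc⟩
  rintro n ih ⟨c, hc⟩ a v u α β x
  have e := ih ⟨_, hc.iA a⟩ v u α β x
  dsimp only at e ⊢
  rw [iA_phi, corr, iA_phi, gam_phi nabla a s hc, ← phi_smul, ← phi_add, corr]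
  rw [show iA a c + s • gam nabla a c + -s • gam nabla a c = iA a c by
    rw [neg_smul, add_neg_cancel_right], e]

theorem Anti.phi (hc : Anti c) : Anti (phi nabla s c) where
  A v u β x := by
    refine isAnti_of_closed
      (S := {η | ∃ c : Co R G X, Anti c ∧ η = fun n α => Co.phi nabla s c n v u α β x}) ?_ ?_ _
      ⟨c, hc, rfl⟩
    -- Contraction of the transformed cochain is the transform of a corrected contraction, again of
    -- a symmetric cochain.
    · rintro _ ⟨c, hc, rfl⟩ a
      exact ⟨_, hc.corr nabla a s, rfl⟩
    · rintro _ ⟨c, hc, rfl⟩ a b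
      funext w α
      change Co.phi nabla s (Co.corr nabla s a (Co.corr nabla s b c)) w v u α β x =
        -Co.phi nabla s (Co.corr nabla s b (Co.corr nabla s a c)) w v u α β x
      rw [corr_corr nabla a b s hc, phi_neg, neg_app]
  B w := by
    induction w generalizing c with
    | zero => exact hc.B 0
    | succ w ih => exact fun v u α i b β x => ih (hc.corr nabla (α 0) s) v u (Fin.tail α) i b β x
  X w := by
    induction w generalizing c with
    | zero => exact hc.X 0
    | succ w ih => exact fun v α β => ih (hc.corr nabla (α 0) s) v (Fin.tail α) β

end Phi

/-! ### The correction exchanges the intrinsic relation and linearity over functions -/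

section PhiModels

/-- A connection, in terms of modules of sections. -/
structure IsConn {R G X : Type*} [CommRing R] [AddCommGroup G] [Module R G]
    [AddCommGroup X] [Module R X] (O : Operations R G X) (nabla : X → G → G) : Prop where
  add_left : ∀ x y a, nabla (x + y) a = nabla x a + nabla y a
  smul_left : ∀ (f : R) x a, nabla (f • x) a = f • nabla x a
  add_right : ∀ x a b, nabla x (a + b) = nabla x a + nabla x b
  leibniz : ∀ x (f : R) a, nabla x (f • a) = f • nabla x a + O.act x f • a

variable {R G X : Type*} [CommRing R] [Algebra ℝ R] [AddCommGroup G] [Module R G]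
  [AddCommGroup X] [Module R X] {O : Operations R G X} {nabla : X → G → G} {c : Co R G X}

theorem gam_add_left (hn : IsConn O nabla) (hc : Multi c) (a b : G) :
    gam nabla (a + b) c = gam nabla a c + gam nabla b c := by
  refine eq_of_kX (ι := {c : Co R G X // Multi c}) (fun c => gam nabla (a + b) c.1)
    (fun c => gam nabla a c.1 + gam nabla b c.1) ?_ ?_ ⟨c, hc⟩
  · intro c w v α β x
    rw [add_app, gam_vanX _ _ _ w v, gam_vanX _ _ _ w v, gam_vanX _ _ _ w v, add_zero]
  · rintro n ih ⟨c, hc⟩ y w v α β x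
    have e := ih ⟨kX y c, hc.kX y⟩ w v α β x
    simp only [kX_add, kX_gam, hn.add_right, hc.B_add, sub_app, add_app] at e ⊢
    rw [e]; ring

/-- The derivative term in the Leibniz rule of the connection inserts `df` into the form arguments:
exactly the opposite of the defect of an intrinsic cochain. -/
theorem gam_smul_left (hn : IsConn O nabla) (hc : Multi c) (f : R) (a : G) :
    gam nabla (f • a) c = f • gam nabla a c + dfun O f * iB a c := by
  refine eq_of_kX (ι := {c : Co R G X // Multi c}) (fun c => gam nabla (f • a) c.1)
    (fun c => f • gam nabla a c.1 + dfun O f * iB a c.1) ?_ ?_ ⟨c, hc⟩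
  · intro c w v α β x
    rw [add_app, smul_app, gam_vanX _ _ _ w v, gam_vanX _ _ _ w v,
      (dfun_vanX O f).mul_right _ w v, mul_zero, add_zero]
  · rintro n ih ⟨c, hc⟩ y w v α β x
    have e := ih ⟨kX y c, hc.kX y⟩ w v α β x
    dsimp only at e ⊢
    simp only [kX_add, kX_smul, kX_mul, kX_gam, hn.leibniz, hc.B_add, hc.B_smul, kX_dfun,
      cst_mul, tw_dfun, neg_mul, sub_app, add_app, neg_app, smul_app, ← iB_kX] at e ⊢
    rw [e]; ring

theorem Multi.gam (hn : IsConn O nabla) (hc : Multi c) (a : G) : Multi (gam nabla a c) where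
  anti := hc.anti.gam nabla a
  A_add b d := by simp only [iA_gam, hc.A_add, gam_add]; abel
  A_smul r b := by simp only [iA_gam, hc.A_smul, gam_smul, smul_neg]
  B_add b d := by simp only [iB_gam nabla _ _ hc.anti, hc.B_add, gam_add]
  B_smul r b := by simp only [iB_gam nabla _ _ hc.anti, hc.B_smul, gam_smul]
  X_add y z := by simp only [kX_gam, hn.add_left, hc.B_add, hc.X_add, gam_add]; abel
  X_smul r y := by simp only [kX_gam, hn.smul_left, hc.B_smul, hc.X_smul, gam_smul, smul_sub]

theorem Multi.corr (hn : IsConn O nabla) (s : R) (hc : Multi c) (a : G) :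
    Multi (corr nabla s a c) := (hc.iA a).add ((hc.gam hn a).smul s)

theorem dfun_algebraMap (h : ∀ x (r : ℝ), O.act x (algebraMap ℝ R r) = 0) (r : ℝ) :
    dfun O (algebraMap ℝ R r) = 0 := by
  ext w v u α β x
  unfold dfun
  split
  · rw [h]; rfl
  · rfl

theorem Multi.phi (hn : IsConn O nabla) (h : ∀ x (r : ℝ), O.act x (algebraMap ℝ R r) = 0) (s : R)
    (hc : Multi c) : Multi (phi nabla s c) where
  anti := hc.anti.phi nabla s
  A_add a b := by
    simp only [iA_phi, ← phi_add, Co.corr, hc.A_add, gam_add_left hn hc, smul_add]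
    congr 1; abel
  A_smul r a := by
    simp only [iA_phi, ← phi_smul, Co.corr, hc.A_smul, gam_smul_left hn hc, dfun_algebraMap h,
      zero_mul, add_zero, smul_add]
    rw [smul_comm s]
  B_add a b := by simp only [iB_phi nabla _ s hc.anti, hc.B_add, phi_add]
  B_smul r a := by simp only [iB_phi nabla _ s hc.anti, hc.B_smul, phi_smul]
  X_add y z := by
    refine eq_of_iA (ι := {c : Co R G X // Multi c}) (fun c => Co.kX (y + z) (Co.phi nabla s c.1))
      (fun c => Co.kX y (Co.phi nabla s c.1) + Co.kX z (Co.phi nabla s c.1)) ?_ ?_ ⟨c, hc⟩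
    · rintro ⟨c, hc⟩ v u α β x
      have := congrArg (fun c : Co R G X => c 0 v u α β x) (hc.X_add y z)
      simpa only [kX_app, phi_zero_app, add_app] using this
    · rintro n ih ⟨c, hc⟩ a v u α β x
      have e := ih ⟨_, hc.corr hn s a⟩ v u α β x
      dsimp only at e ⊢
      simp only [iA_add, iA_kX, iA_phi, neg_app, add_app] at e ⊢
      rw [e]; ring
  X_smul f y := by
    refine eq_of_iA (ι := {c : Co R G X // Multi c}) (fun c => Co.kX (f • y) (Co.phi nabla s c.1))
      (fun c => f • Co.kX y (Co.phi nabla s c.1)) ?_ ?_ ⟨c, hc⟩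
    · rintro ⟨c, hc⟩ v u α β x
      have := congrArg (fun c : Co R G X => c 0 v u α β x) (hc.X_smul f y)
      simpa only [kX_app, phi_zero_app, smul_app] using this
    · rintro n ih ⟨c, hc⟩ a v u α β x
      have e := ih ⟨_, hc.corr hn s a⟩ v u α β x
      dsimp only at e ⊢
      simp only [iA_smul, iA_kX, iA_phi, neg_app, smul_app] at e ⊢
      rw [e]; ring

/-- With coefficient `1` the defects of `iA` and of `gam` cancel. -/
theorem Wint.phi (hn : IsConn O nabla) (h : ∀ x (r : ℝ), O.act x (algebraMap ℝ R r) = 0)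
    (hc : Wint O c) : Wten (phi nabla 1 c) :=
  ⟨hc.multi.phi hn h 1, fun f a => by
    rw [iA_phi, iA_phi, ← phi_smul, corr, corr, hc.leib, gam_smul_left hn hc.multi]
    congr 1
    simp only [one_smul, smul_add]; abel⟩

theorem phi_dfun (s : R) (f : R) : phi nabla s (dfun O f) = dfun O f := by
  have h0 : ∀ a, corr nabla s a (dfun O f) = 0 := fun a => by
    have : gam nabla a (dfun O f) = 0 := by
      ext w v u α β x
      have h1 : altSum (fun (y : X) n x' => (0 : R)) u x = 0 := by
        simpa using altSum_mul (0 : R) (fun (y : X) n x' => (0 : R)) u x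
      simp [gam, altX, h1]
    simp [corr, this]
  refine eq_of_iA (fun _ : Unit => phi nabla s (dfun O f)) (fun _ => dfun O f)
    (fun _ _ _ _ _ _ => rfl) ?_ ()
  intro n _ _ a v u α β x
  rw [iA_phi, h0]
  have : phi nabla s (0 : Co R G X) = 0 := by simpa using phi_smul nabla s 0 (0 : Co R G X)
  rw [this]; rfl

/-- With coefficient `-1` the defect of `gam` alone creates the intrinsic relation; `phi` is
multiplicative and fixes `df`, so the relation survives the transformation. -/
theorem Wten.phi (hn : IsConn O nabla) (h : ∀ x (r : ℝ), O.act x (algebraMap ℝ R r) = 0)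
    (hd : ∀ f, Anti (dfun O f)) (hc : Wten c) : Wint O (phi nabla (-1) c) :=
  ⟨hc.multi.phi hn h (-1), fun f a => by
    have e : Co.corr nabla (-1) (f • a) c =
        f • Co.corr nabla (-1) a c - dfun O f * Co.iB a c := by
      rw [Co.corr, Co.corr, hc.lin, gam_smul_left hn hc.multi]
      simp only [neg_smul, one_smul, smul_add, smul_neg]; abel
    have e2 := phi_mul nabla (-1 : R) (hd f) (hc.multi.anti.iB a)
    rw [phi_dfun] at e2
    rw [iA_phi, iA_phi, e, phi_sub, phi_smul, e2, iB_phi nabla a (-1 : R) hc.multi.anti]⟩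

end PhiModels

end Co

namespace Co

/-! ## Supports -/

section Supp

variable {R G X : Type*} [CommRing R]

/-- Cochains of bidegree `(p, q)`. -/
def Supp (p q : ℕ) (c : Co R G X) : Prop :=
  ∀ w v u, ¬(w + v = p ∧ u + v = q) → ∀ α β x, c w v u α β x = 0

variable {p q p' q' : ℕ} {c d : Co R G X}

/-- The weight which vanishes in bidegree `(p, q)` only. -/
def offWt (p q i j : ℕ) : ℤ := if i = p ∧ j = q then 0 else 1

/-- Being homogeneous means being killed by a weight, so operators with a weight shift transport
supports without inspection of their formulas. -/
theorem supp_iff_wt : Supp p q c ↔ wt (offWt p q) c = 0 := by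
  constructor
  · intro h
    ext w v u α β x
    rw [wt_app]
    by_cases h' : w + v = p ∧ u + v = q
    · simp [offWt, h']
    · rw [h w v u h' α β x]; simp
  · intro h w v u h' α β x
    have := congrArg (fun c : Co R G X => c w v u α β x) h
    simpa [wt_app, offWt, h'] using this

theorem HasWt.supp {T : Co R G X → Co R G X} {i j : ℕ} (hT : HasWt T i j 0 0) (h0 : T 0 = 0)
    (hc : Supp p q c) : Supp (p + i) (q + j) (T c) := by
  rw [supp_iff_wt] at hc ⊢
  have := hT (offWt (p + i) (q + j)) c
  rw [show (fun p' q' => offWt (p + i) (q + j) (p' + i) (q' + j)) = offWt p q by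
    funext; simp [offWt], hc, h0] at this
  exact this.symm

theorem Supp.add (hc : Supp p q c) (hd : Supp p q d) : Supp p q (c + d) :=
  fun w v u h α β x => by rw [add_app, hc w v u h, hd w v u h, add_zero]

theorem Supp.smul (f : R) (hc : Supp p q c) : Supp p q (f • c) :=
  fun w v u h α β x => by rw [smul_app, hc w v u h, mul_zero]

theorem Supp.zero : Supp p q (0 : Co R G X) := fun _ _ _ _ _ _ _ => rfl

theorem Supp.cst (f : R) : Supp 0 0 (cst f : Co R G X) := fun w v u h α β x => by
  cases w <;> cases v <;> cases u <;> first | rfl | (exact absurd ⟨rfl, rfl⟩ h)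

theorem Supp.iA (hc : Supp (p + 1) q c) (a : G) : Supp p q (iA a c) := fun w v u h α β x =>
  hc _ _ _ (fun h' => h ⟨by omega, h'.2⟩) _ _ _

theorem Supp.iB (hc : Supp (p + 1) (q + 1) c) (a : G) : Supp p q (iB a c) :=
  fun w v u h α β x => hc _ _ _ (fun h' => h ⟨by omega, by omega⟩) _ _ _

theorem Supp.kX (hc : Supp p (q + 1) c) (y : X) : Supp p q (kX y c) := fun w v u h α β x => by
  rw [kX_app, hc _ _ _ (fun h' => h ⟨h'.1, by omega⟩), mul_zero]

theorem Supp.iA_eq_zero (hc : Supp 0 q c) (a : G) : Co.iA a c = 0 := by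
  ext w v u α β x
  exact hc _ _ _ (by omega) _ _ _

theorem Supp.iB_eq_zero (hc : Supp p q c) (h : p = 0 ∨ q = 0) (a : G) : Co.iB a c = 0 := by
  ext w v u α β x
  exact hc _ _ _ (by omega) _ _ _

theorem Supp.kX_eq_zero (hc : Supp p 0 c) (y : X) : Co.kX y c = 0 := by
  ext w v u α β x
  rw [kX_app, hc _ _ _ (by omega), mul_zero]; rfl

theorem Supp.mul (hc : Supp p q c) (hd : Supp p' q' d) : Supp (p + p') (q + q') (c * d) := by
  intro w v u h α β x
  rw [mul_app]
  refine Finset.sum_eq_zero fun S _ => Finset.sum_eq_zero fun T _ => Finset.sum_eq_zero fun U _ => ?_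
  by_cases h1 : S.card + T.card = p ∧ U.card + T.card = q
  · rw [hd _ _ _ (fun h2 => h ?_)]
    · simp
    · have hS := Finset.card_compl_add_card S
      have hT := Finset.card_compl_add_card T
      have hU := Finset.card_compl_add_card U
      simp only [Fintype.card_fin] at hS hT hU
      omega
  · rw [hc _ _ _ h1]; simp

theorem Supp.tw_eq (hc : Supp p q c) : Co.tw c = (-1 : R) ^ (p + q) • c := by
  ext w v u α β x
  rw [tw_app, smul_app]
  by_cases h : w + v = p ∧ u + v = q
  · rw [← h.1, ← h.2, show w + v + (u + v) = w + u + (v + v) by ring, pow_add _ (w + u),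
      Even.neg_one_pow (Even.add_self v), mul_one]
  · rw [hc w v u h]; simp

/-- Cochains of bidegree at most `(1, 1)` have no symmetry conditions. -/
theorem Supp.anti (hc : Supp p q c) (hp : p ≤ 1) (hq : q ≤ 1) : Anti c where
  A v u β x n i b α := by
    rcases n with _ | n
    · rw [show i = 0 from Fin.ext (by omega)]
      simp
    · simp only [hc (n + 1 + 1) v u (by omega)]; simp
  B w v u α i b β x := by
    rcases v with _ | n
    · rw [show i = 0 from Fin.ext (by omega)]
      simp
    · simp only [hc w (n + 1 + 1) u (by omega)]
  X w v α β n i b x := by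
    rcases n with _ | n
    · rw [show i = 0 from Fin.ext (by omega)]
      simp
    · simp only [hc w v (n + 1 + 1) (by omega)]; simp

theorem Supp.eq_zero (hc : Supp p q c)
    (h : ∀ w v u, w + v = p → u + v = q → ∀ α β x, c w v u α β x = 0) : c = 0 := by
  ext w v u α β x
  by_cases h' : w + v = p ∧ u + v = q
  · exact h w v u h'.1 h'.2 α β x
  · exact hc w v u h' α β x

theorem Supp.neg (hc : Supp p q c) : Supp p q (-c) := by simpa using hc.smul (-1)

theorem Supp.ext_of (hc : Supp p q c) (hd : Supp p q d)
    (h : ∀ w v u, w + v = p → u + v = q → ∀ α β x, c w v u α β x = d w v u α β x) : c = d := by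
  ext w v u α β x
  by_cases h' : w + v = p ∧ u + v = q
  · exact h w v u h'.1 h'.2 α β x
  · rw [hc w v u h', hd w v u h']

end Supp

end Co

/-! ### Lie algebroids over an abstract algebra of functions -/

/-- The identities satisfied by the operations of a Lie algebroid over a smooth manifold. -/
structure IsLieAlgebroid {R G X : Type*} [CommRing R] [Algebra ℝ R] [AddCommGroup G] [Module R G]
    [AddCommGroup X] [Module R X] (O : Operations R G X) : Prop extends IsDerivationAction O where
  act_add_left : ∀ x y f, O.act (x + y) f = O.act x f + O.act y f
  act_smul_left : ∀ (g : R) x f, O.act (g • x) f = g * O.act x f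
  act_algebraMap : ∀ x (r : ℝ), O.act x (algebraMap ℝ R r) = 0
  act_lieX : ∀ x y f, O.act (O.lieX x y) f = O.act x (O.act y f) - O.act y (O.act x f)
  anchor_add : ∀ a b, O.anchor (a + b) = O.anchor a + O.anchor b
  anchor_smul : ∀ (f : R) a, O.anchor (f • a) = f • O.anchor a
  lie_add_left : ∀ a b d, O.lieG (a + b) d = O.lieG a d + O.lieG b d
  lie_add_right : ∀ a b d, O.lieG a (b + d) = O.lieG a b + O.lieG a d
  lie_self : ∀ a, O.lieG a a = 0
  jacobi : ∀ a b d, O.lieG a (O.lieG b d) = O.lieG (O.lieG a b) d + O.lieG b (O.lieG a d)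
  lie_smul : ∀ a b (f : R), O.lieG a (f • b) = f • O.lieG a b + O.act (O.anchor a) f • b
  anchor_lie : ∀ a b, O.anchor (O.lieG a b) = O.lieX (O.anchor a) (O.anchor b)

namespace IsLieAlgebroid

variable {R G X : Type*} [CommRing R] [Algebra ℝ R] [AddCommGroup G] [Module R G]
    [AddCommGroup X] [Module R X] {O : Operations R G X} (h : IsLieAlgebroid O)
include h

theorem act_zero (x : X) : O.act x 0 = 0 := by simpa using h.act_add x 0 0

theorem act_neg (x : X) (f : R) : O.act x (-f) = -O.act x f := by
  have := h.act_add x f (-f)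
  rw [add_neg_cancel, h.act_zero] at this
  exact (neg_eq_of_add_eq_zero_right this.symm).symm

theorem act_sub (x : X) (f g : R) : O.act x (f - g) = O.act x f - O.act x g := by
  rw [sub_eq_add_neg, h.act_add, h.act_neg, sub_eq_add_neg]

theorem anchor_zero : O.anchor 0 = 0 := by simpa using h.anchor_add 0 0

theorem zero_lie (a : G) : O.lieG 0 a = 0 := by simpa using h.lie_add_left 0 0 a

theorem lie_zero (a : G) : O.lieG a 0 = 0 := by simpa using h.lie_add_right a 0 0

theorem lie_skew (a b : G) : O.lieG a b = -O.lieG b a := by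
  have := h.lie_self (a + b)
  rw [h.lie_add_left, h.lie_add_right, h.lie_add_right, h.lie_self, h.lie_self] at this
  rw [zero_add, add_zero] at this
  exact eq_neg_of_add_eq_zero_left this

theorem smul_lie (a b : G) (f : R) :
    O.lieG (f • a) b = f • O.lieG a b - O.act (O.anchor b) f • a := by
  rw [h.lie_skew, h.lie_smul, h.lie_skew b a, smul_neg]; abel

end IsLieAlgebroid

namespace Co

/-! ### The differentials on functions and on sections of the dual bundle -/

section Generators

variable {R G X : Type*} [CommRing R] [Algebra ℝ R] [AddCommGroup G] [Module R G]
    [AddCommGroup X] [Module R X] {O : Operations R G X}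

/-- The cochain determined by a form on the first kind of arguments. -/
def form (θ : G →ₗ[R] R) : Co R G X
  | 1, 0, 0, α, _, _ => θ (α 0)
  | _, _, _, _, _, _ => 0

theorem Supp.form (θ : G →ₗ[R] R) : Supp 1 0 (form θ : Co R G X) := fun w v u h α β x => by
  match w, v, u, h with
  | 0, _, _, _ => rfl
  | 1, 0, 0, h => exact absurd ⟨rfl, rfl⟩ h
  | 1, 0, u + 1, _ => rfl
  | 1, v + 1, _, _ => rfl
  | w + 2, _, _, _ => rfl

theorem Supp.dfun (O : Operations R G X) (f : R) : Supp 0 1 (dfun O f) := fun w v u h α β x => by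
  match w, v, u, h with
  | 0, 0, 0, _ => rfl
  | 0, 0, 1, h => exact absurd ⟨rfl, rfl⟩ h
  | 0, 0, u + 2, _ => rfl
  | 0, v + 1, _, _ => rfl
  | w + 1, _, _, _ => rfl

/-- Additive in both arguments; true for connections and for the zero map. -/
structure IsBiadditive (nabla : X → G → G) : Prop where
  add_left : ∀ x y a, nabla (x + y) a = nabla x a + nabla y a
  add_right : ∀ x a b, nabla x (a + b) = nabla x a + nabla x b

namespace IsBiadditive

variable {nabla : X → G → G} (hn : IsBiadditive nabla)
include hn

end IsBiadditive

variable (h : IsLieAlgebroid O) {nabla : X → G → G} (hn : IsBiadditive nabla)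
include h

theorem Supp.dV {p q : ℕ} {c : Co R G X} (hc : Supp p q c) : Supp p (q + 1) (dV O nabla c) :=
  (dV_hasWt O nabla h.toIsDerivationAction).supp
    (dV_oddOp O nabla h.toIsDerivationAction).zero hc

theorem Supp.dH {p q : ℕ} {c : Co R G X} (hc : Supp p q c) : Supp (p + 1) q (dH O nabla c) :=
  (dH_hasWt O nabla h.toIsDerivationAction).supp
    (dH_oddOp O nabla h.toIsDerivationAction).zero hc

theorem dV_cst (f : R) : dV O nabla (cst f) = dfun O f := by
  rw [← sub_eq_zero, sub_eq_add_neg, ← neg_one_smul R (dfun O f)]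
  refine (((Supp.cst f).dV h).add ((Supp.dfun O f).smul _)).eq_zero ?_
  intro w v u h1 h2 α β x
  obtain ⟨rfl, rfl, rfl⟩ : w = 0 ∧ v = 0 ∧ u = 1 := by omega
  rw [add_app]
  simp [dV, dVerConn, koszul, nablaDual, shiftTerm, curvTerm, cst, dfun]

/-- The form `α ↦ L_{ρ(α)} f`. -/
def anchorForm (f : R) : G →ₗ[R] R where
  toFun a := O.act (O.anchor a) f
  map_add' a b := by rw [h.anchor_add, h.act_add_left]
  map_smul' g a := by rw [h.anchor_smul, h.act_smul_left]; rfl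

theorem dH_cst (f : R) : dH O nabla (cst f) = form (anchorForm h f) := by
  rw [← sub_eq_zero, sub_eq_add_neg, ← neg_one_smul R (form _)]
  refine (((Supp.cst f).dH h).add ((Supp.form _).smul _)).eq_zero ?_
  intro w v u h1 h2 α β x
  obtain ⟨rfl, rfl, rfl⟩ : w = 1 ∧ v = 0 ∧ u = 0 := by omega
  rw [add_app]
  simp [dH, dHorConn, koszul, basForm, leibnizForm, anchorTerm, basCurvTerm, cst, form,
    anchorForm]

theorem dH_form_app (θ : G →ₗ[R] R) (α : Fin 2 → G) (β : Fin 0 → G) (x : Fin 0 → X) :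
    dH O nabla (form θ) 2 0 0 α β x =
      O.act (O.anchor (α 0)) (θ (α 1)) - O.act (O.anchor (α 1)) (θ (α 0))
        - θ (O.lieG (α 0) (α 1)) := by
  simp [dH, dHorConn, koszul, basForm, leibnizForm, anchorTerm, basCurvTerm, form,
    Fin.sum_univ_succ]
  rw [show Fin.removeNth 1 α 0 = α 0 from rfl, show Fin.tail α 0 = α 1 from rfl]
  ring

theorem dV_form_app_one (θ : G →ₗ[R] R) (α : Fin 1 → G) (β : Fin 0 → G) (x : Fin 1 → X) :
    dV O nabla (form θ) 1 0 1 α β x = θ (nabla (x 0) (α 0)) - O.act (x 0) (θ (α 0)) := by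
  simp [dV, dVerConn, koszul, nablaDual, shiftTerm, curvTerm, form]

theorem dV_form_app_zero (θ : G →ₗ[R] R) (α : Fin 0 → G) (β : Fin 1 → G) (x : Fin 0 → X) :
    dV O nabla (form θ) 0 1 0 α β x = θ (β 0) := by
  simp [dV, dVerConn, koszul, nablaDual, shiftTerm, curvTerm, form]

/-- The only component is the two-form `d(df)`, which vanishes because vector fields act compatibly
with brackets. -/
theorem dV_dV_cst (f : R) : dV O nabla (dV O nabla (cst f)) = 0 := by
  refine (((Supp.cst f).dV h).dV h).eq_zero ?_
  intro w v u h1 h2 α β x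
  obtain ⟨rfl, rfl, rfl⟩ : (w = 0 ∧ v = 0 ∧ u = 2) := by omega
  rw [dV_cst h]
  change dVerConn O nabla (dfun O f) 0 0 2 α β x = 0
  simp [dVerConn, koszul, nablaDual, shiftTerm, curvTerm, dfun, Fin.sum_univ_succ]
  rw [show Fin.removeNth 1 x 0 = x 0 from rfl, show Fin.tail x 0 = x 1 from rfl, h.act_lieX]
  ring

/-- In bidegree `(3, 0)` only exterior arguments occur, so `nabla` plays no role: this is the
classical computation for the Lie algebroid differential. -/
theorem dH_dH_form (θ : G →ₗ[R] R) : dH O nabla (dH O nabla (form θ)) = 0 := by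
  refine (((Supp.form θ).dH h).dH h).eq_zero ?_
  intro w v u h1 h2 α β x
  obtain ⟨rfl, rfl, rfl⟩ : (w = 3 ∧ v = 0 ∧ u = 0) := by omega
  change dHorConn O nabla (dH O nabla (form θ)) 3 0 0 α β x = 0
  simp only [dHorConn, koszul, anchorTerm, basCurvTerm, Fin.sum_univ_succ, Pi.add_apply, Finset.sum_apply, Pi.smul_apply, basForm, leibnizForm, dH_form_app h]
  simp [dH_form_app h, apply_ite (fun P : PolyForm R G X => P 0 0 β x)]
  rw [show Fin.tail α 0 = α 1 from rfl, show Fin.tail α 1 = α 2 from rfl,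
    show Fin.removeNth 1 α 0 = α 0 from rfl, show Fin.removeNth 1 α 1 = α 2 from rfl,
    show Fin.removeNth 2 α 0 = α 0 from rfl, show Fin.removeNth 2 α 1 = α 1 from rfl,
    show Fin.tail (Fin.removeNth 1 α) 0 = α 2 from rfl,
    show Fin.tail (Fin.removeNth 2 α) 0 = α 1 from rfl,
    show Fin.removeNth 1 (Fin.removeNth 2 α) 0 = α 0 from rfl]
  -- The terms with double brackets cancel by Jacobi; those with derivatives by `anchor_lie` and
  -- `act_lieX`.
  have hJ : θ (O.lieG (α 0) (O.lieG (α 1) (α 2))) = θ (O.lieG (O.lieG (α 0) (α 1)) (α 2)) +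
      θ (O.lieG (α 1) (O.lieG (α 0) (α 2))) := by rw [h.jacobi, map_add]
  rw [h.lie_skew (α 0), h.lie_skew (α 1) (O.lieG _ _), map_neg, map_neg] at hJ
  simp only [h.act_sub, h.anchor_lie, h.act_lieX]
  linear_combination -hJ

include hn
-- With two vector fields and one exterior argument, the square of the covariant derivative cancels
-- the curvature term. With one symmetric argument and one vector field, the shift and the covariant
-- derivative cancel in the two orders.
theorem dV_dV_form (θ : G →ₗ[R] R) : dV O nabla (dV O nabla (form θ)) = 0 := by
  refine (((Supp.form θ).dV h).dV h).eq_zero ?_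
  intro w v u h1 h2 α β x
  obtain ⟨rfl, rfl, rfl⟩ | ⟨rfl, rfl, rfl⟩ : (w = 1 ∧ v = 0 ∧ u = 2) ∨ (w = 0 ∧ v = 1 ∧ u = 1) := by
    omega
  · change dVerConn O nabla (dV O nabla (form θ)) 1 0 2 α β x = 0
    simp [dVerConn, koszul, nablaDual, shiftTerm, curvTerm, dV_form_app_one h,
      dV_form_app_zero h, Fin.sum_univ_succ]
    rw [show Fin.removeNth 1 x 0 = x 0 from rfl, show Fin.tail x 0 = x 1 from rfl, h.act_lieX, curv]
    simp only [map_sub, h.act_sub]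
    ring
  · simp [dV, dVerConn, koszul, nablaDual, shiftTerm, curvTerm, form]

/-- The component with a vector field is the compatibility of derivatives with `[ρ(α), x]`; the
terms `ρ(∇_x α)` coming from `basX` and from the dual connection cancel. In the symmetric component
the anchor term cancels the shift. -/
theorem dH_dV_cst (f : R) : dH O nabla (dV O nabla (cst f)) + dV O nabla (dH O nabla (cst f)) = 0 := by
  refine ((((Supp.cst f).dV h).dH h).add (((Supp.cst f).dH h).dV h)).eq_zero ?_
  intro w v u h1 h2 α β x
  obtain ⟨rfl, rfl, rfl⟩ | ⟨rfl, rfl, rfl⟩ : (w = 1 ∧ v = 0 ∧ u = 1) ∨ (w = 0 ∧ v = 1 ∧ u = 0) := by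
    omega
  · rw [add_app]
    simp [dH, dV, dVerConn, nablaDual, shiftTerm, curvTerm, dHorConn, koszul, basForm, leibnizForm, anchorTerm, basCurvTerm, cst, Fin.sum_univ_succ]
    rw [basX, h.act_add_left, h.act_lieX]
    ring
  · rw [add_app]
    simp [dH, dV, dVerConn, nablaDual, shiftTerm, curvTerm, dHorConn, koszul, basForm, leibnizForm, anchorTerm, basCurvTerm, cst, Fin.sum_univ_succ]

/-- The component with two exterior arguments vanishes because of the form of `basCurv`, the one
with a symmetric argument because of the form of `basG`. Neither uses a Leibniz rule for `nabla`, so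
the zero map is allowed. -/
theorem dH_dV_form (θ : G →ₗ[R] R) : dH O nabla (dV O nabla (form θ)) + dV O nabla (dH O nabla (form θ)) = 0 := by
  refine ((((Supp.form θ).dV h).dH h).add (((Supp.form θ).dH h).dV h)).eq_zero ?_
  intro w v u h1 h2 α β x
  obtain ⟨rfl, rfl, rfl⟩ | ⟨rfl, rfl, rfl⟩ : (w = 2 ∧ v = 0 ∧ u = 1) ∨ (w = 1 ∧ v = 1 ∧ u = 0) := by
    omega
  · rw [add_app]
    change dHorConn O nabla (dV O nabla (form θ)) 2 0 1 α β x +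
      dVerConn O nabla (dH O nabla (form θ)) 2 0 1 α β x = 0
    simp [dVerConn, nablaDual, shiftTerm, curvTerm, dHorConn, koszul, basForm, leibnizForm,
      anchorTerm, basCurvTerm, Fin.sum_univ_succ, dV_form_app_one h, dV_form_app_zero h,
      dH_form_app h]
    rw [show Fin.removeNth 1 α 0 = α 0 from rfl, show Fin.tail α 0 = α 1 from rfl]
    simp only [basCurv, basX, map_sub, map_add, h.act_sub, h.act_add, h.act_add_left, h.act_neg, h.act_lieX, hn.add_left]
    ring
  · rw [add_app]
    change dHorConn O nabla (dV O nabla (form θ)) 1 1 0 α β x + dVerConn O nabla (dH O nabla (form θ)) 1 1 0 α β x = 0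
    simp [dVerConn, nablaDual, shiftTerm, curvTerm, dHorConn, koszul, basForm, leibnizForm, anchorTerm, basCurvTerm, Fin.sum_univ_succ, dV_form_app_one h, dV_form_app_zero h, dH_form_app h, basG]
    rw [h.lie_skew (β 0) (α 0), map_neg]
    ring

end Generators

end Co

namespace Co

/-! ### The generators and their differentials belong to the intrinsic model -/

section GeneratorsWint

variable {R G X : Type*} [CommRing R] [Algebra ℝ R] [AddCommGroup G] [Module R G]
    [AddCommGroup X] [Module R X] {O : Operations R G X}

/-- A cochain which only depends on one argument of the first kind. -/
def evalForm (f : G → R) : Co R G X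
  | 1, 0, 0, α, _, _ => f (α 0)
  | _, _, _, _, _, _ => 0

theorem evalForm_add (f g : G → R) :
    (evalForm fun a => f a + g a) = (evalForm f + evalForm g : Co R G X) := by
  ext w v u α β x
  rw [add_app]
  unfold evalForm
  split <;> simp

theorem evalForm_smul (r : R) (f : G → R) :
    (evalForm fun a => r * f a) = (r • evalForm f : Co R G X) := by
  ext w v u α β x
  rw [smul_app]
  unfold evalForm
  split <;> simp

theorem evalForm_eq {c : Co R G X} (hc : Supp 1 0 c) (f : G → R)
    (h : ∀ α β x, c 1 0 0 α β x = f (α 0)) : c = evalForm f := by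
  ext w v u α β x
  match w, v, u, α, β, x with
  | 1, 0, 0, α, β, x => exact h α β x
  | 0, v, u, _, _, _ => exact hc _ _ _ (by omega) _ _ _
  | 1, v + 1, u, _, _, _ => exact hc _ _ _ (by omega) _ _ _
  | 1, 0, u + 1, _, _, _ => exact hc _ _ _ (by omega) _ _ _
  | w + 2, v, u, _, _, _ => exact hc _ _ _ (by omega) _ _ _

/-- Contractions of a cochain of bidegree `(2, 0)` with symmetric or form arguments vanish, as do
triple contractions with sections, so one relation suffices. -/
theorem Anti.of_supp_two {c : Co R G X} (hc : Supp 2 0 c)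
    (h : ∀ a b, Co.iA a (Co.iA b c) = -Co.iA b (Co.iA a c)) : Anti c := by
  refine Anti.of_closed (S := {c | (∀ a, Co.iB a c = 0) ∧ (∀ y, Co.kX y c = 0) ∧
    (∀ a b, Co.iA a (Co.iA b c) = -Co.iA b (Co.iA a c)) ∧
    ∀ a b d, Co.iA a (Co.iA b (Co.iA d c)) = 0}) ?_ ?_ ?_ ?_ ?_ ?_ c ?_
  · rintro c ⟨h1, h2, h3, h4⟩ a
    refine ⟨fun b => by rw [← iA_iB, h1, iA_zero], fun y => ?_, fun b d => by simp [h4],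
      fun b d e => by rw [h4, iA_zero]⟩
    rw [← neg_neg (Co.kX _ _), ← iA_kX, h2, iA_zero, neg_zero]
  · rintro c ⟨h1, h2, h3, h4⟩ a
    rw [h1]; simp
  · rintro c ⟨h1, h2, h3, h4⟩ a
    rw [h2]; simp
  · rintro c ⟨h1, h2, h3, h4⟩; exact h3
  · rintro c ⟨h1, h2, h3, h4⟩ a b; simp [h1]
  · rintro c ⟨h1, h2, h3, h4⟩ a b; simp [h2]
  · exact ⟨fun a => hc.iB_eq_zero (.inr rfl) a, hc.kX_eq_zero, h,
      fun a b d => ((hc.iA d).iA b).iA_eq_zero a⟩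

@[simp] theorem iA_form (θ : G →ₗ[R] R) (a : G) : iA a (form θ : Co R G X) = cst (θ a) := by
  ext w v u α β x
  match w, v, u, α, β, x with
  | 0, 0, 0, _, _, _ => rfl
  | 0, 0, u + 1, _, _, _ => rfl
  | 0, v + 1, u, _, _, _ => rfl
  | w + 1, v, u, _, _, _ => rfl

@[simp] theorem iB_form (θ : G →ₗ[R] R) (a : G) : iB a (form θ : Co R G X) = 0 :=
  (Supp.form θ).iB_eq_zero (.inr rfl) a

@[simp] theorem kX_form (θ : G →ₗ[R] R) (y : X) : kX y (form θ : Co R G X) = 0 :=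
  (Supp.form θ).kX_eq_zero y

@[simp] theorem tw_form (θ : G →ₗ[R] R) : tw (form θ : Co R G X) = -form θ := by
  simpa using (Supp.form θ : Supp 1 0 (form θ : Co R G X)).tw_eq

theorem cst_add (f g : R) : (cst (f + g) : Co R G X) = cst f + cst g := by
  rw [← mul_one (cst (f + g)), cst_mul, add_smul, ← cst_mul, ← cst_mul, mul_one, mul_one]

theorem cst_mul_cst (f g : R) : (cst (f * g) : Co R G X) = f • cst g := by
  rw [← mul_one (cst (f * g)), cst_mul, mul_smul, ← cst_mul g, mul_one]

variable (h : IsLieAlgebroid O)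
include h

theorem Wint.dfun (f : R) : Wint O (dfun O f) :=
  ⟨dfun_multi O h.act_add_left h.act_smul_left f, fun g a => by simp⟩

theorem Wint.form (θ : G →ₗ[R] R) : Wint O (form θ) where
  multi :=
    { anti := (Supp.form θ).anti le_rfl zero_le_one
      A_add := fun a b => by simp [cst_add]
      A_smul := fun r a => by simp [cst_mul_cst]
      B_add := by simp
      B_smul := by simp
      X_add := by simp
      X_smul := by simp }
  leib f a := by simp [cst_mul_cst]

theorem dfun_add (f g : R) : Co.dfun O (f + g) = Co.dfun O f + Co.dfun O g := by
  ext w v u α β x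
  rw [add_app]
  unfold Co.dfun
  split
  · rw [h.act_add]
  · rw [add_zero]

theorem dfun_mul (f g : R) : Co.dfun O (f * g) = f • Co.dfun O g + g • Co.dfun O f := by
  ext w v u α β x
  rw [add_app, smul_app, smul_app]
  unfold Co.dfun
  split
  · rw [h.act_mul]; ring
  · simp

theorem iA_dV_form (θ : G →ₗ[R] R) (a : G) :
    iA a (dV O (fun _ _ => 0) (Co.form θ)) = -Co.dfun O (θ a) := by
  refine (((Supp.form θ).dV h).iA a).ext_of (Supp.dfun O (θ a)).neg ?_
  intro w v u h1 h2 α β x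
  obtain ⟨rfl, rfl, rfl⟩ : w = 0 ∧ v = 0 ∧ u = 1 := by omega
  rw [iA_app, dV_form_app_one h]
  simp [Co.dfun]

theorem iB_dV_form (θ : G →ₗ[R] R) (a : G) :
    iB a (dV O (fun _ _ => 0) (Co.form θ)) = cst (θ a) := by
  refine (((Supp.form θ).dV h).iB a).ext_of (Supp.cst (θ a)) ?_
  intro w v u h1 h2 α β x
  obtain ⟨rfl, rfl, rfl⟩ : w = 0 ∧ v = 0 ∧ u = 0 := by omega
  rw [iB_app, dV_form_app_zero h]
  simp

theorem kX_dV_form (θ : G →ₗ[R] R) (y : X) :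
    kX y (dV O (fun _ _ => 0) (Co.form θ)) = Co.evalForm fun a => O.act y (θ a) := by
  refine evalForm_eq (((Supp.form θ).dV h).kX y) _ fun α β x => ?_
  rw [kX_app, dV_form_app_one h]
  simp

theorem iA_dH_form (θ : G →ₗ[R] R) (a : G) :
    iA a (dH O (fun _ _ => 0) (Co.form θ)) = Co.evalForm fun b =>
      O.act (O.anchor a) (θ b) - O.act (O.anchor b) (θ a) - θ (O.lieG a b) := by
  refine evalForm_eq (((Supp.form θ).dH h).iA a) _ fun α β x => ?_
  rw [iA_app, dH_form_app h]
  simp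

/-- The intrinsic relation is the product rule for `d(f θ(a))`: contraction by `iA a` gives `-d(θ
a)`, and contraction by `iB a` gives `θ a`. -/
theorem Wint.dV_form (θ : G →ₗ[R] R) : Wint O (dV O (fun _ _ => 0) (Co.form θ)) where
  multi :=
    { anti := ((Supp.form θ).dV h).anti le_rfl le_rfl
      A_add := fun a b => by
        simp only [iA_dV_form h, map_add, dfun_add h]; abel
      A_smul := fun r a => by
        simp only [iA_dV_form h, map_smul, smul_eq_mul, dfun_mul h,
          dfun_algebraMap h.act_algebraMap, smul_zero, add_zero, smul_neg]
      B_add := fun a b => by simp only [iB_dV_form h, map_add, cst_add]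
      B_smul := fun r a => by simp only [iB_dV_form h, map_smul, smul_eq_mul, cst_mul_cst]
      X_add := fun y z => by simp only [kX_dV_form h, h.act_add_left, evalForm_add]
      X_smul := fun f y => by simp only [kX_dV_form h, h.act_smul_left, evalForm_smul] }
  leib f a := by
    simp only [iA_dV_form h, iB_dV_form h, map_smul, smul_eq_mul, dfun_mul h, mul_cst]
    simp only [smul_neg]; abel

theorem Wint.dH_form (θ : G →ₗ[R] R) : Wint O (dH O (fun _ _ => 0) (Co.form θ)) := by
  have hs := (Supp.form θ : Supp 1 0 (Co.form θ : Co R G X)).dH h (nabla := fun _ _ => 0)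
  have hB := fun a => hs.iB_eq_zero (.inr rfl) a
  have hX := hs.kX_eq_zero
  -- There are no symmetric arguments in bidegree `(2, 0)`, so the relation is linearity over
  -- functions: the derivatives of `f` from the anchor term and from the bracket cancel.
  have hl : ∀ (f : R) a, Co.iA (f • a) (dH O (fun _ _ => 0) (Co.form θ)) =
      f • Co.iA a (dH O (fun _ _ => 0) (Co.form θ)) := fun f a => by
    rw [iA_dH_form h, iA_dH_form h, ← evalForm_smul]
    congr 1; funext b
    simp only [h.anchor_smul, h.act_smul_left, map_smul, smul_eq_mul, h.act_mul, h.smul_lie,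
      map_sub]
    ring
  refine ⟨⟨Anti.of_supp_two hs fun a b => ?_, fun a b => ?_, fun r a => hl _ a, ?_, ?_, ?_, ?_⟩,
    fun f a => ?_⟩
  · rw [← sub_eq_zero, sub_neg_eq_add]
    refine (((hs.iA b).iA a).add ((hs.iA a).iA b)).eq_zero ?_
    intro w v u h1 h2 α β x
    obtain ⟨rfl, rfl, rfl⟩ : w = 0 ∧ v = 0 ∧ u = 0 := by omega
    rw [add_app, iA_app, iA_app, iA_app, iA_app, dH_form_app h, dH_form_app h]
    simp only [Fin.cons_zero, Fin.cons_one]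
    rw [h.lie_skew b a, map_neg]
    ring
  · rw [iA_dH_form h, iA_dH_form h, iA_dH_form h, ← evalForm_add]
    congr 1; funext d
    simp only [h.anchor_add, h.act_add_left, map_add, h.act_add, h.lie_add_left]
    ring
  · intro a b; simp [hB]
  · intro a b; simp [hB]
  · intro a b; simp [hX]
  · intro a b; simp [hX]
  · rw [hl, hB, mul_zero, sub_zero]

end GeneratorsWint

end Co

/-- On the support of the function `χ` the sections have a global finite frame, and the vector
fields are determined by their action on finitely many functions. -/
structure IsFramed {R G X : Type*} [CommRing R] [AddCommGroup G] [Module R G]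
    [AddCommGroup X] [Module R X] (O : Operations R G X) (χ : R) : Prop where
  frame : ∃ (m : ℕ) (e : Fin m → G) (θ : Fin m → G →ₗ[R] R), ∀ a, χ • a = χ • ∑ i, θ i a • e i
  coord : ∃ (m : ℕ) (e : Fin m → X) (g : Fin m → R), ∀ y, χ • y = χ • ∑ i, O.act y (g i) • e i

/-- The functions on whose support there are frames separate functions. -/
def IsLocallyFramed {R G X : Type*} [CommRing R] [AddCommGroup G] [Module R G]
    [AddCommGroup X] [Module R X] (O : Operations R G X) : Prop :=
  ∀ r : R, (∀ χ, IsFramed O χ → ∃ N : ℕ, χ ^ N * r = 0) → r = 0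

namespace Co

/-! ## Local generation of the intrinsic model -/

section Generation

variable {R G X : Type*} [CommRing R] [Algebra ℝ R] [AddCommGroup G] [Module R G]
    [AddCommGroup X] [Module R X] {O : Operations R G X}

/-- The truncated `q - 1` is harmless: for `q = 0` the contraction is zero. -/
theorem Supp.iB_pred {p q : ℕ} {c : Co R G X} (hc : Supp (p + 1) q c) (a : G) :
    Supp p (q - 1) (Co.iB a c) := by
  cases q with
  | zero => rw [hc.iB_eq_zero (.inr rfl)]; exact .zero
  | succ q => exact hc.iB a

theorem Supp.sum {p q m : ℕ} {c : Fin m → Co R G X} (hc : ∀ i, Supp p q (c i)) :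
    Supp p q (∑ i, c i) :=
  Finset.sum_induction _ (Supp p q) (fun _ _ h h' => h.add h') .zero fun i _ => hc i

/-- In bidegree `(p + 1, q)` every component has at least one exterior or symmetric argument. -/
theorem Supp.ext_iA_iB {p q : ℕ} {c d : Co R G X} (hc : Supp (p + 1) q c) (hd : Supp (p + 1) q d)
    (hA : ∀ a, Co.iA a c = Co.iA a d) (hB : ∀ a, Co.iB a c = Co.iB a d) : c = d := by
  ext w v u α β x
  match w, v, α, β with
  | 0, 0, α, β => rw [hc _ _ _ (by omega), hd _ _ _ (by omega)]
  | w + 1, v, α, β =>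
    rw [← Fin.cons_self_tail α]
    exact congrArg (fun c : Co R G X => c w v u (Fin.tail α) β x) (hA (α 0))
  | w, v + 1, α, β =>
    rw [← Fin.cons_self_tail β]
    exact congrArg (fun c : Co R G X => c w v u α (Fin.tail β) x) (hB (β 0))

theorem Supp.ext_kX {q : ℕ} {c d : Co R G X} (hc : Supp 0 (q + 1) c) (hd : Supp 0 (q + 1) d)
    (hX : ∀ a, Co.kX a c = Co.kX a d) : c = d := by
  refine hc.ext_of hd fun w v u h1 h2 α β x => ?_
  obtain ⟨rfl, rfl, rfl⟩ : w = 0 ∧ v = 0 ∧ u = q + 1 := by omega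
  rw [← Fin.cons_self_tail x]
  simpa [kX_app] using congrArg (fun c : Co R G X => c 0 0 q α β (Fin.tail x)) (hX (x 0))

variable {m : ℕ} (e : Fin m → G) (θ : Fin m → G →ₗ[R] R) (Y : Fin m → X) (g : Fin m → R)

variable (O) in
/-- The Euler operator of a frame. -/
def euler (c : Co R G X) : Co R G X :=
  ∑ i, (form (θ i) * iA (e i) c + dV O (fun _ _ => 0) (form (θ i)) * iB (e i) c)

variable (O) in
/-- The Euler operator of a coordinate system. -/
def eulerX (c : Co R G X) : Co R G X := ∑ i, dfun O (g i) * kX (Y i) c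

theorem Wint.iA_sum {c : Co R G X} (hc : Wint O c) (f : Fin m → R) :
    Co.iA (∑ i, f i • e i) c = ∑ i, (f i • Co.iA (e i) c - Co.dfun O (f i) * Co.iB (e i) c) := by
  have := map_sum (AddMonoidHom.mk' (fun a => Co.iA a c) hc.multi.A_add) (fun i => f i • e i)
    Finset.univ
  simpa only [AddMonoidHom.mk'_apply, hc.leib] using this

theorem Multi.iB_sum {c : Co R G X} (hc : Multi c) (f : Fin m → R) :
    Co.iB (∑ i, f i • e i) c = ∑ i, f i • Co.iB (e i) c := by
  have := map_sum (AddMonoidHom.mk' (fun a => Co.iB a c) hc.B_add) (fun i => f i • e i)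
    Finset.univ
  simpa only [AddMonoidHom.mk'_apply, hc.B_smul] using this

theorem Multi.kX_sum {c : Co R G X} (hc : Multi c) (f : Fin m → R) :
    Co.kX (∑ i, f i • Y i) c = ∑ i, f i • Co.kX (Y i) c := by
  have := map_sum (AddMonoidHom.mk' (fun a => Co.kX a c) hc.X_add) (fun i => f i • Y i)
    Finset.univ
  simpa only [AddMonoidHom.mk'_apply, hc.X_smul] using this

theorem iA_sum (a : G) (c : Fin m → Co R G X) : iA a (∑ i, c i) = ∑ i, iA a (c i) :=
  map_sum (AddMonoidHom.mk' (fun c : Co R G X => iA a c) fun _ _ => rfl) c Finset.univ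

theorem iB_sum (a : G) (c : Fin m → Co R G X) : iB a (∑ i, c i) = ∑ i, iB a (c i) :=
  map_sum (AddMonoidHom.mk' (fun c : Co R G X => iB a c) fun _ _ => rfl) c Finset.univ

theorem kX_sum (a : X) (c : Fin m → Co R G X) : kX a (∑ i, c i) = ∑ i, kX a (c i) :=
  map_sum (AddMonoidHom.mk' (fun c : Co R G X => kX a c) fun _ _ => kX_add ..) c Finset.univ

variable (h : IsLieAlgebroid O)
include h

/-- The contractions `θ_i(a)` of `θ_i` and `-d(θ_i(a))` of its vertical differential reproduce the
two terms by which an intrinsic cochain expands along `∑ θ_i(a) e_i`. This is why `d^ver θ_i` has to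
be among the generators. -/
theorem iA_euler {c : Co R G X} (hc : Wint O c) (a : G) :
    iA a (euler O e θ c) = euler O e θ (iA a c) + iA (∑ i, θ i a • e i) c := by
  rw [hc.iA_sum, euler, iA_sum, euler, ← Finset.sum_add_distrib]
  refine Finset.sum_congr rfl fun i _ => ?_
  have ht : tw (dV O (fun _ _ => 0) (form (θ i))) = dV O (fun _ _ => 0) (form (θ i)) := by
    simpa using ((Supp.form (θ i)).dV h (nabla := fun _ _ => 0)).tw_eq
  rw [iA_add, iA_mul, iA_mul, iA_form, tw_form, iA_dV_form h, ht, hc.multi.anti.iA_iA a, iA_iB,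
    cst_mul]
  noncomm_ring

theorem iB_euler {c : Co R G X} (hc : Wint O c) (a : G) :
    iB a (euler O e θ c) = euler O e θ (iB a c) + iB (∑ i, θ i a • e i) c := by
  rw [hc.multi.iB_sum, euler, iB_sum, euler, ← Finset.sum_add_distrib]
  refine Finset.sum_congr rfl fun i _ => ?_
  rw [iB_add, iB_mul, iB_mul, iB_form, iB_dV_form h, hc.multi.anti.iB_iB a, ← iA_iB, cst_mul]
  noncomm_ring

theorem kX_eulerX {c : Co R G X} (hc : Multi c) (y : X) :
    kX y (eulerX O Y g c) = eulerX O Y g (kX y c) + kX (∑ i, O.act y (g i) • Y i) c := by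
  rw [hc.kX_sum, eulerX, kX_sum, eulerX, ← Finset.sum_add_distrib]
  refine Finset.sum_congr rfl fun i _ => ?_
  rw [kX_mul, kX_dfun, tw_dfun, hc.anti.kX_kX y, cst_mul]
  noncomm_ring

theorem Supp.euler {p q : ℕ} {c : Co R G X} (hc : Supp (p + 1) q c) :
    Supp (p + 1) q (euler O e θ c) := by
  refine Supp.sum fun i => .add ?_ ?_
  · simpa [add_comm] using (Supp.form (θ i)).mul (hc.iA (e i))
  · cases q with
    | zero => rw [hc.iB_eq_zero (.inr rfl), mul_zero]; exact .zero
    | succ q => simpa [add_comm] using ((Supp.form (θ i)).dV h).mul (hc.iB (e i))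

theorem Supp.eulerX {q : ℕ} {c : Co R G X} (hc : Supp 0 (q + 1) c) :
    Supp 0 (q + 1) (eulerX O Y g c) := by
  refine Supp.sum fun i => ?_
  simpa [add_comm] using (Supp.dfun O (g i)).mul (hc.kX (Y i))

omit h in
-- The first factor `χ` moves into the argument at the cost of a term `dχ * iB`; the second is
-- needed to identify these extra terms.
theorem Wint.iA_congr {c : Co R G X} (hc : Wint O c) {χ : R} {a b : G} (hab : χ • a = χ • b) :
    χ ^ 2 • Co.iA a c = χ ^ 2 • Co.iA b c := by
  have h1 : χ • Co.iB a c = χ • Co.iB b c := by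
    rw [← hc.multi.B_smul, ← hc.multi.B_smul, hab]
  have h2 := hc.leib χ a
  rw [hab, hc.leib χ b] at h2
  have h3 := congrArg (χ • ·) h2
  simp only [smul_sub, smul_smul, ← sq, ← mul_smul_comm, h1] at h3
  exact (sub_left_injective h3).symm

/-- Commuting the Euler operator past a contraction in an exterior or symmetric argument yields one
further copy of that contraction, so its eigenvalue on the support of `χ` is the total number `p` of
these arguments. -/
theorem smul_euler {χ : R} (he : ∀ a, χ • a = χ • ∑ i, θ i a • e i) (p : ℕ) :
    ∀ (q : ℕ) (c : Co R G X), Wint O c → Supp p q c →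
      χ ^ 2 • euler O e θ c = (p : R) • χ ^ 2 • c := by
  induction p with
  | zero =>
    intro q c hc hs
    have : euler O e θ c = 0 := by
      refine Finset.sum_eq_zero fun i _ => ?_
      rw [hs.iA_eq_zero, hs.iB_eq_zero (.inl rfl), mul_zero, mul_zero, add_zero]
    simp [this]
  | succ p ih =>
    intro q c hc hs
    refine ((hs.euler e θ h).smul _).ext_iA_iB ((hs.smul _).smul _) (fun a => ?_) fun a => ?_
    · rw [iA_smul, iA_euler e θ h hc, smul_add, ih _ _ (hc.iA a) (hs.iA a),
        ← hc.iA_congr (he a), iA_smul, iA_smul]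
      push_cast
      rw [add_smul, one_smul]
    · have h1 : χ ^ 2 • iB (∑ i, θ i a • e i) c = χ ^ 2 • iB a c := by
        rw [sq, mul_smul, mul_smul, ← hc.multi.B_smul, ← he, hc.multi.B_smul]
      rw [iB_smul, iB_euler e θ h hc, smul_add, ih _ _ (hc.iB a) (hs.iB_pred a), h1, iB_smul,
        iB_smul]
      push_cast
      rw [add_smul, one_smul]

/-- The same count for form arguments. Only multilinearity is assumed, because `kX` need not
preserve the intrinsic relation; in bidegree `(0, q)` that relation is vacuous by
`Wint.of_supp_zero`. -/
theorem smul_eulerX {χ : R} (he : ∀ a, χ • a = χ • ∑ i, O.act a (g i) • Y i) (q : ℕ) :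
    ∀ c : Co R G X, Multi c → Supp 0 q c → χ • eulerX O Y g c = (q : R) • χ • c := by
  induction q with
  | zero =>
    intro c hc hs
    have : eulerX O Y g c = 0 := by
      refine Finset.sum_eq_zero fun i _ => ?_
      rw [hs.kX_eq_zero, mul_zero]
    simp [this]
  | succ q ih =>
    intro c hc hs
    refine ((hs.eulerX Y g h).smul _).ext_kX ((hs.smul _).smul _) fun a => ?_
    have h1 : χ • kX (∑ i, O.act a (g i) • Y i) c = χ • kX a c := by
      rw [← hc.X_smul, ← he, hc.X_smul]
    rw [kX_smul, kX_eulerX Y g h hc, smul_add, ih _ (hc.kX a) (hs.kX a), h1, kX_smul, kX_smul]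
    push_cast
    rw [add_smul, one_smul]

omit h in
theorem Wint.of_supp_zero {q : ℕ} {c : Co R G X} (hc : Multi c) (hs : Supp 0 q c) : Wint O c :=
  ⟨hc, fun f a => by simp [hs.iA_eq_zero, hs.iB_eq_zero (.inl rfl)]⟩

/-- The cochains which satisfy `P` after multiplication by a power of `χ`. -/
def LocalAt (O : Operations R G X) (P : Co R G X → Prop) (χ : R) (c : Co R G X) : Prop :=
  ∃ N : ℕ, Wint O (χ ^ N • c) ∧ P (χ ^ N • c)

/-- An induction principle: the intrinsic model is locally generated by functions, forms on `A`
and their vertical differentials. -/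
theorem Wint.induction {P : Co R G X → Prop} (cst : ∀ f, P (Co.cst f)) (form : ∀ θ, P (Co.form θ))
    (dfun : ∀ f, P (Co.dfun O f)) (dV_form : ∀ θ, P (dV O (fun _ _ => 0) (Co.form θ)))
    (add : ∀ c d, Wint O c → Wint O d → P c → P d → P (c + d))
    (mul : ∀ c d, Wint O c → Wint O d → P c → P d → P (c * d))
    (loc : ∀ p q c, Wint O c → Supp p q c →
      (∀ χ, IsFramed O χ → ∃ N : ℕ, Wint O (χ ^ N • c) ∧ P (χ ^ N • c)) → P c)
    {p q : ℕ} {c : Co R G X} (hc : Wint O c) (hs : Supp p q c) : P c := by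
  refine loc p q c hc hs fun χ ⟨⟨m, e, θ, he⟩, ⟨m', Y, g, hY⟩⟩ => ?_
  change LocalAt O P χ c
  have lmul : ∀ g c, Wint O g → P g → LocalAt O P χ c → LocalAt O P χ (g * c) := by
    rintro g c hg hg' ⟨N, hN, hN'⟩
    refine ⟨N, ?_, ?_⟩ <;> rw [← mul_smul_comm]
    · exact hg.mul hN
    · exact mul _ _ hg hN hg' hN'
  have lsmul : ∀ f c, LocalAt O P χ c → LocalAt O P χ (f • c) := fun f c hc => by
    rw [← cst_mul]; exact lmul _ _ (.cst f) (cst f) hc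
  -- The exponent may be increased, which allows a common exponent for two summands.
  have lpow : ∀ k N c, Wint O (χ ^ N • c) → P (χ ^ N • c) →
      Wint O (χ ^ (k + N) • c) ∧ P (χ ^ (k + N) • c) := by
    intro k N c h1 h2
    rw [pow_add, mul_smul, ← cst_mul]
    exact ⟨(Wint.cst _).mul h1, mul _ _ (.cst _) h1 (cst _) h2⟩
  have ladd : ∀ c d, LocalAt O P χ c → LocalAt O P χ d → LocalAt O P χ (c + d) := by
    rintro c d ⟨N, hN, hN'⟩ ⟨N', h1, h1'⟩
    obtain ⟨h2, h2'⟩ := lpow N' N c hN hN'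
    obtain ⟨h3, h3'⟩ := lpow N N' d h1 h1'
    rw [add_comm] at h2 h2'
    refine ⟨N + N', ?_, ?_⟩ <;> rw [smul_add]
    · exact h2.add h3
    · exact add _ _ h2 h3 h2' h3'
  have l0 : LocalAt O P χ 0 := by
    refine ⟨0, ?_, ?_⟩ <;> rw [smul_zero]
    · exact .zero
    · have : (Co.cst 0 : Co R G X) = 0 := by simpa using cst_mul_cst (G := G) (X := X) (0 : R) 0
      exact this ▸ cst 0
  have lunit : ∀ k c, LocalAt O P χ (χ ^ k • c) → LocalAt O P χ c := by
    rintro k c ⟨N, hN, hN'⟩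
    rw [smul_smul, ← pow_add] at hN hN'
    exact ⟨N + k, hN, hN'⟩
  -- Division by a positive eigenvalue of an Euler operator; here real scalars are essential.
  have lnat : ∀ (k : ℕ) c, LocalAt O P χ (((k + 1 : ℕ) : R) • c) → LocalAt O P χ c := by
    intro k c hc
    have := lsmul (algebraMap ℝ R ((k + 1 : ℕ) : ℝ)⁻¹) _ hc
    rwa [smul_smul, ← map_natCast (algebraMap ℝ R), ← map_mul,
      inv_mul_cancel₀ (Nat.cast_ne_zero.2 (Nat.succ_ne_zero k)), map_one, one_smul] at this
  clear loc
  induction p generalizing q c with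
  | zero =>
    induction q generalizing c with
    | zero =>
      refine ⟨0, by simpa using hc, ?_⟩
      have : c = Co.cst (c 0 0 0 ![] ![] ![]) := hs.ext_of (Supp.cst _) fun w v u h1 h2 α β x => by
        obtain ⟨rfl, rfl, rfl⟩ : w = 0 ∧ v = 0 ∧ u = 0 := by omega
        rw [Subsingleton.elim α ![], Subsingleton.elim β ![], Subsingleton.elim x ![]]
        rfl
      rw [pow_zero, one_smul, this]
      exact cst _
    | succ q ih =>
      have h1 := smul_eulerX Y g h hY _ c hc.multi hs
      refine lunit 1 _ (lnat q _ ?_)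
      rw [pow_one, ← h1]
      refine lsmul _ _ (Finset.sum_induction _ _ ladd l0 fun i _ => ?_)
      exact lmul _ _ (Wint.dfun h _) (dfun _)
        (ih (.of_supp_zero (hc.multi.kX _) (hs.kX _)) (hs.kX _))
  | succ p ih =>
    -- Both contractions in the Euler operator lower `p`, so each summand is a product of a
    -- generator and a cochain covered by the induction hypothesis.
    have h1 := smul_euler e θ h he _ _ c hc hs
    refine lunit 2 _ (lnat p _ ?_)
    rw [← h1]
    refine lsmul _ _ (Finset.sum_induction _ _ ladd l0 fun i _ => ladd _ _ ?_ ?_)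
    · exact lmul _ _ (Wint.form h _) (form _) (ih (hc.iA _) (hs.iA _))
    · exact lmul _ _ (Wint.dV_form h _) (dV_form _) (ih (hc.iB _) (hs.iB_pred _))

end Generation

end Co

theorem IsLocallyFramed.eq {R G X : Type*} [CommRing R] [AddCommGroup G] [Module R G]
    [AddCommGroup X] [Module R X] {O : Operations R G X} (hL : IsLocallyFramed O) {r s : R}
    (hrs : ∀ χ, IsFramed O χ → ∃ N : ℕ, χ ^ N * r = χ ^ N * s) : r = s := by
  refine sub_eq_zero.1 (hL _ fun χ hχ => ?_)
  obtain ⟨N, hN⟩ := hrs χ hχ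
  exact ⟨N, by rw [mul_sub, hN, sub_self]⟩

namespace Co

/-! ### The differentials of the intrinsic model -/

section Operators

variable {R G X : Type*} [CommRing R] [Algebra ℝ R] [AddCommGroup G] [Module R G]
    [AddCommGroup X] [Module R X] {O : Operations R G X}

theorem eq_of_local (hL : IsLocallyFramed O) {c d : Co R G X}
    (hcd : ∀ χ, IsFramed O χ → ∃ N : ℕ, χ ^ N • c = χ ^ N • d) : c = d := by
  ext w v u α β x
  refine hL.eq fun χ hχ => ?_
  obtain ⟨N, hN⟩ := hcd χ hχ
  exact ⟨N, congrArg (fun c : Co R G X => c w v u α β x) hN⟩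

theorem Anti.of_local (hL : IsLocallyFramed O) {c : Co R G X}
    (hc : ∀ χ, IsFramed O χ → ∃ N : ℕ, Anti (χ ^ N • c)) : Anti c where
  A v u β x n i b α := by
    refine hL.eq fun χ hχ => ?_
    obtain ⟨N, hN⟩ := hc χ hχ
    have := hN.A v u β x n i b α
    simp only [smul_app] at this
    exact ⟨N, by rw [this, mul_smul_comm]⟩
  B w v u α i b β x := by
    refine hL.eq fun χ hχ => ?_
    obtain ⟨N, hN⟩ := hc χ hχ
    exact ⟨N, hN.B w v u α i b β x⟩
  X w v α β n i b x := by
    refine hL.eq fun χ hχ => ?_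
    obtain ⟨N, hN⟩ := hc χ hχ
    have := hN.X w v α β n i b x
    simp only [smul_app] at this
    exact ⟨N, by rw [this, mul_smul_comm]⟩

theorem Wint.of_local (hL : IsLocallyFramed O) {c : Co R G X}
    (hc : ∀ χ, IsFramed O χ → ∃ N : ℕ, Wint O (χ ^ N • c)) : Wint O c where
  multi :=
    { anti := .of_local hL fun χ hχ => (hc χ hχ).imp fun _ h => h.multi.anti
      A_add := fun a b => eq_of_local hL fun χ hχ => (hc χ hχ).imp fun _ h => by
        simpa only [iA_smul, smul_add] using h.multi.A_add a b
      A_smul := fun r a => eq_of_local hL fun χ hχ => (hc χ hχ).imp fun N h => by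
        rw [smul_comm]
        simpa only [iA_smul] using h.multi.A_smul r a
      B_add := fun a b => eq_of_local hL fun χ hχ => (hc χ hχ).imp fun _ h => by
        simpa only [iB_smul, smul_add] using h.multi.B_add a b
      B_smul := fun r a => eq_of_local hL fun χ hχ => (hc χ hχ).imp fun N h => by
        rw [smul_comm]
        simpa only [iB_smul] using h.multi.B_smul r a
      X_add := fun a b => eq_of_local hL fun χ hχ => (hc χ hχ).imp fun _ h => by
        simpa only [kX_smul, smul_add] using h.multi.X_add a b
      X_smul := fun r a => eq_of_local hL fun χ hχ => (hc χ hχ).imp fun N h => by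
        rw [smul_comm]
        simpa only [kX_smul] using h.multi.X_smul r a }
  leib f a := eq_of_local hL fun χ hχ => (hc χ hχ).imp fun N h => by
    rw [smul_sub, smul_comm _ f, ← mul_smul_comm]
    simpa only [iA_smul, iB_smul] using h.leib f a

/-- `T` maps homogeneous elements of the intrinsic model to elements of the intrinsic model. -/
def Preserves (O : Operations R G X) (T : Co R G X → Co R G X) : Prop :=
  ∀ ⦃p q : ℕ⦄ ⦃c : Co R G X⦄, Wint O c → Supp p q c → Wint O (T c)

variable (h : IsLieAlgebroid O) (hL : IsLocallyFramed O) {T T' : Co R G X → Co R G X}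

theorem OddOp.smul (hT : OddOp T) {c : Co R G X} (hc : Anti c) (f : R) :
    T (f • c) = T (cst f) * c + f • T c := by
  rw [← cst_mul, hT.mul _ _ (.cst f) hc, tw_cst, cst_mul]

include h hL

/-- Membership in the intrinsic model is a local property, so an odd derivation preserves the model
as soon as it maps generators into it. -/
theorem OddOp.preserves (hT : OddOp T) (hcst : ∀ f, Wint O (T (cst f)))
    (hform : ∀ θ, Wint O (T (form θ))) (hdfun : ∀ f, Wint O (T (dfun O f)))
    (hdV : ∀ θ, Wint O (T (dV O (fun _ _ => 0) (form θ)))) : Preserves O T := by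
  intro p q c hc hs
  refine Wint.induction h (P := fun c => Wint O (T c)) hcst hform hdfun hdV ?_ ?_ ?_ hc hs
  · intro c d _ _ h1 h2
    rw [hT.add]; exact h1.add h2
  · intro c d hc hd h1 h2
    rw [hT.mul _ _ hc.multi.anti hd.multi.anti]; exact (h1.mul hd).add (hc.tw.mul h2)
  · intro p q c hc _ hl
    refine Wint.of_local hL fun χ hχ => (hl χ hχ).imp fun N hN => ?_
    -- By the Leibniz rule `χ ^ N • T c` is the difference of `T (χ ^ N • c)` and `T (χ ^ N) * c`,
    -- both intrinsic.
    have := hN.2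
    rw [hT.smul hc.multi.anti] at this
    simpa using this.sub ((hcst (χ ^ N)).mul hc)

omit h hL in
-- The anticommutator of two odd derivations is an even derivation. The images have to be intrinsic
-- because the Leibniz rules are available only for symmetric cochains.
theorem anticomm_mul (hT : OddOp T) (hT' : OddOp T') {c d : Co R G X} (hc : Wint O c)
    (hd : Wint O d) (h1 : Wint O (T c)) (h2 : Wint O (T d)) (h1' : Wint O (T' c))
    (h2' : Wint O (T' d)) : T (T' (c * d)) + T' (T (c * d)) =
      (T (T' c) + T' (T c)) * d + c * (T (T' d) + T' (T d)) := by
  rw [hT'.mul _ _ hc.multi.anti hd.multi.anti, hT.mul _ _ hc.multi.anti hd.multi.anti, hT.add,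
    hT'.add, hT.mul _ _ h1'.multi.anti hd.multi.anti, hT'.mul _ _ h1.multi.anti hd.multi.anti,
    hT.mul _ _ hc.tw.multi.anti h2'.multi.anti, hT'.mul _ _ hc.tw.multi.anti h2.multi.anti,
    hT.tw, hT'.tw, tw_tw]
  noncomm_ring

/-- Membership of `T c` and `T' c` is carried along in the induction so that the derivation rule can
be applied again to products. -/
theorem anticomm_eq_zero (hT : OddOp T) (hT' : OddOp T') (pT : Preserves O T)
    (pT' : Preserves O T') (hcst : ∀ f, T (T' (cst f)) + T' (T (cst f)) = 0)
    (hform : ∀ θ, T (T' (form θ)) + T' (T (form θ)) = 0)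
    (hdfun : ∀ f, T (T' (dfun O f)) + T' (T (dfun O f)) = 0)
    (hdV : ∀ θ, T (T' (dV O (fun _ _ => 0) (form θ))) +
      T' (T (dV O (fun _ _ => 0) (form θ))) = 0)
    {p q : ℕ} {c : Co R G X} (hc : Wint O c) (hs : Supp p q c) : T (T' c) + T' (T c) = 0 := by
  have wc := fun f => Wint.cst (O := O) f
  have sc : ∀ f, Supp 0 0 (cst f : Co R G X) := Supp.cst
  have key := Wint.induction h
    (P := fun c => Wint O (T c) ∧ Wint O (T' c) ∧ T (T' c) + T' (T c) = 0)
    (fun f => ⟨pT (wc f) (sc f), pT' (wc f) (sc f), hcst f⟩)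
    (fun θ => ⟨pT (Wint.form h θ) (Supp.form θ), pT' (Wint.form h θ) (Supp.form θ), hform θ⟩)
    (fun f => ⟨pT (Wint.dfun h f) (Supp.dfun O f), pT' (Wint.dfun h f) (Supp.dfun O f), hdfun f⟩)
    (fun θ => ⟨pT (Wint.dV_form h θ) ((Supp.form θ).dV h),
      pT' (Wint.dV_form h θ) ((Supp.form θ).dV h), hdV θ⟩) ?_ ?_ ?_ hc hs
  · exact key.2.2
  · rintro c d _ _ ⟨h1, h2, h3⟩ ⟨h1', h2', h3'⟩
    rw [hT.add, hT'.add]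
    refine ⟨h1.add h1', h2.add h2', ?_⟩
    rw [hT.add, hT'.add, add_add_add_comm, h3, h3', add_zero]
  · rintro c d hc hd ⟨h1, h2, h3⟩ ⟨h1', h2', h3'⟩
    refine ⟨?_, ?_, ?_⟩
    · rw [hT.mul _ _ hc.multi.anti hd.multi.anti]; exact (h1.mul hd).add (hc.tw.mul h1')
    · rw [hT'.mul _ _ hc.multi.anti hd.multi.anti]; exact (h2.mul hd).add (hc.tw.mul h2')
    · rw [anticomm_mul hT hT' hc hd h1 h1' h2 h2', h3, h3', zero_mul, mul_zero, add_zero]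
  · intro p q c hc hs hl
    refine ⟨pT hc hs, pT' hc hs, eq_of_local hL fun χ hχ => ?_⟩
    obtain ⟨N, -, -, -, hN⟩ := hl χ hχ
    refine ⟨N, ?_⟩
    rw [← cst_mul, anticomm_mul hT hT' (wc _) hc (pT (wc _) (sc _)) (pT hc hs)
      (pT' (wc _) (sc _)) (pT' hc hs), hcst, zero_mul, zero_add, cst_mul] at hN
    rw [hN, smul_zero]

omit h hL in
theorem eq_zero_of_add_self {c : Co R G X} (hc : c + c = 0) : c = 0 := by
  have : (algebraMap ℝ R (1 / 2)) • (c + c) = c := by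
    rw [smul_add, ← add_smul, ← map_add]
    norm_num
  rw [← this, hc, smul_zero]

omit hL in
theorem isBiadditive_zero : IsBiadditive (fun (_ : X) (_ : G) => (0 : G)) :=
  ⟨fun _ _ _ => by simp, fun _ _ _ => by simp⟩

omit hL in
theorem dV_oddOp' {nabla : X → G → G} : OddOp (dV O nabla) := dV_oddOp O _ h.toIsDerivationAction
omit hL in
theorem dH_oddOp' {nabla : X → G → G} : OddOp (dH O nabla) := dH_oddOp O _ h.toIsDerivationAction

theorem dV_preserves : Preserves O (dV O fun _ _ => 0) := by
  refine OddOp.preserves h hL (dV_oddOp' h) (fun f => ?_) (Wint.dV_form h) (fun f => ?_) fun θ => ?_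
  · rw [dV_cst h]; exact .dfun h f
  · rw [← dV_cst h (nabla := fun _ _ => 0), dV_dV_cst h]; exact .zero
  · rw [dV_dV_form h (isBiadditive_zero h)]; exact .zero

/-- On the vertical differential of a generator, `dH` is minus `dV` of the horizontal one, so
stability under `dV` has to be known first. -/
theorem dH_preserves : Preserves O (dH O fun _ _ => 0) := by
  refine OddOp.preserves h hL (dH_oddOp' h) (fun f => ?_) (Wint.dH_form h) (fun f => ?_) fun θ => ?_
  · rw [dH_cst h]; exact .form h _
  · rw [← dV_cst h (nabla := fun _ _ => 0),
      eq_neg_of_add_eq_zero_left (dH_dV_cst h (isBiadditive_zero h) f), dH_cst h]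
    exact (Wint.dV_form h _).neg
  · rw [eq_neg_of_add_eq_zero_left (dH_dV_form h (isBiadditive_zero h) θ)]
    exact (dV_preserves h hL (Wint.dH_form h θ) ((Supp.form θ).dH h)).neg

theorem dV_dV {p q : ℕ} {c : Co R G X} (hc : Wint O c) (hs : Supp p q c) :
    dV O (fun _ _ => 0) (dV O (fun _ _ => 0) c) = 0 := by
  have hd := dV_oddOp' h (nabla := fun _ _ => 0)
  have e1 := dV_dV_cst h (nabla := fun _ _ => 0)
  have e2 := dV_dV_form h (isBiadditive_zero h)
  refine eq_zero_of_add_self (anticomm_eq_zero h hL hd hd (dV_preserves h hL) (dV_preserves h hL)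
    (fun f => ?_) (fun θ => ?_) (fun f => ?_) (fun θ => ?_) hc hs)
  · rw [e1, add_zero]
  · rw [e2, add_zero]
  · rw [← dV_cst h (nabla := fun _ _ => 0), e1, hd.zero, add_zero]
  · rw [e2, hd.zero, add_zero]

theorem dH_dV {p q : ℕ} {c : Co R G X} (hc : Wint O c) (hs : Supp p q c) :
    dH O (fun _ _ => 0) (dV O (fun _ _ => 0) c) + dV O (fun _ _ => 0) (dH O (fun _ _ => 0) c) =
      0 := by
  have hd := dV_oddOp' h (nabla := fun _ _ => 0)
  have hd' := dH_oddOp' h (nabla := fun _ _ => 0)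
  have e1 := dV_dV_cst h (nabla := fun _ _ => 0)
  have e2 := dV_dV_form h (isBiadditive_zero h)
  have e3 := dH_dV_cst h (isBiadditive_zero h)
  have e4 := dH_dV_form h (isBiadditive_zero h)
  refine anticomm_eq_zero h hL hd' hd (dH_preserves h hL) (dV_preserves h hL)
    e3 e4 (fun f => ?_) (fun θ => ?_) hc hs
  · rw [← dV_cst h (nabla := fun _ _ => 0), e1, hd'.zero, zero_add,
      eq_neg_of_add_eq_zero_left (e3 f), hd.map_neg, dH_cst h, e2, neg_zero]
  · rw [e2, hd'.zero, zero_add, eq_neg_of_add_eq_zero_left (e4 θ), hd.map_neg,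
      dV_dV h hL (Wint.dH_form h θ) ((Supp.form θ).dH h), neg_zero]

omit hL in
theorem dH_dH_cst {nabla : X → G → G} (f : R) : dH O nabla (dH O nabla (cst f)) = 0 := by
  refine (((Supp.cst f).dH h).dH h).eq_zero ?_
  intro w v u h1 h2 α β x
  obtain ⟨rfl, rfl, rfl⟩ : (w = 2 ∧ v = 0 ∧ u = 0) := by omega
  rw [dH_cst h, dH_form_app h]
  simp only [anchorForm, LinearMap.coe_mk, AddHom.coe_mk, h.anchor_lie, h.act_lieX, sub_self]

/-- On functions and sections of the dual this is the direct computation; on their vertical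
differentials, two applications of anticommutation move `dV` to the outside. -/
theorem dH_dH {p q : ℕ} {c : Co R G X} (hc : Wint O c) (hs : Supp p q c) :
    dH O (fun _ _ => 0) (dH O (fun _ _ => 0) c) = 0 := by
  have hd := dV_oddOp' h (nabla := fun _ _ => 0)
  have hd' := dH_oddOp' h (nabla := fun _ _ => 0)
  have e1 := dH_dH_cst h (nabla := fun _ _ => 0)
  have e2 := dH_dH_form h (nabla := fun _ _ => 0)
  have e3 := dH_dV_cst h (isBiadditive_zero h)
  have e4 := dH_dV_form h (isBiadditive_zero h)
  refine eq_zero_of_add_self (anticomm_eq_zero h hL hd' hd' (dH_preserves h hL)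
    (dH_preserves h hL) (fun f => ?_) (fun θ => ?_) (fun f => ?_) (fun θ => ?_) hc hs)
  · rw [e1, add_zero]
  · rw [e2, add_zero]
  · rw [← dV_cst h (nabla := fun _ _ => 0), eq_neg_of_add_eq_zero_left (e3 f), hd'.map_neg,
      dH_cst h, eq_neg_of_add_eq_zero_left (e4 _), ← dH_cst h (nabla := fun _ _ => 0), e1, hd.zero,
      neg_zero, neg_zero, add_zero]
  · rw [eq_neg_of_add_eq_zero_left (e4 θ), hd'.map_neg, eq_neg_of_add_eq_zero_left
      (dH_dV h hL (Wint.dH_form h θ) ((Supp.form θ).dH h)), e2, hd.zero, neg_zero, neg_zero,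
      add_zero]

end Operators

end Co

namespace Co

/-! ## Comparison of the two models -/

section Comparison

variable {R G X : Type*} [CommRing R]

theorem phi_zero (nabla : X → G → G) (s : R) : phi nabla s (0 : Co R G X) = 0 := by
  simpa using phi_smul nabla s 0 (0 : Co R G X)

theorem Supp.phi {p q : ℕ} {c : Co R G X} (hc : Supp p q c) (nabla : X → G → G) (s : R) :
    Supp p q (phi nabla s c) := by
  have : HasWt (Co.phi nabla s) 0 0 0 0 := fun t c => phi_wt nabla s _ c
  exact this.supp (phi_zero nabla s) hc

/-- The correction enters only through a symmetric argument. -/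
theorem phi_eq_self (nabla : X → G → G) (s : R) {c : Co R G X} (hc : ∀ b, iB b c = 0) :
    phi nabla s c = c := by
  refine eq_of_iA (ι := {c : Co R G X // ∀ b, iB b c = 0}) (fun c => phi nabla s c.1)
    (fun c => c.1) (fun _ _ _ _ _ _ => rfl) ?_ ⟨c, hc⟩
  rintro n ih ⟨c, hc⟩ a v u α β x
  have hg : gam nabla a c = 0 := by
    ext w v u α β x
    have h1 : altSum (fun (y : X) n x' => (0 : R)) u x = 0 := by
      simpa using altSum_mul (0 : R) (fun (y : X) n x' => (0 : R)) u x
    simp [gam, altX, hc, h1]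
  have := ih ⟨iA a c, fun b => by rw [← iA_iB, hc]; rfl⟩ v u α β x
  simpa [iA_phi, corr, hg] using this

theorem phi_app_one (nabla : X → G → G) (s : R) (c : Co R G X) (α : Fin 1 → G) (β : Fin 0 → G)
    (x : Fin 1 → X) : phi nabla s c 1 0 1 α β x =
      c 1 0 1 α β x + s * c 0 1 0 ![] ![nabla (x 0) (α 0)] ![] := by
  change corr nabla s (α 0) c 0 0 1 (Fin.tail α) β x = _
  rw [corr, add_app, smul_app, iA_app, Fin.cons_self_tail]
  have e : gam nabla (α 0) c 0 0 1 (Fin.tail α) β x =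
      c 0 1 0 (Fin.tail α) (Fin.cons (nabla (x 0) (α 0)) β) (Fin.removeNth 0 x) := by
    simp [gam, altX, altSum, iB_app]
  rw [e, Subsingleton.elim (Fin.tail α) ![], Subsingleton.elim (Fin.removeNth 0 x) ![]]
  congr 3
  ext i
  rw [show i = 0 from Fin.ext (by omega)]
  rfl

end Comparison

/-! ### Transport of the differentials along the isomorphism -/

section Operators

variable {R G X : Type*} [CommRing R] [Algebra ℝ R] [AddCommGroup G] [Module R G]
    [AddCommGroup X] [Module R X] {O : Operations R G X}

variable (h : IsLieAlgebroid O) (hL : IsLocallyFramed O) {T T' : Co R G X → Co R G X}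
  {nabla : X → G → G} (hn : IsConn O nabla)

include h
-- Correcting the intrinsic `-x(θ(α))` by the value `θ(∇_x α)` of the symmetric component gives the
-- component of the covariant differential of `θ`.
theorem phi_dV_form (θ : G →ₗ[R] R) :
    phi nabla 1 (dV O (fun _ _ => 0) (form θ)) = dV O nabla (form θ) := by
  refine (((Supp.form θ).dV h).phi nabla 1).ext_of ((Supp.form θ).dV h) ?_
  intro w v u h1 h2 α β x
  obtain ⟨rfl, rfl, rfl⟩ | ⟨rfl, rfl, rfl⟩ : (w = 1 ∧ v = 0 ∧ u = 1) ∨ (w = 0 ∧ v = 1 ∧ u = 0) := by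
    omega
  · rw [phi_app_one, dV_form_app_one h, dV_form_app_one h, dV_form_app_zero h]
    simp; ring
  · rw [phi_zero_app, dV_form_app_zero h, dV_form_app_zero h]

include hL
-- Both composites obey the same Leibniz rule along the multiplicative map `phi`, so agreement on
-- generators spreads by local generation.
theorem phi_intertwines (hT : OddOp T) (hT' : OddOp T') (pT : Preserves O T)
    (hcst : ∀ f, phi nabla 1 (T (cst f)) = T' (cst f))
    (hform : ∀ θ, phi nabla 1 (T (form θ)) = T' (form θ))
    (hdfun : ∀ f, phi nabla 1 (T (dfun O f)) = T' (dfun O f))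
    (hdV : ∀ θ, phi nabla 1 (T (dV O (fun _ _ => 0) (form θ))) = T' (dV O nabla (form θ)))
    {p q : ℕ} {c : Co R G X} (hc : Wint O c) (hs : Supp p q c) :
    phi nabla 1 (T c) = T' (phi nabla 1 c) := by
  have wc := fun f => Wint.cst (O := O) f
  have sc : ∀ f, Supp 0 0 (cst f : Co R G X) := Supp.cst
  have hcst' : ∀ f, phi nabla (1 : R) (cst f : Co R G X) = cst f :=
    fun f => phi_eq_self _ _ fun b => iB_cst b f
  have key := Wint.induction h
    (P := fun c => Wint O (T c) ∧ phi nabla 1 (T c) = T' (phi nabla 1 c))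
    (fun f => ⟨pT (wc f) (sc f), by rw [hcst, hcst']⟩)
    (fun θ => ⟨pT (Wint.form h θ) (Supp.form θ), by
      rw [hform, phi_eq_self _ _ fun b => iB_form θ b]⟩)
    (fun f => ⟨pT (Wint.dfun h f) (Supp.dfun O f), by rw [hdfun, phi_dfun]⟩)
    (fun θ => ⟨pT (Wint.dV_form h θ) ((Supp.form θ).dV h), by rw [hdV, phi_dV_form h]⟩)
    ?_ ?_ ?_ hc hs
  · exact key.2
  · rintro c d _ _ ⟨h1, h2⟩ ⟨h1', h2'⟩
    refine ⟨by rw [hT.add]; exact h1.add h1', ?_⟩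
    rw [hT.add, phi_add, h2, h2', phi_add, hT'.add]
  · rintro c d hc hd ⟨h1, h2⟩ ⟨h1', h2'⟩
    have hc' := hc.multi.anti
    have hd' := hd.multi.anti
    rw [hT.mul _ _ hc' hd']
    refine ⟨(h1.mul hd).add (hc.tw.mul h1'), ?_⟩
    rw [phi_add, phi_mul _ _ h1.multi.anti hd', phi_mul _ _ hc'.tw h1'.multi.anti, h2, h2',
      phi_mul _ _ hc' hd', hT'.mul _ _ (hc'.phi _ _) (hd'.phi _ _), phi_tw]
  · intro p q c hc hs hl
    refine ⟨pT hc hs, eq_of_local hL fun χ hχ => ?_⟩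
    obtain ⟨N, -, -, hN⟩ := hl χ hχ
    refine ⟨N, ?_⟩
    rw [hT.smul hc.multi.anti, phi_add, phi_mul _ _ (pT (wc _) (sc _)).multi.anti hc.multi.anti,
      phi_smul, phi_smul, hT'.smul (hc.multi.anti.phi _ _), hcst] at hN
    exact add_left_cancel hN

omit hL
theorem phi_dH_cst (f : R) : phi nabla 1 (dH O (fun _ _ => 0) (cst f)) = dH O nabla (cst f) := by
  rw [dH_cst h, dH_cst h, phi_eq_self _ _ fun b => iB_form _ b]

theorem phi_dH_form (θ : G →ₗ[R] R) :
    phi nabla 1 (dH O (fun _ _ => 0) (form θ)) = dH O nabla (form θ) := by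
  rw [phi_eq_self _ _ fun b => ((Supp.form θ).dH h).iB_eq_zero (.inr rfl) b]
  refine ((Supp.form θ).dH h).ext_of ((Supp.form θ).dH h) ?_
  intro w v u h1 h2 α β x
  obtain ⟨rfl, rfl, rfl⟩ : w = 2 ∧ v = 0 ∧ u = 0 := by omega
  rw [dH_form_app h, dH_form_app h]

include hL hn

theorem phi_dV {p q : ℕ} {c : Co R G X} (hc : Wint O c) (hs : Supp p q c) :
    phi nabla 1 (dV O (fun _ _ => 0) c) = dV O nabla (phi nabla 1 c) := by
  have hb : IsBiadditive nabla := ⟨hn.add_left, hn.add_right⟩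
  refine phi_intertwines h hL (dV_oddOp' h) (dV_oddOp' h) (dV_preserves h hL) (fun f => ?_)
    (fun θ => phi_dV_form h θ) (fun f => ?_) (fun θ => ?_) hc hs
  · rw [dV_cst h, dV_cst h, phi_dfun]
  · rw [← dV_cst h (nabla := fun _ _ => 0), dV_dV_cst h, phi_zero, dV_cst h,
      ← dV_cst h (nabla := nabla), dV_dV_cst h]
  · rw [dV_dV_form h (isBiadditive_zero h), dV_dV_form h hb, phi_zero]

/-- On vertical differentials of generators, anticommutation on both sides reduces the claim to
`phi_dV`. -/
theorem phi_dH {p q : ℕ} {c : Co R G X} (hc : Wint O c) (hs : Supp p q c) :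
    phi nabla 1 (dH O (fun _ _ => 0) c) = dH O nabla (phi nabla 1 c) := by
  have hb : IsBiadditive nabla := ⟨hn.add_left, hn.add_right⟩
  refine phi_intertwines h hL (dH_oddOp' h) (dH_oddOp' h) (dH_preserves h hL)
    (fun f => phi_dH_cst h f) (fun θ => phi_dH_form h θ) (fun f => ?_) (fun θ => ?_) hc hs
  · rw [← dV_cst h (nabla := fun _ _ => 0),
      eq_neg_of_add_eq_zero_left (dH_dV_cst h (isBiadditive_zero h) f), phi_neg, dH_cst h,
      phi_dV_form h, dV_cst h, ← dV_cst h (nabla := nabla),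
      eq_neg_of_add_eq_zero_left (dH_dV_cst h hb f), dH_cst h]
  · rw [eq_neg_of_add_eq_zero_left (dH_dV_form h (isBiadditive_zero h) θ), phi_neg,
      phi_dV h hL hn (Wint.dH_form h θ) ((Supp.form θ).dH h), phi_dH_form h,
      eq_neg_of_add_eq_zero_left (dH_dV_form h hb θ)]

/-- Every homogeneous tensorial cochain is a transform, so the identities below are inherited from
the intrinsic model without computing with curvatures. -/
theorem Wten.exists_phi {p q : ℕ} {c : Co R G X} (hc : Wten c) (hs : Supp p q c) :
    ∃ d, Wint O d ∧ Supp p q d ∧ Co.phi nabla 1 d = c := by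
  refine ⟨Co.phi nabla (-1 : R) c, Wten.phi hn h.act_algebraMap
    (fun f => (Wint.dfun h f).multi.anti) hc, hs.phi _ _, ?_⟩
  simpa using phi_phi nabla (-1 : R) hc.multi.anti

theorem Wten.dV {p q : ℕ} {c : Co R G X} (hc : Wten c) (hs : Supp p q c) :
    Wten (dV O nabla c) := by
  obtain ⟨d, hd, hs', rfl⟩ := hc.exists_phi h hL hn hs
  rw [← phi_dV h hL hn hd hs']
  exact (dV_preserves h hL hd hs').phi hn h.act_algebraMap

theorem Wten.dH {p q : ℕ} {c : Co R G X} (hc : Wten c) (hs : Supp p q c) :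
    Wten (dH O nabla c) := by
  obtain ⟨d, hd, hs', rfl⟩ := hc.exists_phi h hL hn hs
  rw [← phi_dH h hL hn hd hs']
  exact (dH_preserves h hL hd hs').phi hn h.act_algebraMap

theorem Wten.dV_dV {p q : ℕ} {c : Co R G X} (hc : Wten c) (hs : Supp p q c) :
    Co.dV O nabla (Co.dV O nabla c) = 0 := by
  obtain ⟨d, hd, hs', rfl⟩ := hc.exists_phi h hL hn hs
  rw [← phi_dV h hL hn hd hs', ← phi_dV h hL hn (dV_preserves h hL hd hs') (hs'.dV h),
    Co.dV_dV h hL hd hs', phi_zero]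

theorem Wten.dH_dH {p q : ℕ} {c : Co R G X} (hc : Wten c) (hs : Supp p q c) :
    Co.dH O nabla (Co.dH O nabla c) = 0 := by
  obtain ⟨d, hd, hs', rfl⟩ := hc.exists_phi h hL hn hs
  rw [← phi_dH h hL hn hd hs', ← phi_dH h hL hn (dH_preserves h hL hd hs') (hs'.dH h),
    Co.dH_dH h hL hd hs', phi_zero]

theorem Wten.dH_dV {p q : ℕ} {c : Co R G X} (hc : Wten c) (hs : Supp p q c) :
    Co.dH O nabla (Co.dV O nabla c) + Co.dV O nabla (Co.dH O nabla c) = 0 := by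
  obtain ⟨d, hd, hs', rfl⟩ := hc.exists_phi h hL hn hs
  rw [← phi_dV h hL hn hd hs', ← phi_dH h hL hn (dV_preserves h hL hd hs') (hs'.dV h),
    ← phi_dH h hL hn hd hs', ← phi_dV h hL hn (dH_preserves h hL hd hs') (hs'.dH h), ← phi_add,
    Co.dH_dV h hL hd hs', phi_zero]

omit hL hn

/-- For the zero map the basic connections are the brackets, and the basic curvature is zero, so its
insertion vanishes by linearity in the symmetric arguments. -/
theorem dHor_eq {c : Co R G X} (hc : Multi c) : dHor O c = dH O (fun _ _ => 0) c := by
  have hB : ∀ w v u α β x, c w (v + 1) u α (Fin.cons 0 β) x = 0 := by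
    intro w v u α β x
    have := congrArg (fun c : Co R G X => c w v u α β x) (hc.B_smul 0 0)
    simpa [iB_app] using this
  have hG : basForm O (fun _ _ => (0 : G)) = lieForm O := by
    funext α P v u β x
    simp only [basForm, lieForm, leibnizForm, basG, basX, h.anchor_zero, zero_add]
  have h0 : ∀ w v u α β x, basCurvTerm O (fun _ _ => (0 : G)) c w v u α β x = 0 := by
    intro w v u α β x
    unfold basCurvTerm
    split
    · refine Finset.sum_eq_zero fun _ _ => Finset.sum_eq_zero fun _ _ =>
        Finset.sum_eq_zero fun _ _ => ?_
      simp only [basCurv, h.zero_lie, h.lie_zero, sub_zero, add_zero, hB, mul_zero, ite_self]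
    · rfl
  funext w v u α β x
  change _ = koszul O.lieG (basForm O fun _ _ => 0) _ w α v u β x - _ + basCurvTerm O _ c w v u α β x
  rw [h0, hG, add_zero]
  rfl

/-- For the zero map every correction in the covariant derivative and the curvature term inserts `0`
into a multilinear argument. -/
theorem dVer_eq {c : Co R G X} (hc : Multi c) : dVer O c = dV O (fun _ _ => 0) c := by
  have hB : ∀ w v u α β x, c w (v + 1) u α (Fin.cons 0 β) x = 0 := by
    intro w v u α β x
    have := congrArg (fun c : Co R G X => c w v u α β x) (hc.B_smul 0 0)
    simpa [iB_app] using this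
  have hA : ∀ w v u α β x, c (w + 1) v u (Fin.cons 0 α) β x = 0 := by
    intro w v u α β x
    have := congrArg (fun c : Co R G X => c w v u α β x) (hc.A_smul 0 0)
    simpa [iA_app] using this
  have hB' : ∀ w v u α β x (j : Fin v), c w v u α (Function.update β j 0) x = 0 := by
    intro w v u α β x j
    cases v with
    | zero => exact j.elim0
    | succ v =>
      rw [show Function.update β j 0 = j.insertNth 0 (j.removeNth β) from
        (Fin.insertNth_removeNth j 0 β).symm, hc.anti.B, hB]
  have hA' : ∀ w v u α β x (j : Fin w), c w v u (Function.update α j 0) β x = 0 := by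
    intro w v u α β x j
    cases w with
    | zero => exact j.elim0
    | succ w =>
      have := (hc.anti.A v u β x).update w j α 0
      simpa [hA] using this
  have hD : ∀ (y : X) w v α β u x, nablaDual O (fun _ _ => (0 : G)) y
      (fun w' v' α' β' => c w' v' u α' β' x) w v α β = O.act y (c w v u α β x) := by
    intro y w v α β u x
    simp only [nablaDual, hA', hB', Finset.sum_const_zero, sub_zero]
  have h0 : ∀ w v u α β x, curvTerm O (fun _ _ => (0 : G)) c w v u α β x = 0 := by
    intro w v u α β x
    unfold curvTerm
    split
    · refine Finset.sum_eq_zero fun _ _ => Finset.sum_eq_zero fun _ _ =>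
        Finset.sum_eq_zero fun _ _ => ?_
      simp only [curv, sub_zero, hB, mul_zero, ite_self]
    · rfl
  funext w v u α β x
  change _ = (-1 : R) ^ w * koszul O.lieX (nablaDual O fun _ _ => 0) _ u x w v α β + _
    + curvTerm O _ c w v u α β x
  rw [h0, add_zero]
  change (-1 : R) ^ w * _ + _ = _
  congr 2
  match u, x with
  | 0, x => rfl
  | 1, x => exact (hD _ _ _ _ _ _ _).symm
  | u + 2, x =>
    simp only [koszul, Pi.add_apply, Finset.sum_apply, Pi.smul_apply, hD]
    congr 1
    refine Finset.sum_congr rfl fun j _ => Finset.sum_congr rfl fun i _ => ?_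
    split_ifs <;> rfl

end Operators

end Co

/-! ## The pieces of the two models -/

section Maps

variable {S R P : Type*} [CommRing S] [CommRing R] [Algebra S R] [AddCommGroup P] [Module S P]

theorem AlternatingMap.isAnti_sign {n : ℕ} (m : P [⋀^Fin (n + 1)]→ₗ[S] R) (i : Fin (n + 1)) (a : P)
    (x : Fin n → P) : m (i.insertNth a x) = (-1 : ℤ) ^ (i : ℕ) • m (Fin.cons a x) := by
  have h := m.map_perm (Fin.cons a x) i.cycleRange
  rw [Fin.cons_comp_cycleRange, Fin.sign_cycleRange] at h
  rw [h, Units.smul_def]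
  push_cast
  rfl

theorem IsAnti.exists_alternatingMap [Algebra ℝ R] {η : ∀ n, (Fin n → P) → R} (h : IsAnti η)
    (hadd : ∀ n a b x, η (n + 1) (Fin.cons (a + b) x) =
      η (n + 1) (Fin.cons a x) + η (n + 1) (Fin.cons b x))
    (hsmul : ∀ n (s : S) a x, η (n + 1) (Fin.cons (s • a) x) = s • η (n + 1) (Fin.cons a x))
    (n : ℕ) : ∃ m : P [⋀^Fin n]→ₗ[S] R, ∀ x, η n x = m x := by
  cases n with
  | zero => exact ⟨AlternatingMap.constOfIsEmpty S P (Fin 0) (η 0 ![]), fun x => by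
      rw [Subsingleton.elim x ![]]; rfl⟩
  | succ n =>
    refine ⟨⟨⟨η (n + 1), fun {D} v i a b => ?_, fun {D} v i s a => ?_⟩, fun v i j hv hij => ?_⟩,
      fun x => rfl⟩
    · rw [Subsingleton.elim D (instDecidableEqFin _), h.update, h.update, h.update, hadd, smul_add]
    · rw [Subsingleton.elim D (instDecidableEqFin _), h.update, h.update, hsmul, smul_comm]
    · obtain ⟨k, rfl⟩ := Fin.exists_succAbove_eq hij.symm
      cases n with
      | zero => exact k.elim0
      | succ n =>
        -- Antisymmetry gives vanishing on equal arguments because `2` is invertible in a real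
        -- algebra.
        have h1 : ∀ a (x : Fin n → P), η (n + 2) (Fin.cons a (Fin.cons a x)) = 0 := by
          intro a x
          have := congrFun (congrFun (h.contr_contr a a) n) x
          simp only [WeilAlgebra.contr, Pi.neg_apply] at this
          have e : (algebraMap ℝ R (1 / 2)) * (η (n + 2) (Fin.cons a (Fin.cons a x)) +
              η (n + 2) (Fin.cons a (Fin.cons a x))) = η (n + 2) (Fin.cons a (Fin.cons a x)) := by
            rw [← two_mul, ← mul_assoc, show (2 : R) = algebraMap ℝ R 2 from (map_ofNat _ 2).symm, ← map_mul]
            norm_num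
          rw [← e]
          nth_rewrite 1 [this]
          simp
        have h2 : v = i.insertNth (v i) (k.insertNth (v i) (k.removeNth (i.removeNth v))) := by
          have : k.insertNth (v i) (k.removeNth (i.removeNth v)) = i.removeNth v := by
            rw [hv]; exact Fin.insertNth_self_removeNth k (i.removeNth v)
          rw [this, Fin.insertNth_self_removeNth]
        have h3 := h (n + 1) i (v i) (k.insertNth (v i) (k.removeNth (i.removeNth v)))
        have h4 := h.contr (v i) n k (v i) (k.removeNth (i.removeNth v))
        simp only [WeilAlgebra.contr] at h4
        change η (n + 2) v = 0
        rw [h2, h3, h4, h1, smul_zero, smul_zero]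

theorem exists_multilinearMap {η : ∀ n, (Fin n → P) → R}
    (h : ∀ n (i : Fin (n + 1)) b x, η (n + 1) (i.insertNth b x) = η (n + 1) (Fin.cons b x))
    (hadd : ∀ n a b x, η (n + 1) (Fin.cons (a + b) x) =
      η (n + 1) (Fin.cons a x) + η (n + 1) (Fin.cons b x))
    (hsmul : ∀ n (s : S) a x, η (n + 1) (Fin.cons (s • a) x) = s • η (n + 1) (Fin.cons a x))
    (n : ℕ) : ∃ m : MultilinearMap S (fun _ : Fin n => P) R, ∀ x, η n x = m x := by
  cases n with
  | zero => exact ⟨MultilinearMap.constOfIsEmpty S _ (η 0 ![]), fun x => by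
      rw [Subsingleton.elim x ![]]; rfl⟩
  | succ n =>
    have hu : ∀ (v : Fin (n + 1) → P) i a, η (n + 1) (Function.update v i a) =
        η (n + 1) (Fin.cons a (i.removeNth v)) := fun v i a => by
      rw [← h, Fin.insertNth_removeNth]
    refine ⟨⟨η (n + 1), fun {D} v i a b => ?_, fun {D} v i s a => ?_⟩, fun x => rfl⟩
    · rw [Subsingleton.elim D (instDecidableEqFin _), hu, hu, hu, hadd]
    · rw [Subsingleton.elim D (instDecidableEqFin _), hu, hu, hsmul]

end Maps

/-- A permutation is composed of the cycle that brings its first value to the front and a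
permutation of the remaining positions, so invariance under moving one argument forward suffices. -/
theorem eq_comp_perm {P N : Type*} (n : ℕ) : ∀ {η : ∀ n, (Fin n → P) → N}
    (_ : ∀ n (i : Fin (n + 1)) b x, η (n + 1) (i.insertNth b x) = η (n + 1) (Fin.cons b x))
    (x : Fin n → P) (σ : Equiv.Perm (Fin n)), η n (x ∘ σ) = η n x := by
  induction n with
  | zero => exact fun _ x σ => by rw [Subsingleton.elim (x ∘ σ) x]
  | succ n ih =>
    intro η h x σ
    have hc : ∀ b n (i : Fin (n + 1)) a x,
        contr b η (n + 1) (i.insertNth a x) = contr b η (n + 1) (Fin.cons a x) := by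
      intro b n i a x
      have h1 := h (n + 1) i.succ a (Fin.cons b x)
      have h2 := h (n + 1) (Fin.succ 0) a (Fin.cons b x)
      rw [Fin.insertNth_succ_cons] at h1 h2
      rw [Fin.insertNth_zero'] at h2
      exact h1.trans h2.symm
    set j := σ 0
    obtain ⟨τ, hτ⟩ : ∃ τ, j.cycleRange * σ = Equiv.Perm.decomposeFin.symm (0, τ) := by
      obtain ⟨⟨p, τ⟩, hp⟩ := Equiv.Perm.decomposeFin.symm.surjective (j.cycleRange * σ)
      refine ⟨τ, ?_⟩
      have : (j.cycleRange * σ) 0 = 0 := by simp [j]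
      rw [← hp, Equiv.Perm.decomposeFin_symm_apply_zero] at this
      rw [← hp, this]
    have hx : x ∘ σ = Fin.cons (x j) (j.removeNth x ∘ τ) := by
      have hσ : σ = j.cycleRange.symm * Equiv.Perm.decomposeFin.symm (0, τ) := by
        rw [← hτ]; ext; simp
      funext k
      conv_lhs => rw [← Fin.insertNth_self_removeNth j x]
      rw [hσ]
      simp only [Function.comp_apply, Equiv.Perm.mul_apply]
      rw [Fin.insertNth_apply_cycleRange_symm]
      cases k using Fin.cases with
      | zero => simp
      | succ k => simp [Equiv.Perm.decomposeFin_symm_apply_succ]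
    rw [hx]
    refine (ih (hc (x j)) (j.removeNth x) τ).trans ?_
    change η (n + 1) (Fin.cons (x j) (j.removeNth x)) = _
    rw [← h, Fin.insertNth_self_removeNth]

namespace Co

section Pieces

variable {R G X : Type*} [CommRing R] {O : Operations R G X} [Algebra ℝ R] [AddCommGroup G]
  [Module R G] [AddCommGroup X] [Module R X]

theorem dWedge_eq_altSum (f : R) (η : ∀ u, (Fin u → X) → R) (u : ℕ) (x : Fin u → X) :
    dWedge O f η u x = altSum (fun y n x' => O.act y f * η n x') u x := by
  cases u with
  | zero => rfl
  | succ u => simp [dWedge, altSum, mul_assoc]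

theorem dfun_mul_eq_altX (f : R) (c : Co R G X) :
    dfun O f * c = altX (fun y c => O.act y f • c) c := by
  refine eq_of_kX (fun c => dfun O f * c) (altX fun y c => O.act y f • c) ?_ ?_ c
  · intro c w v α β x
    rw [altX_vanX]
    exact VanX.mul_right (dfun_vanX O f) c w v α β x
  · intro n ih c a w v α β x
    have := ih (kX a c) w v α β x
    rw [kX_altX_of_comm fun _ _ _ => kX_smul .., kX_mul]
    rw [add_app, sub_app, kX_dfun, cst_mul, tw_dfun, neg_mul, neg_app, this, sub_eq_add_neg]

/-- The sign `(-1) ^ w` comes from the one-form `df` passing the exterior arguments of the second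
factor. -/
theorem dfun_mul_app (f : R) (c : Co R G X) (w v u : ℕ) (α β) (x : Fin u → X) :
    (dfun O f * c) w v u α β x =
      (-1) ^ w * dWedge O f (fun n y => c w v n α β y) u x := by
  rw [dfun_mul_eq_altX, dWedge_eq_altSum]
  rfl

theorem Multi.isFormValued {p q : ℕ} {c : Co R G X} (hc : Multi c) (hs : Supp p q c) :
    IsFormValued p q (c : Cochain R G X) := by
  have hx := fun {a b : Co R G X} (h : a = b) w v u α β x =>
    congrFun (congrFun (congrFun (congrFun (congrFun (congrFun h w) v) u) α) β) x
  refine ⟨fun w v u h => ?_, fun w v u α β => ?_, fun w v u α x => ?_,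
    fun w v u α β x σ => ?_⟩
  · funext α β x
    exact hs w v u (by omega) α β x
  · have e : ∀ (a b : R), (-1 : R) ^ w * a = (-1) ^ w * b → a = b := fun a b h => by
      have := congrArg (fun r => (-1 : R) ^ w * r) h
      simpa [← mul_assoc, neg_one_pow_mul_self] using this
    refine IsAnti.exists_alternatingMap (hc.anti.X w v α β) (fun n a b y => ?_)
      (fun n r a y => ?_) u
    · refine e _ _ ((hx (hc.X_add a b) w v n α β y).trans ?_)
      simp only [add_app, kX_app]; ring
    · refine e _ _ ((hx (hc.X_smul r a) w v n α β y).trans ?_)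
      simp only [smul_app, kX_app, smul_eq_mul]; ring
  · exact exists_multilinearMap (η := fun n β => c w n u α β x)
      (fun n i b β => hc.anti.B w n u α i b β x)
      (fun n a b β => hx (hc.B_add a b) w n u α β x)
      (fun n r a β => hx (hc.B_smul r a) w n u α β x) v
  · exact eq_comp_perm (η := fun n β => c w n u α β x) v
      (fun n i b β => hc.anti.B w n u α i b β x) β σ

/-- The defining relation multiplies the last exterior argument by `f`, the relation of `Wint` the
first. Moving the argument costs `(-1) ^ w`, which cancels the sign in `dfun_mul_app`. -/
theorem mem_intrinsicPiece_iff [Module ℝ G] [IsScalarTower ℝ R G] {p q : ℕ} {c : Co R G X} :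
    c ∈ intrinsicPiece O p q ↔ Wint O c ∧ Supp p q c := by
  constructor
  · rintro ⟨⟨h1, h2, h3, h4⟩, h5, h6⟩
    have hA : ∀ v u β x, IsAnti fun n α => c n v u α β x := fun v u β x n i a α => by
      obtain ⟨m, hm⟩ := h5 (n + 1) v u β x
      simp only [hm]
      exact AlternatingMap.isAnti_sign m i a α
    refine ⟨⟨⟨⟨hA, fun w v u α i b β x => ?_, fun w v α β n i a x => ?_⟩, fun a b => ?_,
      fun r a => ?_, fun a b => ?_, fun r a => ?_, fun a b => ?_, fun r a => ?_⟩, fun f a => ?_⟩,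
      fun w v u h α β x => ?_⟩
    · rw [← h4 w (v + 1) u α (i.insertNth b β) x i.cycleRange.symm]
      congr 1
      funext k
      simp
    · obtain ⟨m, hm⟩ := h2 w v (n + 1) α β
      simp only [hm]
      exact AlternatingMap.isAnti_sign m i a x
    · ext w v u α β x
      obtain ⟨m, hm⟩ := h5 (w + 1) v u β x
      simp only [iA_app, hm, add_app]
      exact m.toMultilinearMap.cons_add _ _ _
    · ext w v u α β x
      obtain ⟨m, hm⟩ := h5 (w + 1) v u β x
      simp only [iA_app, hm, smul_app, algebraMap_smul, ← Algebra.smul_def]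
      exact m.toMultilinearMap.cons_smul _ _ _
    · ext w v u α β x
      obtain ⟨m, hm⟩ := h3 w (v + 1) u α x
      simp only [iB_app, hm, add_app]
      exact m.cons_add _ _ _
    · ext w v u α β x
      obtain ⟨m, hm⟩ := h3 w (v + 1) u α x
      simp only [iB_app, hm, smul_app]
      exact m.cons_smul _ _ _
    · ext w v u α β x
      obtain ⟨m, hm⟩ := h2 w v (u + 1) α β
      simp only [kX_app, hm, add_app, ← mul_add]
      exact congrArg _ (m.toMultilinearMap.cons_add _ _ _)
    · ext w v u α β x
      obtain ⟨m, hm⟩ := h2 w v (u + 1) α β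
      simp only [kX_app, hm, smul_app, mul_left_comm r]
      exact congrArg _ (m.toMultilinearMap.cons_smul _ _ _)
    · ext w v u α β x
      have h7 := h6 w v u α a f β x
      simp only [← Fin.insertNth_last'] at h7
      have e := fun a => hA v u β x w (Fin.last w) a α
      simp only [Fin.val_last, zsmul_eq_mul] at e
      rw [e, e] at h7
      simp only [iA_app, sub_app, smul_app, dfun_mul_app, iB_app]
      have h8 := congrArg (fun r => (-1 : R) ^ w * r) h7
      push_cast at h8
      simpa [mul_sub, mul_left_comm f, ← mul_assoc, neg_one_pow_mul_self] using h8
    · rw [h1 w v u (by omega)]; rfl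
  · rintro ⟨hc, hs⟩
    have hx := fun {a b : Co R G X} (h : a = b) w v u α β x =>
      congrFun (congrFun (congrFun (congrFun (congrFun (congrFun h w) v) u) α) β) x
    refine ⟨hc.multi.isFormValued hs, fun w v u β x => ?_, fun w v u α a f β x => ?_⟩
    · refine IsAnti.exists_alternatingMap (hc.multi.anti.A v u β x)
        (fun n a b α => hx (hc.multi.A_add a b) n v u α β x) (fun n r a α => ?_) w
      have := hx (hc.multi.A_smul r a) n v u α β x
      rw [algebraMap_smul] at this
      rw [Algebra.smul_def]
      exact this
    · have e := fun a => hc.multi.anti.A v u β x w (Fin.last w) a α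
      simp only [Fin.val_last, zsmul_eq_mul] at e
      simp only [← Fin.insertNth_last']
      rw [e, e]
      have h7 := hx (hc.leib f a) w v u α β x
      simp only [iA_app, sub_app, smul_app, dfun_mul_app, iB_app] at h7
      rw [h7]
      push_cast
      simp [mul_sub, mul_left_comm f, ← mul_assoc, neg_one_pow_mul_self]

theorem mem_tensorPiece_iff {p q : ℕ} {c : Co R G X} :
    c ∈ tensorPiece R G X p q ↔ Wten c ∧ Supp p q c := by
  constructor
  · rintro ⟨⟨h1, h2, h3, h4⟩, h5⟩
    have hs : ∀ (f : R) a, iA (f • a) c = f • iA a c := fun r a => by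
      ext w v u α β x
      obtain ⟨m, hm⟩ := h5 (w + 1) v u β x
      simp only [iA_app, hm, smul_app]
      exact m.toMultilinearMap.cons_smul _ _ _
    refine ⟨⟨⟨⟨fun v u β x n i a α => ?_, fun w v u α i b β x => ?_, fun w v α β n i a x => ?_⟩,
      fun a b => ?_, fun r a => hs _ a, fun a b => ?_, fun r a => ?_, fun a b => ?_,
      fun r a => ?_⟩, hs⟩, fun w v u h α β x => ?_⟩
    · obtain ⟨m, hm⟩ := h5 (n + 1) v u β x
      simp only [hm]
      exact AlternatingMap.isAnti_sign m i a α
    · rw [← h4 w (v + 1) u α (i.insertNth b β) x i.cycleRange.symm]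
      congr 1
      funext k
      simp
    · obtain ⟨m, hm⟩ := h2 w v (n + 1) α β
      simp only [hm]
      exact AlternatingMap.isAnti_sign m i a x
    · ext w v u α β x
      obtain ⟨m, hm⟩ := h5 (w + 1) v u β x
      simp only [iA_app, hm, add_app]
      exact m.toMultilinearMap.cons_add _ _ _
    · ext w v u α β x
      obtain ⟨m, hm⟩ := h3 w (v + 1) u α x
      simp only [iB_app, hm, add_app]
      exact m.cons_add _ _ _
    · ext w v u α β x
      obtain ⟨m, hm⟩ := h3 w (v + 1) u α x
      simp only [iB_app, hm, smul_app]
      exact m.cons_smul _ _ _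
    · ext w v u α β x
      obtain ⟨m, hm⟩ := h2 w v (u + 1) α β
      simp only [kX_app, hm, add_app, ← mul_add]
      exact congrArg _ (m.toMultilinearMap.cons_add _ _ _)
    · ext w v u α β x
      obtain ⟨m, hm⟩ := h2 w v (u + 1) α β
      simp only [kX_app, hm, smul_app, mul_left_comm r]
      exact congrArg _ (m.toMultilinearMap.cons_smul _ _ _)
    · rw [h1 w v u (by omega)]; rfl
  · rintro ⟨hc, hs⟩
    have hx := fun {a b : Co R G X} (h : a = b) w v u α β x =>
      congrFun (congrFun (congrFun (congrFun (congrFun (congrFun h w) v) u) α) β) x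
    exact ⟨hc.multi.isFormValued hs, fun w v u β x =>
      IsAnti.exists_alternatingMap (hc.multi.anti.A v u β x)
        (fun n a b α => hx (hc.multi.A_add a b) n v u α β x)
        (fun n r a α => hx (hc.lin r a) n v u α β x) w⟩

end Pieces

end Co

/-! ## The two differential bigraded algebras -/

section Total

variable {V : Type*} [AddCommGroup V] [Module ℝ V] {W : ℕ → ℕ → Submodule ℝ V}

theorem le_total (p q : ℕ) : W p q ≤ total W := le_iSup (fun pq : ℕ × ℕ => W pq.1 pq.2) (p, q)

end Total

namespace Co

variable {R G X : Type*} [CommRing R] [Algebra ℝ R]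

/-- The pieces are real subspaces of functions, while `Co` is treated as a module over the
functions; this reconciles the scalars. -/
theorem real_smul_eq (r : ℝ) (c : Cochain R G X) :
    r • c = (algebraMap ℝ R r • (c : Co R G X) : Co R G X) := by
  funext w v u α β x
  exact Algebra.smul_def r _

theorem add_eq (c d : Cochain R G X) :
    c + d = (HAdd.hAdd (α := Co R G X) (β := Co R G X) (γ := Co R G X) c d) := rfl

theorem mul_one_left (c : Co R G X) : mul one c = c := one_mul c

theorem mul_one_right (c : Co R G X) : mul c one = c := mul_one c

theorem neg_one_pow_real_smul (n : ℕ) (c : Cochain R G X) :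
    (-1 : ℝ) ^ n • c = ((-1 : R) ^ n • (c : Co R G X) : Co R G X) := by
  rw [real_smul_eq]; simp

theorem total_induction {W : ℕ → ℕ → Submodule ℝ (Cochain R G X)} {P : Co R G X → Prop}
    (mem : ∀ {p q} {c : Co R G X}, c ∈ W p q → P c) (zero : P 0)
    (add : ∀ {c d : Co R G X}, P c → P d → P (c + d)) {c : Co R G X} (hc : c ∈ total W) : P c :=
  Submodule.iSup_induction (fun pq : ℕ × ℕ => W pq.1 pq.2) (motive := fun c : Cochain R G X => P c)
    hc (fun _ _ hx => mem hx) zero fun _ _ h1 h2 => add h1 h2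

/-- The numbers of arguments `(w, v, u)` determine the bidegree, so different pieces have disjoint
supports. -/
theorem iSupIndep_of_supp {W : ℕ → ℕ → Submodule ℝ (Cochain R G X)}
    (hW : ∀ {p q} {c : Co R G X}, c ∈ W p q → Supp p q c) :
    iSupIndep fun pq : ℕ × ℕ => W pq.1 pq.2 := by
  rintro ⟨p, q⟩
  rw [Submodule.disjoint_def]
  intro c hc hc'
  have h : ∀ w v u, w + v = p ∧ u + v = q → ∀ α β x, c w v u α β x = 0 := by
    intro w v u h α β x
    refine Submodule.iSup_induction (fun i : ℕ × ℕ => ⨆ (_ : i ≠ (p, q)), W i.1 i.2)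
      (motive := fun c => c w v u α β x = 0) hc' ?_ rfl
      (fun c d h1 h2 => by simp [h1, h2])
    rintro ⟨p', q'⟩ d hd
    by_cases hpq : (p', q') = (p, q)
    · simp only [hpq, ne_eq, not_true_eq_false, iSup_false, Submodule.mem_bot] at hd
      rw [hd]; rfl
    · simp only [ne_eq, hpq, not_false_eq_true, iSup_pos] at hd
      refine hW hd w v u (fun h' => hpq ?_) α β x
      ext <;> simp <;> omega
  funext w v u α β x
  by_cases hw : w + v = p ∧ u + v = q
  · exact h w v u hw α β x
  · exact hW hc w v u hw α β x

/-- Common assembly for the two models: `Q` is membership without the grading, and `dh'`, `dv'` are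
derivations of the whole ring that agree with the prescribed differentials where `Q` holds. -/
theorem isDifferentialBigradedAlgebra {W : ℕ → ℕ → Submodule ℝ (Cochain R G X)}
    {Q : Co R G X → Prop} (hW : ∀ {p q} {c : Co R G X}, c ∈ W p q ↔ Q c ∧ Supp p q c)
    (hanti : ∀ {c}, Q c → Anti c) (hone : Q 1) (hadd : ∀ {c d}, Q c → Q d → Q (c + d))
    (hmul : ∀ {c d}, Q c → Q d → Q (c * d)) {dh dv : Cochain R G X → Cochain R G X}
    {dh' dv' : Co R G X → Co R G X} (ho : OddOp dh') (vo : OddOp dv')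
    (he : ∀ {c : Co R G X}, Q c → dh c = dh' c) (ve : ∀ {c : Co R G X}, Q c → dv c = dv' c)
    (hQ : ∀ {p q c}, Q c → Supp p q c → Q (dh' c)) (vQ : ∀ {p q c}, Q c → Supp p q c → Q (dv' c))
    (hS : ∀ {p q c}, Supp p q c → Supp (p + 1) q (dh' c))
    (vS : ∀ {p q c}, Supp p q c → Supp p (q + 1) (dv' c))
    (hr : ∀ r, dh' (cst (algebraMap ℝ R r)) = 0) (vr : ∀ r, dv' (cst (algebraMap ℝ R r)) = 0)
    (hh : ∀ {p q c}, Q c → Supp p q c → dh' (dh' c) = 0)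
    (vv : ∀ {p q c}, Q c → Supp p q c → dv' (dv' c) = 0)
    (hv : ∀ {p q c}, Q c → Supp p q c → dh' (dv' c) + dv' (dh' c) = 0) :
    IsDifferentialBigradedAlgebra W one mul dh dv := by
  have h0 : Q 0 := (hW.1 (W 0 0).zero_mem).1
  have tQ : ∀ {c : Co R G X}, c ∈ total W → Q c := fun hc =>
    total_induction (P := Q) (fun h => (hW.1 h).1) h0 hadd hc
  have hm : ∀ {p q} {c : Co R G X}, c ∈ W p q → dh c ∈ W (p + 1) q := fun {p q c} hc => by
    obtain ⟨h1, h2⟩ := hW.1 hc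
    rw [he h1]; exact hW.2 ⟨hQ h1 h2, hS h2⟩
  have vm : ∀ {p q} {c : Co R G X}, c ∈ W p q → dv c ∈ W p (q + 1) := fun {p q c} hc => by
    obtain ⟨h1, h2⟩ := hW.1 hc
    rw [ve h1]; exact hW.2 ⟨vQ h1 h2, vS h2⟩
  have tQh : ∀ {c : Co R G X}, c ∈ total W → Q (dh' c) := fun hc =>
    total_induction (P := fun c : Co R G X => Q (dh' c))
      (fun h => hQ (hW.1 h).1 (hW.1 h).2) (by rwa [ho.zero])
      (fun h1 h2 => by rw [ho.add]; exact hadd h1 h2) hc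
  have tQv : ∀ {c : Co R G X}, c ∈ total W → Q (dv' c) := fun hc =>
    total_induction (P := fun c : Co R G X => Q (dv' c))
      (fun h => vQ (hW.1 h).1 (hW.1 h).2) (by rwa [vo.zero])
      (fun h1 h2 => by rw [vo.add]; exact hadd h1 h2) hc
  have sq : ∀ {T : Co R G X → Co R G X}, (∀ c d, T (c + d) = T c + T d) →
      (∀ {p q c}, Q c → Supp p q c → T c = 0) → ∀ {c : Co R G X}, c ∈ total W → T c = 0 :=
    fun {T} hT hT' {c} hc => total_induction (P := fun c : Co R G X => T c = 0)
      (fun h => hT' (hW.1 h).1 (hW.1 h).2) (by simpa using hT 0 0)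
      (fun h1 h2 => by rw [hT, h1, h2, add_zero]) hc
  -- Real linearity is not a separate property: it follows from the Leibniz rule and the vanishing
  -- on real constants.
  have sm : ∀ {T : Co R G X → Co R G X}, OddOp T → (∀ r, T (cst (algebraMap ℝ R r)) = 0) →
      ∀ (r : ℝ) {c : Co R G X}, Q c → T (algebraMap ℝ R r • c) = algebraMap ℝ R r • T c :=
    by
    intro T hT h r c hc
    rw [← cst_mul, hT.mul _ _ (.cst _) (hanti hc), h, zero_mul, zero_add, tw_cst, cst_mul]
  have der : ∀ {T : Co R G X → Co R G X}, OddOp T → ∀ {p q c d}, Q c → Q d → Supp p q c →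
      T (c * d) = T c * d + (-1 : R) ^ (p + q) • (c * T d) := by
    intro T hT p q c d hc hd hs
    rw [hT.mul _ _ (hanti hc) (hanti hd), hs.tw_eq, smul_mul_assoc]
  have am : ∀ {d : Cochain R G X → Cochain R G X} {T : Co R G X → Co R G X}, OddOp T →
      (∀ {c : Co R G X}, Q c → d c = T c) → ∀ {x y : Cochain R G X}, x ∈ total W → y ∈ total W →
      d (x + y) = d x + d y := by
    intro d T hT e x y hx hy
    rw [add_eq, add_eq, e (tQ hx), e (tQ hy), e (tQ (add_eq x y ▸ Submodule.add_mem _ hx hy))]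
    exact hT.add x y
  have smm : ∀ {d : Cochain R G X → Cochain R G X} {T : Co R G X → Co R G X}, OddOp T →
      (∀ {c : Co R G X}, Q c → d c = T c) → (∀ r, T (cst (algebraMap ℝ R r)) = 0) →
      ∀ (r : ℝ) {x : Cochain R G X}, x ∈ total W → d (r • x) = r • d x := by
    intro d T hT e h r x hx
    rw [real_smul_eq, real_smul_eq]
    exact (e (tQ (real_smul_eq r x ▸ Submodule.smul_mem _ r hx))).trans
      ((sm hT h r (tQ hx)).trans
        (congrArg (fun z : Co R G X => algebraMap ℝ R r • z) (e (tQ hx)).symm))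
  exact
  { direct := iSupIndep_of_supp fun h => (hW.1 h).2
    one_mem := hW.2 ⟨hone, by rw [← one_def, ← cst_one]; exact .cst 1⟩
    mul_mem := fun hx hy => hW.2 ⟨hmul (hW.1 hx).1 (hW.1 hy).1, (hW.1 hx).2.mul (hW.1 hy).2⟩
    add_mul := fun {x y z} _ _ _ => add_mul' (x : Co R G X) y z
    mul_add := fun {x y z} _ _ _ => mul_add' (x : Co R G X) y z
    smul_mul := fun r x y _ _ => by
      rw [real_smul_eq, real_smul_eq]; exact smul_mul' (algebraMap ℝ R r) (x : Co R G X) y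
    mul_smul := fun r x y _ _ => by
      rw [real_smul_eq, real_smul_eq]; exact mul_smul' (algebraMap ℝ R r) (x : Co R G X) y
    one_mul := fun {x} _ => mul_one_left x
    mul_one := fun {x} _ => mul_one_right x
    mul_assoc := fun {x y z} _ _ _ => mul_assoc' x y z
    mul_comm := fun {p q p' q' x y} hx hy => by
      rw [neg_one_pow_real_smul]
      exact mul_comm_of_parity (p + q) (p' + q') (x : Co R G X) y (hW.1 hx).2.tw_eq
        (hW.1 hy).2.tw_eq
    dh_mem := hm
    dv_mem := vm
    dh_add := am ho he
    dv_add := am vo ve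
    dh_smul := smm ho he hr
    dv_smul := smm vo ve vr
    dh_dh := fun {x} hx => by
      rw [he (tQ hx), he (tQh hx)]
      exact sq (T := fun c => dh' (dh' c)) (fun c d => by simp only [ho.add]) hh hx
    dv_dv := fun {x} hx => by
      rw [ve (tQ hx), ve (tQv hx)]
      exact sq (T := fun c => dv' (dv' c)) (fun c d => by simp only [vo.add]) vv hx
    dh_dv := fun {x} hx => by
      rw [he (tQ hx), ve (tQ hx), he (tQv hx), ve (tQh hx)]
      exact sq (T := fun c => dh' (dv' c) + dv' (dh' c))
        (fun c d => by simp only [ho.add, vo.add]; abel) hv hx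
    dh_mul := fun {p q p' q' x y} hx hy => by
      obtain ⟨h1, h2⟩ := hW.1 hx
      obtain ⟨h3, h4⟩ := hW.1 hy
      rw [he h1, he h3, he (c := mul x y) (hmul h1 h3), neg_one_pow_real_smul]
      exact der ho h1 h3 h2
    dv_mul := fun {p q p' q' x y} hx hy => by
      obtain ⟨h1, h2⟩ := hW.1 hx
      obtain ⟨h3, h4⟩ := hW.1 hy
      rw [ve h1, ve h3, ve (c := mul x y) (hmul h1 h3), neg_one_pow_real_smul]
      exact der vo h1 h3 h2 }

/-! ### Both models satisfy the axioms -/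

section Models

variable [AddCommGroup G] [Module R G] [AddCommGroup X] [Module R X] {O : Operations R G X}
  (h : IsLieAlgebroid O) (hL : IsLocallyFramed O)
include h hL

theorem dV_cst_algebraMap {nabla : X → G → G} (r : ℝ) :
    dV O nabla (cst (algebraMap ℝ R r)) = 0 := by
  rw [dV_cst h, dfun_algebraMap h.act_algebraMap]

theorem dH_cst_algebraMap {nabla : X → G → G} (r : ℝ) :
    dH O nabla (cst (algebraMap ℝ R r)) = 0 := by
  rw [dH_cst h]
  refine (Supp.form _).eq_zero fun w v u h1 h2 α β x => ?_
  obtain ⟨rfl, rfl, rfl⟩ : w = 1 ∧ v = 0 ∧ u = 0 := by omega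
  exact h.act_algebraMap _ r

theorem isDifferentialBigradedAlgebra_intrinsicPiece [Module ℝ G] [IsScalarTower ℝ R G] :
    IsDifferentialBigradedAlgebra (intrinsicPiece O) one mul (dHor O) (dVer O) :=
  isDifferentialBigradedAlgebra mem_intrinsicPiece_iff (fun hc => hc.multi.anti)
    (by rw [← cst_one]; exact .cst 1) .add .mul (dH_oddOp' h) (dV_oddOp' h)
    (fun hc => dHor_eq h hc.multi) (fun hc => dVer_eq h hc.multi)
    (fun hc hs => dH_preserves h hL hc hs) (fun hc hs => dV_preserves h hL hc hs) (.dH h) (.dV h)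
    (dH_cst_algebraMap h hL) (dV_cst_algebraMap h hL)
    (dH_dH h hL) (dV_dV h hL) (dH_dV h hL)

theorem isDifferentialBigradedAlgebra_tensorPiece {nabla : X → G → G} (hn : IsConn O nabla) :
    IsDifferentialBigradedAlgebra (tensorPiece R G X) one mul (dHorConn O nabla)
      (dVerConn O nabla) :=
  isDifferentialBigradedAlgebra mem_tensorPiece_iff (fun hc => hc.multi.anti)
    (by rw [← cst_one]; exact .cst 1) .add .mul (dH_oddOp' h) (dV_oddOp' h)
    (fun _ => rfl) (fun _ => rfl)
    (Wten.dH h hL hn) (Wten.dV h hL hn) (.dH h) (.dV h)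
    (dH_cst_algebraMap h hL) (dV_cst_algebraMap h hL)
    (fun hc hs => hc.dH_dH h hL hn hs) (fun hc hs => hc.dV_dV h hL hn hs)
    (fun hc hs => hc.dH_dV h hL hn hs)

end Models

end Co

namespace Co

/-! ## The isomorphism between the two models -/

section Isomorphism

variable {R G X : Type*} [CommRing R] [Algebra ℝ R] [AddCommGroup G] [Module R G] [Module ℝ G]
  [IsScalarTower ℝ R G] [AddCommGroup X] [Module R X] {O : Operations R G X}

theorem Wint.mem_total {p q : ℕ} {c : Co R G X} (hc : Wint O c) (hs : Supp p q c) :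
    c ∈ total (intrinsicPiece O) :=
  le_total (V := Cochain R G X) p q (mem_intrinsicPiece_iff.2 ⟨hc, hs⟩)

theorem wint_of_mem_total {c : Co R G X} (hc : c ∈ total (intrinsicPiece O)) : Wint O c :=
  total_induction (fun h => (mem_intrinsicPiece_iff.1 h).1) .zero .add hc

omit [Module ℝ G] [IsScalarTower ℝ R G] in
theorem wten_of_mem_total {c : Co R G X} (hc : c ∈ total (tensorPiece R G X)) : Wten c :=
  total_induction (fun h => (mem_tensorPiece_iff.1 h).1) .zero .add hc

variable {nabla : X → G → G} (h : IsLieAlgebroid O) (hn : IsConn O nabla)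
include h hn

theorem phi_mem_tensorPiece_iff {p q : ℕ} {c : Co R G X} (hc : Wint O c) :
    phi nabla 1 c ∈ tensorPiece R G X p q ↔ c ∈ intrinsicPiece O p q := by
  rw [mem_tensorPiece_iff, mem_intrinsicPiece_iff]
  refine ⟨fun h' => ⟨hc, ?_⟩, fun h' => ⟨hc.phi hn h.act_algebraMap, h'.2.phi _ _⟩⟩
  rw [← phi_phi nabla 1 hc.multi.anti]
  exact h'.2.phi _ _

theorem phi_mem_total {c : Co R G X} (hc : c ∈ total (intrinsicPiece O)) :
    phi nabla 1 c ∈ total (tensorPiece R G X) := by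
  refine total_induction (P := fun c => phi nabla 1 c ∈ total (tensorPiece R G X)) (fun hc => ?_)
    ?_ (fun h1 h2 => ?_) hc
  · exact le_total (V := Cochain R G X) _ _ ((phi_mem_tensorPiece_iff h hn (mem_intrinsicPiece_iff.1 hc).1).2 hc)
  · rw [phi_zero]; exact Submodule.zero_mem _
  · rw [phi_add]; exact Submodule.add_mem _ h1 h2

theorem phi_neg_mem_total {c : Co R G X} (hc : c ∈ total (tensorPiece R G X)) :
    phi nabla (-1) c ∈ total (intrinsicPiece O) := by
  refine total_induction (P := fun c => phi nabla (-1) c ∈ total (intrinsicPiece O)) (fun hc => ?_)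
    ?_ (fun h1 h2 => ?_) hc
  · obtain ⟨h1, h2⟩ := mem_tensorPiece_iff.1 hc
    exact Wint.mem_total (h1.phi hn h.act_algebraMap fun f => (Wint.dfun h f).multi.anti)
      (h2.phi _ _)
  · rw [phi_zero]; exact Submodule.zero_mem _
  · rw [phi_add]; exact Submodule.add_mem _ h1 h2

/-- The isomorphism from the intrinsic model to the connection dependent one. -/
def phiEquiv : total (intrinsicPiece O) ≃ₗ[ℝ] total (tensorPiece R G X) where
  toFun c := ⟨phi nabla 1 c.1, phi_mem_total h hn c.2⟩
  invFun c := ⟨phi nabla (-1) c.1, phi_neg_mem_total h hn c.2⟩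
  map_add' c d := Subtype.ext (phi_add nabla 1 _ _)
  map_smul' r c := Subtype.ext <| by
    change phi nabla 1 (r • c.1) =
      HSMul.hSMul (α := ℝ) (β := Cochain R G X) (γ := Cochain R G X) r (phi nabla 1 c.1)
    exact (congrArg (phi nabla 1) (real_smul_eq r c.1)).trans
      ((phi_smul nabla 1 _ _).trans (real_smul_eq r (phi nabla 1 c.1)).symm)
  left_inv c := Subtype.ext (phi_phi nabla 1 (wint_of_mem_total c.2).multi.anti)
  right_inv c := Subtype.ext <| by
    have := phi_phi nabla (-1 : R) (wten_of_mem_total c.2).multi.anti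
    rwa [neg_neg] at this

variable (hL : IsLocallyFramed O)
include hL

theorem phi_dVer {c : Co R G X} (hc : c ∈ total (intrinsicPiece O)) :
    phi nabla 1 (dVer O c) = dVerConn O nabla (phi nabla 1 c) := by
  rw [dVer_eq h (wint_of_mem_total hc).multi]
  change phi nabla 1 (dV O (fun _ _ => 0) c) = dV O nabla (phi nabla 1 c)
  refine total_induction (P := fun c => phi nabla 1 (dV O (fun _ _ => 0) c) =
    dV O nabla (phi nabla 1 c)) (fun hc => ?_) ?_ (fun h1 h2 => ?_) hc
  · obtain ⟨h1, h2⟩ := mem_intrinsicPiece_iff.1 hc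
    exact phi_dV h hL hn h1 h2
  · rw [(dV_oddOp' h).zero, phi_zero, (dV_oddOp' h).zero]
  · rw [(dV_oddOp' h).add, phi_add, h1, h2, phi_add, (dV_oddOp' h).add]

theorem phi_dHor {c : Co R G X} (hc : c ∈ total (intrinsicPiece O)) :
    phi nabla 1 (dHor O c) = dHorConn O nabla (phi nabla 1 c) := by
  rw [dHor_eq h (wint_of_mem_total hc).multi]
  change phi nabla 1 (dH O (fun _ _ => 0) c) = dH O nabla (phi nabla 1 c)
  refine total_induction (P := fun c => phi nabla 1 (dH O (fun _ _ => 0) c) =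
    dH O nabla (phi nabla 1 c)) (fun hc => ?_) ?_ (fun h1 h2 => ?_) hc
  · obtain ⟨h1, h2⟩ := mem_intrinsicPiece_iff.1 hc
    exact phi_dH h hL hn h1 h2
  · rw [(dH_oddOp' h).zero, phi_zero, (dH_oddOp' h).zero]
  · rw [(dH_oddOp' h).add, phi_add, h1, h2, phi_add, (dH_oddOp' h).add]

theorem phiEquiv_isDBGAIso :
    IsDBGAIso one mul (dHor O) (dVer O) one mul (dHorConn O nabla) (dVerConn O nabla)
      (phiEquiv h hn) where
  map_mem p q x := (phi_mem_tensorPiece_iff h hn (wint_of_mem_total x.2)).symm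
  map_one x hx := by
    change phi nabla 1 x.1 = one
    rw [hx]
    refine phi_eq_self nabla 1 (c := (1 : Co R G X)) fun b => ?_
    rw [← cst_one, iB_cst]
  map_mul x y z hz := by
    change phi nabla 1 z.1 = mul (phi nabla 1 x.1) (phi nabla 1 y.1)
    rw [hz]
    exact phi_mul nabla 1 (wint_of_mem_total x.2).multi.anti (wint_of_mem_total y.2).multi.anti
  map_dh x y hy := by
    change phi nabla 1 y.1 = dHorConn O nabla (phi nabla 1 x.1)
    rw [hy]
    exact phi_dHor h hn hL x.2
  map_dv x y hy := by
    change phi nabla 1 y.1 = dVerConn O nabla (phi nabla 1 x.1)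
    rw [hy]
    exact phi_dVer h hn hL x.2

/-- Compatibility with `d^ver` fixes the value on `d^ver θ`, and the other generators lie in the
bidegrees where the map is prescribed. Local generation and multiplicativity do the rest; the
formula in bidegree `(1, 1)` is not needed. -/
theorem eq_phiEquiv {ψ : total (intrinsicPiece O) ≃ₗ[ℝ] total (tensorPiece R G X)}
    (hψ : IsDBGAIso one mul (dHor O) (dVer O) one mul (dHorConn O nabla) (dVerConn O nabla) ψ)
    (hψ' : ∀ c : total (intrinsicPiece O), c.1 ∈ intrinsicPiece O 0 0 ∨
      c.1 ∈ intrinsicPiece O 1 0 ∨ c.1 ∈ intrinsicPiece O 0 1 → (ψ c).1 = c.1) :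
    ψ = phiEquiv h hn := by
  let P : Co R G X → Prop := fun c =>
    ∃ hc : c ∈ total (intrinsicPiece O), (ψ ⟨c, hc⟩).1 = phi nabla 1 c
  have add : ∀ {c d : Co R G X}, P c → P d → P (c + d) := by
    rintro c d ⟨hc, h1⟩ ⟨hd, h2⟩
    refine ⟨Submodule.add_mem _ hc hd, ?_⟩
    rw [phi_add, ← h1, ← h2]
    exact congrArg Subtype.val (map_add ψ ⟨c, hc⟩ ⟨d, hd⟩)
  have cst : ∀ f, P (cst f) := fun f =>
    ⟨(Wint.cst f).mem_total (.cst f), by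
      rw [phi_eq_self nabla 1 fun b => iB_cst b _]
      exact hψ' _ (.inl (mem_intrinsicPiece_iff.2 ⟨.cst f, .cst f⟩))⟩
  have form : ∀ θ, P (form θ) := fun θ =>
    ⟨(Wint.form h θ).mem_total (.form θ), by
      rw [phi_eq_self nabla 1 fun b => iB_form θ b]
      exact hψ' _ (.inr (.inl (mem_intrinsicPiece_iff.2 ⟨.form h θ, .form θ⟩)))⟩
  let T : Co R G X → Prop := fun c => c ∈ total (intrinsicPiece O)
  have T0 : T 0 := Submodule.zero_mem _
  have Tadd : ∀ {c d : Co R G X}, T c → T d → T (c + d) := Submodule.add_mem _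
  have mulmem : ∀ {c d : Co R G X}, c ∈ total (intrinsicPiece O) → d ∈ total (intrinsicPiece O) →
      c * d ∈ total (intrinsicPiece O) := by
    intro c d hc hd
    refine total_induction (P := fun c => T (c * d)) (fun {p q c} hc => ?_)
      ?_ (fun h1 h2 => ?_) hc
    · obtain ⟨h1, h2⟩ := mem_intrinsicPiece_iff.1 hc
      refine total_induction (P := fun d => T (c * d))
        (fun {p' q' d} hd => ?_) ?_ (fun h1 h2 => ?_) hd
      · obtain ⟨h3, h4⟩ := mem_intrinsicPiece_iff.1 hd
        exact (h1.mul h3).mem_total (h2.mul h4)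
      · rwa [mul_zero]
      · rw [mul_add]; exact Tadd h1 h2
    · rwa [zero_mul]
    · rw [add_mul]; exact Tadd h1 h2
  have main : ∀ {p q} {c : Co R G X}, c ∈ intrinsicPiece O p q → P c := by
    intro p q c hc
    obtain ⟨hc, hs⟩ := mem_intrinsicPiece_iff.1 hc
    refine Wint.induction h (P := P) cst form (fun f => ?_) (fun θ => ?_)
      (fun c d _ _ => add) (fun c d _ _ => ?_) (fun p q c hc hs hloc => ?_) hc hs
    · refine ⟨(Wint.dfun h f).mem_total (.dfun O f), ?_⟩
      rw [phi_dfun]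
      exact hψ' _ (.inr (.inr (mem_intrinsicPiece_iff.2 ⟨.dfun h f, .dfun O f⟩)))
    · obtain ⟨hf, e⟩ := form θ
      refine ⟨(Wint.dV_form h θ).mem_total ((Supp.form θ).dV h), ?_⟩
      rw [hψ.map_dv ⟨Co.form θ, hf⟩ _ (dVer_eq h (Wint.form h θ).multi).symm, e,
        phi_dV h hL hn (.form h θ) (.form θ)]
      rfl
    · rintro ⟨h1, e1⟩ ⟨h2, e2⟩
      refine ⟨mulmem h1 h2, ?_⟩
      rw [phi_mul nabla 1 (wint_of_mem_total h1).multi.anti (wint_of_mem_total h2).multi.anti,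
        ← e1, ← e2]
      exact hψ.map_mul ⟨c, h1⟩ ⟨d, h2⟩ _ rfl
    · have hm := hc.mem_total hs
      refine ⟨hm, ?_⟩
      -- As `ψ` is multiplicative and fixes functions, it is linear over functions, so equality for
      -- `χ ^ N • c` is equality for `c` up to the factor `χ ^ N`.
      have key : ∀ χ, IsFramed O χ → ∃ N : ℕ, χ ^ N • ((ψ ⟨c, hm⟩).1 : Co R G X) =
          χ ^ N • phi nabla 1 c := by
        intro χ hχ
        obtain ⟨N, -, hm', e⟩ := hloc χ hχ
        obtain ⟨h1, e1⟩ := cst (χ ^ N)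
        refine ⟨N, ?_⟩
        rw [← phi_smul, ← e,
          hψ.map_mul ⟨_, h1⟩ ⟨c, hm⟩ ⟨_, hm'⟩ (cst_mul (χ ^ N) c).symm, e1,
          phi_eq_self nabla 1 fun b => iB_cst b _]
        exact (cst_mul (χ ^ N) ((ψ ⟨c, hm⟩).1 : Co R G X)).symm
      exact eq_of_local (c := ((ψ ⟨c, hm⟩).1 : Co R G X)) hL key
  refine LinearEquiv.ext fun c => Subtype.ext ?_
  have : P c.1 := total_induction (P := P) main
    ⟨Submodule.zero_mem _, by rw [phi_zero]; exact congrArg Subtype.val (map_zero ψ)⟩ add c.2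
  exact this.2

theorem existsUnique_iso :
    ∃! φ : total (intrinsicPiece O) ≃ₗ[ℝ] total (tensorPiece R G X),
      IsDBGAIso one mul (dHor O) (dVer O) one mul (dHorConn O nabla) (dVerConn O nabla) φ ∧
      (∀ c : total (intrinsicPiece O), c.1 ∈ intrinsicPiece O 0 0 ∨ c.1 ∈ intrinsicPiece O 1 0 ∨
        c.1 ∈ intrinsicPiece O 0 1 → (φ c).1 = c.1) ∧
      ∀ c : total (intrinsicPiece O), c.1 ∈ intrinsicPiece O 1 1 →
        (∀ (a : G) (y : X), (φ c).1 1 0 1 ![a] ![] ![y] =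
          c.1 1 0 1 ![a] ![] ![y] + c.1 0 1 0 ![] ![nabla y a] ![]) ∧
        (φ c).1 0 1 0 = c.1 0 1 0 := by
  refine ⟨phiEquiv h hn, ⟨phiEquiv_isDBGAIso h hn hL, fun c hc => ?_, fun c _ => ⟨fun a y => ?_, ?_⟩⟩,
    fun ψ hψ => eq_phiEquiv h hn hL hψ.1 hψ.2.1⟩
  · obtain ⟨p, q, hpq, hs⟩ : ∃ p q, (p = 0 ∨ q = 0) ∧ Supp p q c.1 := by
      rcases hc with hc | hc | hc
      · exact ⟨0, 0, .inl rfl, (mem_intrinsicPiece_iff.1 hc).2⟩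
      · exact ⟨1, 0, .inr rfl, (mem_intrinsicPiece_iff.1 hc).2⟩
      · exact ⟨0, 1, .inl rfl, (mem_intrinsicPiece_iff.1 hc).2⟩
    exact phi_eq_self nabla 1 fun b => hs.iB_eq_zero hpq b
  · refine (phi_app_one nabla 1 c.1 ![a] ![] ![y]).trans ?_
    rw [one_mul]
    rfl
  · funext α β x
    exact phi_zero_app nabla 1 c.1 1 0 α β x

end Isomorphism

end Co

/-! ## The operations of a Lie algebroid -/

section Calculus

variable {n : ℕ} {M : Type*} [TopologicalSpace M] [ChartedSpace (EuclideanSpace ℝ (Fin n)) M]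

theorem SmoothFun.mdifferentiableAt (f : SmoothFun n M) (x : M) :
    MDifferentiableAt (𝓡 n) 𝓘(ℝ, ℝ) f x := f.contMDiff.mdifferentiableAt (by simp)

section Module

variable {F : Type*} [NormedAddCommGroup F] [NormedSpace ℝ F]
  {A : M → Type*} [TopologicalSpace (Bundle.TotalSpace F A)]
  [∀ x, AddCommGroup (A x)] [∀ x, Module ℝ (A x)] [∀ x, TopologicalSpace (A x)]
  [FiberBundle F A] [VectorBundle ℝ F A]

theorem Sections.smul_apply (f : SmoothFun n M) (s : Sections n F A) (x : M) :
    (f • s) x = f x • s x := rfl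

instance : IsScalarTower ℝ (SmoothFun n M) (Sections n F A) where
  smul_assoc r f s := by ext x; exact smul_assoc r (f x) (s x)

theorem Sections.sum_apply {ι : Type*} (t : Finset ι) (s : ι → Sections n F A) (x : M) :
    (∑ i ∈ t, s i) x = ∑ i ∈ t, s i x :=
  map_sum ({ toFun := fun s => s x, map_zero' := rfl, map_add' := fun _ _ => rfl } :
    Sections n F A →+ A x) s t

end Module

variable [IsManifold (𝓡 n) ∞ M]

theorem VectorFields.mdifferentiableAt (X : VectorFields n M) (x : M) :
    MDifferentiableAt (𝓡 n) (𝓡 n).tangent (fun x => (X x : TangentBundle (𝓡 n) M)) x :=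
  X.contMDiff.mdifferentiableAt (by simp)

theorem actFun_apply (X : VectorFields n M) (f : SmoothFun n M) (x : M) :
    actFun X f x = mvfderiv (𝓡 n) f x (X x) := rfl

theorem actFun_add (X : VectorFields n M) (f g : SmoothFun n M) :
    actFun X (f + g) = actFun X f + actFun X g := by
  ext x
  change mvfderiv (𝓡 n) (⇑f + ⇑g) x (X x) = _
  rw [mvfderiv_add (f.mdifferentiableAt x) (g.mdifferentiableAt x)]
  rfl

theorem actFun_mul (X : VectorFields n M) (f g : SmoothFun n M) :
    actFun X (f * g) = actFun X f * g + f * actFun X g := by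
  ext x
  change mvfderiv (𝓡 n) (⇑f * ⇑g) x (X x) = mvfderiv (𝓡 n) f x (X x) * g x +
    f x * mvfderiv (𝓡 n) g x (X x)
  rw [mvfderiv_mul (f.mdifferentiableAt x) (g.mdifferentiableAt x)]
  simp only [add_apply, smul_apply, smul_eq_mul]
  ring

theorem actFun_algebraMap (X : VectorFields n M) (r : ℝ) :
    actFun X (algebraMap ℝ (SmoothFun n M) r) = 0 := by
  ext x
  change mvfderiv (𝓡 n) (fun _ : M => r) x (X x) = 0
  rw [mvfderiv_const]
  rfl

theorem actFun_add_left (X Y : VectorFields n M) (f : SmoothFun n M) :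
    actFun (X + Y) f = actFun X f + actFun Y f := by
  ext x
  exact map_add (mvfderiv (𝓡 n) f x) (X x) (Y x)

theorem actFun_smul_left (g : SmoothFun n M) (X : VectorFields n M) (f : SmoothFun n M) :
    actFun (g • X) f = g * actFun X f := by
  ext x
  exact map_smul (mvfderiv (𝓡 n) f x) (g x) (X x)

theorem lieField_smul (X Y : VectorFields n M) (f : SmoothFun n M) :
    lieField X (f • Y) = f • lieField X Y + actFun X f • Y := by
  ext1 x
  change VectorField.mlieBracket (𝓡 n) X (⇑f • ⇑Y) x = f x • VectorField.mlieBracket (𝓡 n) X Y x +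
    mvfderiv (𝓡 n) f x (X x) • Y x
  rw [VectorField.mlieBracket_smul_right (f.mdifferentiableAt x) (Y.mdifferentiableAt x), add_comm]

theorem lieField_add (X Y Z : VectorFields n M) :
    lieField X (Y + Z) = lieField X Y + lieField X Z := by
  ext1 x
  exact VectorField.mlieBracket_add_right (Y.mdifferentiableAt x) (Z.mdifferentiableAt x)

theorem lieField_jacobi (X Y Z : VectorFields n M) :
    lieField X (lieField Y Z) = lieField (lieField X Y) Z + lieField Y (lieField X Z) := by
  have h : minSmoothness ℝ 2 ≤ (∞ : ℕ∞ω) := by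
    simpa using (WithTop.coe_le_coe.2 le_top : ((2 : ℕ∞) : ℕ∞ω) ≤ ∞)
  have h3 : minSmoothness ℝ 3 ≤ (∞ : ℕ∞ω) := by
    simpa using (WithTop.coe_le_coe.2 le_top : ((3 : ℕ∞) : ℕ∞ω) ≤ ∞)
  have : IsManifold (𝓡 n) (minSmoothness ℝ 3) M := IsManifold.of_le h3
  ext1 x
  exact VectorField.leibniz_identity_mlieBracket_apply (X.contMDiff.of_le h x)
    (Y.contMDiff.of_le h x) (Z.contMDiff.of_le h x)

end Calculus

/-- The representation on functions which is forced by the Jacobi and Leibniz identities. -/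
theorem smul_eq_zero_of_jacobi {R G : Type*} [CommRing R] [AddCommGroup G] [Module R G]
    (br : G → G → G) (act : G → R → R) (hadd : ∀ a b d, br a (b + d) = br a b + br a d)
    (hsmul : ∀ a b (f : R), br a (f • b) = f • br a b + act a f • b)
    (hjac : ∀ a b d, br a (br b d) = br (br a b) d + br b (br a d)) (a b d : G) (f : R) :
    (act (br a b) f - (act a (act b f) - act b (act a f))) • d = 0 := by
  have h := hjac a b (f • d)
  simp only [hsmul, hadd, hjac a b d, smul_add] at h
  rw [sub_smul, sub_smul, sub_eq_zero]
  have h' := sub_eq_zero.2 h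
  rw [← sub_eq_zero, ← neg_eq_zero, ← h']
  abel

/-! ## Local frames and coordinates -/

section Frames

open Bundle

variable {n : ℕ} {M : Type*} [TopologicalSpace M] [ChartedSpace (EuclideanSpace ℝ (Fin n)) M]
  [IsManifold (𝓡 n) ∞ M] [T2Space M]

/-- Away from the support of the bump function the product vanishes, and on a neighbourhood of it
both factors are smooth. -/
theorem SmoothBumpFunction.contMDiff_mul_of_tsupport {x₀ : M} (ψ : SmoothBumpFunction (𝓡 n) x₀)
    {u : Set M} (hu : IsOpen u) (hψ : tsupport ψ ⊆ u) {g : M → ℝ}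
    (hg : ContMDiffOn (𝓡 n) 𝓘(ℝ, ℝ) ∞ g u) : ContMDiff (𝓡 n) 𝓘(ℝ, ℝ) ∞ fun x => ψ x * g x := by
  refine contMDiff_of_tsupport fun x hx => ?_
  have : x ∈ u := hψ (tsupport_smul_subset_left (ψ : M → ℝ) g hx)
  exact ψ.contMDiffAt.mul (hg.contMDiffAt (hu.mem_nhds this))

variable {F : Type*} [NormedAddCommGroup F] [NormedSpace ℝ F] [FiniteDimensional ℝ F]
  {A : M → Type*} [TopologicalSpace (TotalSpace F A)]
  [∀ x, AddCommGroup (A x)] [∀ x, Module ℝ (A x)] [∀ x, TopologicalSpace (A x)]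
  [FiberBundle F A] [VectorBundle ℝ F A] [ContMDiffVectorBundle ∞ F A (𝓡 n)]

variable (A) in
/-- The local frame at `x₀`, cut off by a bump function. -/
noncomputable def frameSection {x₀ : M} (ψ : SmoothBumpFunction (𝓡 n) x₀)
    (hψ : tsupport ψ ⊆ (trivializationAt F A x₀).baseSet) {ι : Type*} (b : Module.Basis ι ℝ F)
    (i : ι) : Sections n F A :=
  ⟨fun x => ψ x • (trivializationAt F A x₀).localFrame b i x,
    ContMDiffOn.smul_section_of_tsupport ψ.contMDiff.contMDiffOn
      (trivializationAt F A x₀).open_baseSet hψ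
      ((trivializationAt F A x₀).contMDiffOn_localFrame_baseSet ∞ b i)⟩

variable (A) in
/-- The coefficients in the local frame at `x₀`, cut off by a bump function. -/
noncomputable def frameCoeff {x₀ : M} (ψ : SmoothBumpFunction (𝓡 n) x₀)
    (hψ : tsupport ψ ⊆ (trivializationAt F A x₀).baseSet) {ι : Type*} (b : Module.Basis ι ℝ F)
    (i : ι) : Sections n F A →ₗ[SmoothFun n M] SmoothFun n M where
  toFun a := ⟨fun x => ψ x * (trivializationAt F A x₀).localFrameCoeff (𝓡 n) b i x (a x),
    SmoothBumpFunction.contMDiff_mul_of_tsupport ψ (trivializationAt F A x₀).open_baseSet hψ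
      (contMDiffOn_baseSet_localFrameCoeff b a.contMDiff.contMDiffOn i)⟩
  map_add' a b := by
    ext x
    exact (congrArg (ψ x * ·) (map_add _ (a x) (b x))).trans (mul_add _ _ _)
  map_smul' f a := by
    ext x
    exact (congrArg (ψ x * ·) (map_smul _ (f x) (a x))).trans (mul_left_comm _ _ _)

theorem sum_frameCoeff_smul {x₀ : M} (ψ : SmoothBumpFunction (𝓡 n) x₀)
    (hψ : tsupport ψ ⊆ (trivializationAt F A x₀).baseSet) {ι : Type*} [Fintype ι]
    (b : Module.Basis ι ℝ F) (a : Sections n F A) {x : M} (hx : ψ x = 1) :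
    ∑ i, frameCoeff A ψ hψ b i a x • frameSection A ψ hψ b i x = a x := by
  have hx' : x ∈ (trivializationAt F A x₀).baseSet :=
    hψ (subset_tsupport _ (by simp [Function.mem_support, hx]))
  rw [(trivializationAt F A x₀).eq_sum_localFrameCoeff_smul (I := 𝓡 n) (b := b) (s := a) hx']
  refine Finset.sum_congr rfl fun i _ => ?_
  change (ψ x * (trivializationAt F A x₀).localFrameCoeff (𝓡 n) b i x (a x)) •
    (ψ x • (trivializationAt F A x₀).localFrame b i x) = _
  rw [hx, one_mul, one_smul]

/-- A coordinate function at `x₀`, cut off by a bump function. -/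
noncomputable def coordFun {x₀ : M} (ψ : SmoothBumpFunction (𝓡 n) x₀) (i : Fin n) :
    SmoothFun n M :=
  ⟨fun x => ψ x * extChartAt (𝓡 n) x₀ x i,
    SmoothBumpFunction.contMDiff_mul_of_tsupport ψ (chartAt _ x₀).open_source
      ψ.tsupport_subset_chartAt_source
      ((EuclideanSpace.proj i : EuclideanSpace ℝ (Fin n) →L[ℝ] ℝ).contMDiff.comp_contMDiffOn
        contMDiffOn_extChartAt)⟩

/-- Where the cut-off is locally `1`, the differential of the coordinate functions is the
trivialisation of the tangent bundle given by the chart. A neighbourhood is required, since the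
cut-off is differentiated as well. -/
theorem actFun_coordFun {x₀ : M} (ψ : SmoothBumpFunction (𝓡 n) x₀) (i : Fin n)
    (hψ : tsupport ψ ⊆ (trivializationAt (EuclideanSpace ℝ (Fin n)) (TangentSpace (𝓡 n)) x₀).baseSet)
    (y : VectorFields n M) {x : M} (hx : ∀ᶠ x' in nhds x, ψ x' = 1) :
    actFun y (coordFun ψ i) x =
      frameCoeff (TangentSpace (𝓡 n)) ψ hψ (EuclideanSpace.basisFun (Fin n) ℝ).toBasis i y x := by
  have hs : x ∈ (chartAt (EuclideanSpace ℝ (Fin n)) x₀).source :=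
    ψ.tsupport_subset_chartAt_source (subset_tsupport _ (by simp [Function.mem_support, hx.self_of_nhds]))
  have hs' : x ∈ (trivializationAt (EuclideanSpace ℝ (Fin n)) (TangentSpace (𝓡 n)) x₀).baseSet := by
    simpa using hs
  have h1 : (coordFun ψ i : M → ℝ) =ᶠ[nhds x]
      (EuclideanSpace.proj i : EuclideanSpace ℝ (Fin n) →L[ℝ] ℝ) ∘ extChartAt (𝓡 n) x₀ :=
    hx.mono fun x' h => by
      change ψ x' * extChartAt (𝓡 n) x₀ x' i = extChartAt (𝓡 n) x₀ x' i
      rw [h, one_mul]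
  have h2 : mfderiv (𝓡 n) 𝓘(ℝ, ℝ) (coordFun ψ i) x =
      (EuclideanSpace.proj i : EuclideanSpace ℝ (Fin n) →L[ℝ] ℝ) ∘L
        mfderiv (𝓡 n) 𝓘(ℝ, EuclideanSpace ℝ (Fin n)) (extChartAt (𝓡 n) x₀) x := by
    rw [h1.mfderiv_eq, mfderiv_comp x
      (EuclideanSpace.proj i : EuclideanSpace ℝ (Fin n) →L[ℝ] ℝ).mdifferentiableAt
      (mdifferentiableAt_extChartAt hs), ContinuousLinearMap.mfderiv_eq]
    rfl
  have h3 : actFun y (coordFun ψ i) x =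
      (EuclideanSpace.proj i : EuclideanSpace ℝ (Fin n) →L[ℝ] ℝ)
        (mfderiv (𝓡 n) 𝓘(ℝ, EuclideanSpace ℝ (Fin n)) (extChartAt (𝓡 n) x₀) x (y x)) :=
    congrArg (fun T => T (y x)) h2
  rw [h3, ← TangentBundle.continuousLinearMapAt_trivializationAt hs]
  change _ = ψ x * (trivializationAt _ (TangentSpace (𝓡 n)) x₀).localFrameCoeff (𝓡 n) _ i x (y x)
  rw [hx.self_of_nhds, one_mul, Trivialization.localFrameCoeff_eq_coeff _ hs']
  have h4 : (trivializationAt (EuclideanSpace ℝ (Fin n)) (TangentSpace (𝓡 n)) x₀).continuousLinearMapAt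
      ℝ x (y x) = (trivializationAt (EuclideanSpace ℝ (Fin n)) (TangentSpace (𝓡 n)) x₀ ⟨x, y x⟩).2 := by
    rw [Trivialization.continuousLinearMapAt_apply, Trivialization.linearMapAt_apply, if_pos hs']
  exact congrArg (fun v : EuclideanSpace ℝ (Fin n) => v i) h4

/-- The functions which are supported in a region where frames and coordinates exist. -/
theorem exists_isFramed (L : LieAlgebroid n F A) (x₀ : M) :
    ∃ χ : SmoothFun n M, IsFramed L.ops χ ∧ χ x₀ = 1 := by
  obtain ⟨ψ, -, hψ⟩ := (SmoothBumpFunction.nhds_basis_tsupport (I := 𝓡 n) x₀).mem_iff.1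
    ((trivializationAt F A x₀).open_baseSet.mem_nhds (FiberBundle.mem_baseSet_trivializationAt' x₀))
  have hψ' : tsupport ψ ⊆
      (trivializationAt (EuclideanSpace ℝ (Fin n)) (TangentSpace (𝓡 n)) x₀).baseSet := by
    simpa using ψ.tsupport_subset_chartAt_source
  -- The second bump function is supported where the first is locally constant equal to `1`, so on
  -- its support the global cut-off frames and coordinates act as honest local ones.
  obtain ⟨χ, -, hχ⟩ := (SmoothBumpFunction.nhds_basis_tsupport (I := 𝓡 n) x₀).mem_iff.1
    (eventually_eventually_nhds.2 ψ.eventuallyEq_one)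
  have hχ' : ∀ x, χ x ≠ 0 → ∀ᶠ x' in nhds x, ψ x' = 1 := fun x hx => hχ (subset_tsupport _ hx)
  refine ⟨⟨χ, χ.contMDiff⟩, ⟨⟨_, frameSection A ψ hψ (Module.finBasis ℝ F),
    frameCoeff A ψ hψ (Module.finBasis ℝ F), fun a => ?_⟩,
    ⟨n, frameSection (TangentSpace (𝓡 n)) ψ hψ' (EuclideanSpace.basisFun (Fin n) ℝ).toBasis,
      coordFun ψ, fun y => ?_⟩⟩, χ.eq_one⟩
  · ext1 x
    change χ x • a x = χ x • _
    by_cases hx : χ x = 0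
    · rw [hx, zero_smul, zero_smul]
    · rw [Sections.sum_apply]
      exact congrArg (χ x • ·) (sum_frameCoeff_smul ψ hψ _ a (hχ' x hx).self_of_nhds).symm
  · ext1 x
    change χ x • y x = χ x • _
    by_cases hx : χ x = 0
    · rw [hx, zero_smul, zero_smul]
    · rw [Sections.sum_apply, ← sum_frameCoeff_smul ψ hψ' (EuclideanSpace.basisFun (Fin n) ℝ).toBasis
        y (hχ' x hx).self_of_nhds]
      refine congrArg (χ x • ·) (Finset.sum_congr rfl fun i _ => ?_)
      rw [← actFun_coordFun ψ i hψ' y (hχ' x hx)]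
      rfl

theorem isLocallyFramed (L : LieAlgebroid n F A) : IsLocallyFramed L.ops := by
  intro r hr
  ext x₀
  obtain ⟨χ, hχ, h1⟩ := exists_isFramed L x₀
  obtain ⟨N, hN⟩ := hr χ hχ
  have : (χ x₀) ^ N * r x₀ = 0 := by
    have := congrArg (fun f : SmoothFun n M => f x₀) hN
    simpa using this
  simpa [h1] using this

end Frames

/-! ## The identities of a Lie algebroid -/

section LieAlgebroid

open Bundle

variable {n : ℕ} {M : Type*} [TopologicalSpace M] [ChartedSpace (EuclideanSpace ℝ (Fin n)) M]
  [IsManifold (𝓡 n) ∞ M]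

theorem actFun_apply_of_eq_zero {X : VectorFields n M} {x : M} (hX : X x = 0)
    (f : SmoothFun n M) : actFun X f x = 0 := by
  rw [actFun_apply, hX, map_zero]

/-- The Jacobi and Leibniz identities give this at each point where some vector field is nonzero. At
a point where all of them vanish, so do all derivatives along them. -/
theorem actFun_lieField (X Y : VectorFields n M) (f : SmoothFun n M) :
    actFun (lieField X Y) f = actFun X (actFun Y f) - actFun Y (actFun X f) := by
  ext x
  by_cases h : ∃ Z : VectorFields n M, Z x ≠ 0
  · obtain ⟨Z, hZ⟩ := h
    have := congrArg (fun V : VectorFields n M => V x)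
      (smul_eq_zero_of_jacobi lieField actFun lieField_add lieField_smul lieField_jacobi X Y Z f)
    exact sub_eq_zero.1 ((smul_eq_zero.1 this).resolve_right hZ)
  · push Not at h
    refine (actFun_apply_of_eq_zero (h _) f).trans ?_
    change 0 = actFun X (actFun Y f) x - actFun Y (actFun X f) x
    rw [actFun_apply_of_eq_zero (h X), actFun_apply_of_eq_zero (h Y), sub_zero]

variable [T2Space M] {F : Type*} [NormedAddCommGroup F] [NormedSpace ℝ F] [FiniteDimensional ℝ F]
  {A : M → Type*} [TopologicalSpace (TotalSpace F A)]
  [∀ x, AddCommGroup (A x)] [∀ x, Module ℝ (A x)] [∀ x, TopologicalSpace (A x)]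
  [FiberBundle F A] [VectorBundle ℝ F A] [ContMDiffVectorBundle ∞ F A (𝓡 n)]
  (L : LieAlgebroid n F A)
include L

/-- Near a point a vector field is recovered from its action on finitely many cut-off coordinates.
-/
theorem VectorFields.ext_actFun {X Y : VectorFields n M} (h : ∀ f, actFun X f = actFun Y f) :
    X = Y := by
  ext1 x
  obtain ⟨χ, ⟨-, m, e, g, hg⟩, h1⟩ := exists_isFramed L x
  have : χ • X = χ • Y := by
    rw [hg X, hg Y]
    simp only [LieAlgebroid.ops, h]
  have := congrArg (fun V : VectorFields n M => V x) this
  simpa [Sections.smul_apply, h1] using this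

omit [T2Space M] [FiniteDimensional ℝ F] [ContMDiffVectorBundle ∞ F A (𝓡 n)] in
theorem LieAlgebroid.lie_smul (α β : Sections n F A) (f : SmoothFun n M) :
    L.lie α (f • β) = f • L.lie α β + actFun (L.anchorSection α) f • β := by
  ext x
  exact L.leibniz α β f x

/-- Compatibility of the anchor with brackets is not an axiom. Tested on functions, it follows from
Jacobi and Leibniz where some section is nonzero; elsewhere the anchor of every section vanishes. -/
theorem LieAlgebroid.anchorSection_lie (α β : Sections n F A) :
    L.anchorSection (L.lie α β) = lieField (L.anchorSection α) (L.anchorSection β) := by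
  refine VectorFields.ext_actFun L fun f => ?_
  rw [actFun_lieField]
  ext x
  by_cases h : ∃ γ : Sections n F A, γ x ≠ 0
  · obtain ⟨γ, hγ⟩ := h
    have := congrArg (fun s : Sections n F A => s x)
      (smul_eq_zero_of_jacobi L.lie (fun a => actFun (L.anchorSection a)) L.lie_add L.lie_smul
        L.jacobi α β γ f)
    exact sub_eq_zero.1 ((smul_eq_zero.1 this).resolve_right hγ)
  · push Not at h
    have h' : ∀ γ, L.anchorSection γ x = 0 := fun γ =>
      (congrArg (L.anchor x) (h γ)).trans (map_zero _)
    refine (actFun_apply_of_eq_zero (h' _) f).trans ?_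
    change 0 = actFun (L.anchorSection α) (actFun (L.anchorSection β) f) x -
      actFun (L.anchorSection β) (actFun (L.anchorSection α) f) x
    rw [actFun_apply_of_eq_zero (h' α), actFun_apply_of_eq_zero (h' β), sub_zero]

theorem isLieAlgebroid : IsLieAlgebroid L.ops where
  act_add := actFun_add
  act_mul := actFun_mul
  act_add_left := actFun_add_left
  act_smul_left := actFun_smul_left
  act_algebraMap := actFun_algebraMap
  act_lieX := actFun_lieField
  anchor_add α β := by ext1 x; exact map_add (L.anchor x) (α x) (β x)
  anchor_smul f α := by ext1 x; exact map_smul (L.anchor x) (f x) (α x)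
  lie_add_left := L.add_lie
  lie_add_right := L.lie_add
  lie_self := L.lie_self
  jacobi := L.jacobi
  lie_smul := L.lie_smul
  anchor_lie := L.anchorSection_lie

omit [T2Space M] [FiniteDimensional ℝ F] [ContMDiffVectorBundle ∞ F A (𝓡 n)] in
theorem isConn (D : Connection n F A) : Co.IsConn L.ops D.nabla where
  add_left := D.add_left
  smul_left := D.smul_left
  add_right := D.add_right
  leibniz x f a := D.leibniz f x a

end LieAlgebroid

end WeilAlgebra

/-! ### The theorem for Lie algebroids over manifolds -/

open WeilAlgebra in
theorem mainTheorem8 {n : ℕ} {M : Type*} [TopologicalSpace M]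
    [ChartedSpace (EuclideanSpace ℝ (Fin n)) M] [IsManifold (𝓡 n) ∞ M]
    [T2Space M] [SecondCountableTopology M]
    {F : Type*} [NormedAddCommGroup F] [NormedSpace ℝ F] [FiniteDimensional ℝ F]
    {A : M → Type*} [TopologicalSpace (Bundle.TotalSpace F A)]
    [∀ x, AddCommGroup (A x)] [∀ x, Module ℝ (A x)] [∀ x, TopologicalSpace (A x)]
    [FiberBundle F A] [VectorBundle ℝ F A] [ContMDiffVectorBundle ∞ F A (𝓡 n)]
    (L : LieAlgebroid n F A) :
    IsDifferentialBigradedAlgebra (intrinsicPiece L.ops) one mul (dHor L.ops) (dVer L.ops) ∧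
    ∀ D : Connection n F A,
      IsDifferentialBigradedAlgebra
        (tensorPiece (SmoothFun n M) (Sections n F A) (VectorFields n M)) one mul
        (dHorConn L.ops D.nabla) (dVerConn L.ops D.nabla) ∧
      ∃! φ : total (intrinsicPiece L.ops) ≃ₗ[ℝ]
          total (tensorPiece (SmoothFun n M) (Sections n F A) (VectorFields n M)),
        IsDBGAIso one mul (dHor L.ops) (dVer L.ops)
          one mul (dHorConn L.ops D.nabla) (dVerConn L.ops D.nabla) φ ∧
        (∀ c : total (intrinsicPiece L.ops),
          c.1 ∈ intrinsicPiece L.ops 0 0 ∨ c.1 ∈ intrinsicPiece L.ops 1 0 ∨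
            c.1 ∈ intrinsicPiece L.ops 0 1 → (φ c).1 = c.1) ∧
        ∀ c : total (intrinsicPiece L.ops), c.1 ∈ intrinsicPiece L.ops 1 1 →
          (∀ (α : Sections n F A) (X : VectorFields n M),
            (φ c).1 1 0 1 ![α] ![] ![X] =
              c.1 1 0 1 ![α] ![] ![X] + c.1 0 1 0 ![] ![D.nabla X α] ![]) ∧
          (φ c).1 0 1 0 = c.1 0 1 0 := by
  have h := isLieAlgebroid L
  have hL := isLocallyFramed L
  exact ⟨Co.isDifferentialBigradedAlgebra_intrinsicPiece h hL, fun D =>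
    ⟨Co.isDifferentialBigradedAlgebra_tensorPiece h hL (isConn L D),
      Co.existsUnique_iso h (isConn L D) hL⟩⟩
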